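/- Let $n\ge 0$. Notation: for $z,w\in\mathbb C^n$ put $zw=z\cdot w=\sum_k z_kw_k$, and let $dm$ be Lebesgue measure on $\mathbb C^n\cong\mathbb R^{2n}$. Let $\mathcal F$ be the Fock space of entire functions $f$ on $\mathbb C^n$ with $(2\pi)^{-n}\int|f(z)|^2e^{-|z|^2/2}\,dm(z)<\infty$, and let $\mathcal B:L^2(\mathbb R^n)\to\mathcal F$, $$(\mathcal B\varphi)(z)=\pi^{-n/4}\int_{\mathbb R^n}\exp\left(-\tfrac14z^2+zx-\tfrac12x^2\right)\varphi(x)\,dx,$$ be the (unitary) Bargmann transform. For $k=\begin{pmatrix}P&Q\\ \bar Q&\bar P\end{pmatrix}\in Sp(n,\mathbb C)\cap SU(n,n)$ let $\sigma(k)$ be the operator on $\mathcal F$ $$(\sigma(k)f)(z)=(2\pi)^{-n}\int_{\mathbb C^n}b_k(z,w)f(w)e^{-|w|^2/2}\,dm(w),$$ $$b_k(z,w)=(\det P)^{-1/2}\exp\left(\tfrac14\left(z\cdot\bar QP^{-1}z+2z\cdot(P^t)^{-1}\bar w-\bar w\cdot P^{-1}Q\bar w\right)\right),$$ with the principal square root.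 For $g\in Sp(n,\mathbb R)$ let $\sigma'(g)=\mathcal B^{-1}\sigma(UgU^{-1})\mathcal B$ on $L^2(\mathbb R^n)$, where $U=\begin{pmatrix}I_n&iI_n\\I_n&-iI_n\end{pmatrix}$ (the metaplectic representation). For $X\in sp(n,\mathbb R)$ let $d\sigma'(X)\varphi=\frac{d}{dt}\big|_{t=0}\sigma'(\exp(tX))\varphi$ (derivative in $L^2(\mathbb R^n)$), defined on all $\varphi\in L^2(\mathbb R^n)$ for which this derivative exists. The classical Weyl correspondence $\mathcal W$ on polynomial functions on $\mathbb R^{2n}$ with complex coefficients is linear in the symbol and given, for $f(x,y)=u(x)y^\alpha$ with $u$ a polynomial and $\alpha$ a multi-index, by $$(\mathcal W(f)\varphi)(p)=\left(i\frac{\partial}{\partial s}\right)^{\alpha}\left(u(p+\tfrac12s)\,\varphi(p+s)\right)\Big|_{s=0}.$$ If there is exactly one polynomial $f$ such that the Schwartz space $\mathcal S(\mathbb R^n)$ is contained in the domain of an operator $T$ on $L^2(\mathbb R^n)$ and $T\varphi=\mathcal W(f)\varphi$ for all $\varphi\in\mathcal S(\mathbb R^n)$, we write $W_1(T)=f$ and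 call it the classical Weyl symbol of $T$. Proposition. Let $X=\begin{pmatrix}A&B\\C&-A^t\end{pmatrix}\in sp(n,\mathbb R)$ and $J=\begin{pmatrix}0&I_n\\-I_n&0\end{pmatrix}$. Then the operator $d\sigma'(X)$ has exactly one polynomial Weyl symbol (in particular $\mathcal S(\mathbb R^n)$ is contained in its domain), and for all $x,y\in\mathbb R^n$ $$W_1(d\sigma'(X))(x,y)=\tfrac12i\left(2y\cdot Ax+y\cdot By-x\cdot Cx\right)=-\tfrac12i\begin{pmatrix}x&y\end{pmatrix}JX\begin{pmatrix}x\\y\end{pmatrix}.$$ -/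

import Mathlib

open MeasureTheory
open scoped SchwartzMap Matrix

noncomputable section

/-- The Hilbert space `L²(ℝⁿ)`. -/
abbrev L2 (n : ℕ) : Type := Lp ℂ 2 (volume : Measure (EuclideanSpace ℝ (Fin n)))

/-- The Bargmann transform (parameter `λ = 1`)
`(ℬφ)(z) = π^{-n/4} ∫ exp(-z²/4 + z·x - x²/2) φ(x) dx`, with `z² = ∑ₖ zₖ²`.
It is an isometry of `L²(ℝⁿ)` onto the Fock space of the entire functions `f` on `ℂⁿ` with
`(2π)^{-n} ∫ |f(z)|² e^{-|z|²/2} dm(z) < ∞`. -/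
def bargmann {n : ℕ} (φ : L2 n) (z : Fin n → ℂ) : ℂ :=
  ((Real.pi ^ (-(n : ℝ) / 4) : ℝ) : ℂ) *
    ∫ x : EuclideanSpace ℝ (Fin n),
      Complex.exp (-(1 / 4) * ∑ k, z k ^ 2 + ∑ k, z k * (x k : ℂ) - (1 / 2) * ∑ k, (x k : ℂ) ^ 2)
        * φ x

/-- The inverse `ℬ⁻¹` of the Bargmann transform (meaningful on the range of `ℬ`, the Fock space). -/
def bargmannInv {n : ℕ} (f : (Fin n → ℂ) → ℂ) : L2 n :=
  Function.invFun (bargmann (n := n)) f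

/-- The kernel of the metaplectic operator `σ(k)` on the Fock space, `k = (P Q; Q̄ P̄)`:
`(det P)^{-1/2} exp(¼(z·Q̄P⁻¹z + 2 z·(Pᵗ)⁻¹w̄ - w̄·P⁻¹Qw̄))`, with the principal square root. -/
def metaplecticKernel {n : ℕ} (k : Matrix (Fin n ⊕ Fin n) (Fin n ⊕ Fin n) ℂ)
    (z w : Fin n → ℂ) : ℂ :=
  k.toBlocks₁₁.det ^ (-(1 / 2) : ℂ) *
    Complex.exp ((1 / 4) *
      (z ⬝ᵥ ((k.toBlocks₁₂.map star * k.toBlocks₁₁⁻¹) *ᵥ z)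
        + 2 * (z ⬝ᵥ ((k.toBlocks₁₁ᵀ)⁻¹ *ᵥ star w))
        - star w ⬝ᵥ ((k.toBlocks₁₁⁻¹ * k.toBlocks₁₂) *ᵥ star w)))

/-- The metaplectic operator `σ(k)` for `k ∈ Sp(n,ℂ) ∩ SU(n,n)`, acting on the Fock space:
`(σ(k)f)(z) = (2π)^{-n} ∫ b_k(z,w) f(w) e^{-|w|²/2} dm(w)`. -/
def fockMetaplectic {n : ℕ} (k : Matrix (Fin n ⊕ Fin n) (Fin n ⊕ Fin n) ℂ)
    (f : (Fin n → ℂ) → ℂ) (z : Fin n → ℂ) : ℂ :=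
  (((2 * Real.pi) ^ n)⁻¹ : ℝ) *
    ∫ w : Fin n → ℂ,
      metaplecticKernel k z w * f w * (Real.exp (-(1 / 2) * ∑ j, ‖w j‖ ^ 2) : ℂ)

/-- The matrix `U = (I iI; I -iI)`; `g ↦ U g U⁻¹` maps `Sp(n,ℝ)` onto `Sp(n,ℂ) ∩ SU(n,n)`. -/
def cayleyU (n : ℕ) : Matrix (Fin n ⊕ Fin n) (Fin n ⊕ Fin n) ℂ :=
  Matrix.fromBlocks 1 (Complex.I • 1) 1 (-(Complex.I • 1))

/-- The metaplectic operator `σ'(g) = ℬ⁻¹ σ(U g U⁻¹) ℬ` on `L²(ℝⁿ)`, for `g ∈ Sp(n,ℝ)`. -/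
def metaplectic {n : ℕ} (g : Matrix (Fin n ⊕ Fin n) (Fin n ⊕ Fin n) ℝ) (φ : L2 n) : L2 n :=
  bargmannInv (fockMetaplectic (cayleyU n * g.map Complex.ofReal * (cayleyU n)⁻¹) (bargmann φ))

/-- The differential `dσ'(X)φ = d/dt σ'(exp(tX))φ` at `t = 0` (derivative in the norm of `L²(ℝⁿ)`),
an unbounded operator whose domain consists of all `φ` for which the derivative exists. -/
def dMetaplectic {n : ℕ} (X : Matrix (Fin n ⊕ Fin n) (Fin n ⊕ Fin n) ℝ) : L2 n →. L2 n :=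
  fun φ =>
    ⟨DifferentiableAt ℝ (fun t : ℝ => metaplectic (NormedSpace.exp (t • X)) φ) 0,
      fun _ => deriv (fun t : ℝ => metaplectic (NormedSpace.exp (t • X)) φ) 0⟩

/-- The operator `(i ∂/∂s)^α` for a multi-index `α`. -/
def iPartialPow {n : ℕ} (α : Fin n → ℕ) (g : EuclideanSpace ℝ (Fin n) → ℂ) :
    EuclideanSpace ℝ (Fin n) → ℂ :=
  (List.finRange n).foldr
    (fun j h => (fun (u : EuclideanSpace ℝ (Fin n) → ℂ) s =>
      Complex.I * lineDeriv ℝ u s (EuclideanSpace.single j 1))^[α j] h) g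

/-- The classical Weyl correspondence `𝒲` on polynomial symbols `f(x, y)` on `ℝ²ⁿ` (the variables
`x` are indexed by `Sum.inl`, the variables `y` by `Sum.inr`). It is linear in `f`, and
`(𝒲(u(x)y^α)φ)(p) = (i ∂/∂s)^α (u(p + s/2) φ(p + s))` at `s = 0`. -/
def weylOp {n : ℕ} (f : MvPolynomial (Fin n ⊕ Fin n) ℂ) (φ : EuclideanSpace ℝ (Fin n) → ℂ)
    (p : EuclideanSpace ℝ (Fin n)) : ℂ :=
  ∑ m ∈ f.support, f.coeff m *
    iPartialPow (fun j => m (Sum.inr j))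
      (fun s => (∏ j, ((p j + s j / 2 : ℝ) : ℂ) ^ m (Sum.inl j)) * φ (p + s)) 0

/-- `f` is a Weyl symbol of the unbounded operator `T` on `L²(ℝⁿ)`: the domain of `T` contains the
Schwartz space, and `T = 𝒲(f)` there. -/
def IsWeylSymbol {n : ℕ} (T : L2 n →. L2 n) (f : MvPolynomial (Fin n ⊕ Fin n) ℂ) : Prop :=
  ∀ φ : 𝓢(EuclideanSpace ℝ (Fin n), ℂ), ∃ ψ ∈ T (φ.toLp 2), ψ =ᵐ[volume] weylOp f φ

/-- The inverse `W₁` of the Weyl correspondence: `W₁(T)` is the function on `ℝ²ⁿ` given by the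
polynomial `f` with `𝒲(f) = T` (meaningful when there is exactly one). -/
def weylSymbol {n : ℕ} (T : L2 n →. L2 n) (x y : Fin n → ℝ) : ℂ :=
  MvPolynomial.eval (Sum.elim (fun j => (x j : ℂ)) (fun j => (y j : ℂ)))
    (Classical.epsilon (IsWeylSymbol T))

/-- The matrix `J = (0 I; -I 0)`. -/
def standardJ (n : ℕ) : Matrix (Fin n ⊕ Fin n) (Fin n ⊕ Fin n) ℝ :=
  Matrix.fromBlocks 0 1 (-1) 0

end

/-! The value `bargmann φ z` is the inner product of `φ` with a Gaussian vector `coherent z`, and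
these vectors have the reproducing kernel `e^{z·w̄/2}` as Gram matrix. The Bargmann transform is
injective, because on imaginary arguments it is, up to nonvanishing factors, the Fourier transform
of `e^{-x²/2} φ`. Injectivity suffices to evaluate `bargmannInv`: once some `ψ` in `L²` is exhibited
with `ℬψ = σ(k)ℬφ`, it is `metaplectic g φ`.

For Schwartz `φ` such a `ψ` is the Bochner integral of `b_k(z,w) (ℬφ)(w) e^{-|z|²/2} e^{-|w|²/2}
coherent z` over `z` and `w`, up to the factor `(2π)^{-2n}`; the reproducing property in `z` shows
that its transform is `σ(k)ℬφ`. The operator differential is therefore the derivative at `t = 0` of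
an `L²`-valued integral, and dominated differentiation applies once there is a majorant uniform in
`t`. It comes from two facts. Invariance of the form of signature `(n,n)` bounds the kernel by
`e^{(|z|²+|w|²)/4}` with a Gaussian gain away from `z̄ = Sz + Rw̄`
(`scatteringBound_of_signatureForm`), and since `S` is small near `t = 0` this converts growth in
`z` into growth in `w`. The growth in `w` is absorbed by `ℬφ`, which decays faster than any power
relative to `e^{|w|²/4}` (`schwartzBargmann_rapid_decay`).

The derivative of the kernel at `t = 0` is a quadratic polynomial in `z` and `w̄` times
`e^{z·w̄/2}`. Under `ℬ`, multiplication by `z_j` is the creation operator `x_j - ∂_j`, and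
integration against `w̄_j` is the annihilation operator `x_j + ∂_j`. So the generator is a normally
ordered quadratic expression in these operators (`hasDerivAt_metaplectic`). Rewriting it in `x` and
`∂` gives the Weyl quantization of the stated quadratic form; the trace term from `(det P)^{-1/2}`
compensates the passage from normal to symmetric ordering (`ladderOp_apply_eq_weylOp`).

Uniqueness of the symbol: the commutator of `𝒲(f)` with `x_k` is `i𝒲(∂f/∂y_k)` up to sign. Induction
on the degree in `y` reduces to symbols in `x` alone, which act by multiplication
(`eq_zero_of_weylLinear_eq_zero`). -/

/-! ### Coherent vectors and their reproducing kernel. -/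

section CoherentVectors

variable {n : ℕ}

/-- The integral kernel of the Bargmann transform, without its normalization. -/
noncomputable def bargmannExp (z : Fin n → ℂ) (x : EuclideanSpace ℝ (Fin n)) : ℂ :=
  Complex.exp (-(1 / 4) * ∑ k, z k ^ 2 + ∑ k, z k * (x k : ℂ) - (1 / 2) * ∑ k, (x k : ℂ) ^ 2)

theorem integrable_cexp_neg_mul_sum_sq_add {b : ℂ} (hb : 0 < b.re) (c : Fin n → ℂ) :
    Integrable (fun x : EuclideanSpace ℝ (Fin n) =>
      Complex.exp (-b * ∑ k, (x k : ℂ) ^ 2 + ∑ k, c k * (x k : ℂ))) := by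
  rw [← (PiLp.volume_preserving_toLp (Fin n)).integrable_comp_emb
    (MeasurableEquiv.toLp 2 _).measurableEmbedding]
  exact GaussianFourier.integrable_cexp_neg_mul_sum_add hb c

theorem integral_cexp_neg_mul_sum_sq_add {b : ℂ} (hb : 0 < b.re) (c : Fin n → ℂ) :
    ∫ x : EuclideanSpace ℝ (Fin n),
      Complex.exp (-b * ∑ k, (x k : ℂ) ^ 2 + ∑ k, c k * (x k : ℂ)) =
      (Real.pi / b) ^ (n / 2 : ℂ) * Complex.exp ((∑ k, c k ^ 2) / (4 * b)) := by
  rw [← (PiLp.volume_preserving_toLp (Fin n)).integral_comp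
    (MeasurableEquiv.toLp 2 _).measurableEmbedding]
  simpa using GaussianFourier.integral_cexp_neg_mul_sum_add hb c

theorem continuous_bargmannExp_right (z : Fin n → ℂ) : Continuous (bargmannExp z) := by
  unfold bargmannExp; fun_prop

theorem bargmannExp_mul (z w : Fin n → ℂ) (x : EuclideanSpace ℝ (Fin n)) :
    bargmannExp z x * bargmannExp w x =
      Complex.exp (-(1 / 4) * ∑ k, (z k ^ 2 + w k ^ 2)) *
        Complex.exp (-1 * ∑ k, (x k : ℂ) ^ 2 + ∑ k, (z k + w k) * (x k : ℂ)) := by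
  simp only [bargmannExp, ← Complex.exp_add, Finset.sum_add_distrib, add_mul]
  ring_nf

theorem integrable_bargmannExp_mul (z w : Fin n → ℂ) :
    Integrable fun x => bargmannExp z x * bargmannExp w x := by
  simp only [bargmannExp_mul]
  exact (integrable_cexp_neg_mul_sum_sq_add (by simp) _).const_mul _

/-- Completing the square produces `(z + w)²/4`, whose pure squares cancel the prefactor and leave
the cross term `z·w/2`. -/
theorem integral_bargmannExp_mul (z w : Fin n → ℂ) :
    ∫ x, bargmannExp z x * bargmannExp w x =
      (Real.pi : ℂ) ^ (n / 2 : ℂ) * Complex.exp ((1 / 2) * ∑ k, z k * w k) := by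
  simp only [bargmannExp_mul]
  rw [integral_const_mul, integral_cexp_neg_mul_sum_sq_add (by simp), div_one, mul_left_comm,
    ← Complex.exp_add]
  congr 2
  simp only [Finset.sum_div, Finset.mul_sum, ← Finset.sum_add_distrib]
  exact Finset.sum_congr rfl fun k _ => by ring

theorem star_bargmannExp (z : Fin n → ℂ) (x : EuclideanSpace ℝ (Fin n)) :
    (starRingEnd ℂ) (bargmannExp z x) = bargmannExp (star z) x := by
  simp [bargmannExp, ← Complex.exp_conj, Complex.conj_ofNat]

theorem memLp_bargmannExp (z : Fin n → ℂ) : MemLp (bargmannExp z) 2 volume := by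
  rw [memLp_two_iff_integrable_sq_norm (continuous_bargmannExp_right z).aestronglyMeasurable]
  refine (integrable_bargmannExp_mul z (star z)).norm.congr (Filter.Eventually.of_forall fun x => ?_)
  simp [← star_bargmannExp, sq]

/-- The coherent vector at `z`: the element of `L²(ℝⁿ)` representing `φ ↦ (ℬφ)(z)`. -/
noncomputable def coherent (z : Fin n → ℂ) : L2 n :=
  ((Real.pi ^ (-(n : ℝ) / 4) : ℝ) : ℂ) • (memLp_bargmannExp (star z)).toLp _

theorem bargmann_eq_inner (φ : L2 n) (z : Fin n → ℂ) : bargmann φ z = inner ℂ (coherent z) φ := by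
  rw [coherent, inner_smul_left, L2.inner_def, Complex.conj_ofReal, bargmann]
  congr 1
  refine integral_congr_ae ?_
  filter_upwards [(memLp_bargmannExp (star z)).coeFn_toLp] with x hx
  rw [RCLike.inner_apply', hx]
  simp only [star_bargmannExp, star_star]
  rfl

theorem inner_coherent (z w : Fin n → ℂ) :
    inner ℂ (coherent z) (coherent w) = Complex.exp ((1 / 2) * ∑ k, z k * star (w k)) := by
  rw [← bargmann_eq_inner, bargmann, coherent]
  have : ∀ᵐ x, (((Real.pi ^ (-(n : ℝ) / 4) : ℝ) : ℂ) • (memLp_bargmannExp (star w)).toLp _ : L2 n) x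
      = ((Real.pi ^ (-(n : ℝ) / 4) : ℝ) : ℂ) * bargmannExp (star w) x := by
    filter_upwards [(memLp_bargmannExp (star w)).coeFn_toLp,
      Lp.coeFn_smul ((Real.pi ^ (-(n : ℝ) / 4) : ℝ) : ℂ) ((memLp_bargmannExp (star w)).toLp _)]
      with x hx hx'
    rw [hx', Pi.smul_apply, hx, smul_eq_mul]
  rw [integral_congr_ae (g := fun x => ((Real.pi ^ (-(n : ℝ) / 4) : ℝ) : ℂ) *
    (bargmannExp z x * bargmannExp (star w) x))]
  · rw [integral_const_mul, integral_bargmannExp_mul, ← mul_assoc, ← mul_assoc]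
    have h : ((Real.pi ^ (-(n : ℝ) / 4) : ℝ) : ℂ) * ((Real.pi ^ (-(n : ℝ) / 4) : ℝ) : ℂ) *
        (Real.pi : ℂ) ^ (n / 2 : ℂ) = 1 := by
      have : (Real.pi : ℂ) ^ (n / 2 : ℂ) = ((Real.pi ^ ((n : ℝ) / 2) : ℝ) : ℂ) := by
        rw [Complex.ofReal_cpow Real.pi_pos.le]; simp
      rw [this, ← Complex.ofReal_mul, ← Complex.ofReal_mul, ← Real.rpow_add Real.pi_pos,
        ← Real.rpow_add Real.pi_pos]
      simp only [Complex.ofReal_eq_one]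
      rw [show -(n : ℝ) / 4 + -(n : ℝ) / 4 + n / 2 = 0 by ring, Real.rpow_zero]
    rw [h, one_mul]
    rfl
  · filter_upwards [this] with x hx
    rw [hx, mul_left_comm]
    rfl

theorem norm_coherent (z : Fin n → ℂ) :
    ‖coherent z‖ = Real.exp ((1 / 4) * ∑ k, ‖z k‖ ^ 2) := by
  have h := inner_self_eq_norm_sq_to_K (𝕜 := ℂ) (coherent z)
  rw [inner_coherent] at h
  have h2 : (∑ k, z k * star (z k) : ℂ) = ((∑ k, ‖z k‖ ^ 2 : ℝ) : ℂ) := by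
    push_cast
    exact Finset.sum_congr rfl fun k _ => Complex.mul_conj' _
  rw [h2] at h
  have h3 : Real.exp ((1 / 2) * ∑ k, ‖z k‖ ^ 2) = ‖coherent z‖ ^ 2 := by
    have : ((Real.exp ((1 / 2) * ∑ k, ‖z k‖ ^ 2) : ℝ) : ℂ) = ((‖coherent z‖ ^ 2 : ℝ) : ℂ) := by
      push_cast
      push_cast at h
      exact h
    exact_mod_cast this
  rw [← sq_eq_sq₀ (norm_nonneg _) (Real.exp_pos _).le, ← h3, ← Real.exp_nat_mul]
  congr 1
  push_cast
  ring

/-- Expanding the squared norm of a difference by `inner_coherent` turns norm continuity into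
continuity of explicit exponentials. -/
theorem continuous_coherent : Continuous (coherent (n := n)) := by
  rw [continuous_iff_continuousAt]
  intro z
  rw [ContinuousAt, tendsto_iff_norm_sub_tendsto_zero]
  have h : ∀ w : Fin n → ℂ, ‖coherent w - coherent z‖ = Real.sqrt
      (Real.exp ((1 / 4) * ∑ k, ‖w k‖ ^ 2) ^ 2 -
        2 * (Complex.exp ((1 / 2) * ∑ k, w k * star (z k))).re +
        Real.exp ((1 / 4) * ∑ k, ‖z k‖ ^ 2) ^ 2) := by
    intro w
    rw [← norm_coherent, ← norm_coherent, ← inner_coherent]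
    have := @norm_sub_sq ℂ (L2 n) _ _ _ (coherent w) (coherent z)
    rw [← Real.sqrt_sq (norm_nonneg (coherent w - coherent z)), this]
    rfl
  have hc : Continuous fun w : Fin n → ℂ => Real.sqrt
      (Real.exp ((1 / 4) * ∑ k, ‖w k‖ ^ 2) ^ 2 -
        2 * (Complex.exp ((1 / 2) * ∑ k, w k * star (z k))).re +
        Real.exp ((1 / 4) * ∑ k, ‖z k‖ ^ 2) ^ 2) := by fun_prop
  have h0 := hc.tendsto z
  rw [← h z, sub_self, norm_zero] at h0
  simpa only [h] using h0

theorem norm_bargmann_le (φ : L2 n) (z : Fin n → ℂ) :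
    ‖bargmann φ z‖ ≤ Real.exp ((1 / 4) * ∑ k, ‖z k‖ ^ 2) * ‖φ‖ := by
  rw [bargmann_eq_inner, ← norm_coherent]
  exact norm_inner_le_norm _ _

theorem continuous_bargmann (φ : L2 n) : Continuous (bargmann φ) := by
  have : bargmann φ = fun z => inner ℂ (coherent z) φ := funext (bargmann_eq_inner φ)
  rw [this]
  exact continuous_coherent.inner continuous_const

end CoherentVectors

/-! ### Injectivity of the Bargmann transform. -/

section Injectivity

open scoped FourierTransform ContDiff

/-- Every Schwartz `g` is `𝓕 g'` with `g'` Schwartz, and the Fourier transform moves across the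
pairing: `∫ h · 𝓕 g' = ∫ 𝓕 h · g' = 0`. Compactly supported smooth test functions then detect `h`.
-/
theorem MeasureTheory.Integrable.ae_eq_zero_of_fourier_eq_zero {V : Type*} [NormedAddCommGroup V]
    [InnerProductSpace ℝ V] [FiniteDimensional ℝ V] [MeasurableSpace V] [BorelSpace V]
    {h : V → ℂ} (hh : Integrable h) (h0 : ∀ ξ, 𝓕 h ξ = 0) : h =ᵐ[volume] 0 := by
  have key : ∀ g : 𝓢(V, ℂ), ∫ x, h x * g x = 0 := by
    intro g
    obtain ⟨g', hg'⟩ : ∃ g' : 𝓢(V, ℂ), g' = 𝓕⁻ g := ⟨_, rfl⟩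
    have h1 := VectorFourier.integral_bilin_fourierIntegral_eq_flip
      (ContinuousLinearMap.mul ℂ ℂ) (L := innerₗ V)
      Real.continuous_fourierChar continuous_inner hh
      (SchwartzMap.integrable (μ := volume) g')
    have h2 : ∀ x, VectorFourier.fourierIntegral Real.fourierChar volume (innerₗ V).flip
        g' x = g x := by
      intro x
      have : (𝓕 g') x = g x := by rw [hg', FourierTransform.fourier_fourierInv_eq]
      rw [← this, SchwartzMap.fourier_coe]
      simp only [flip_innerₗ]
      rfl
    simp only [h2, ContinuousLinearMap.mul_apply'] at h1
    rw [← h1]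
    have h3 : ∀ x, VectorFourier.fourierIntegral Real.fourierChar volume (innerₗ V) h x = 0 := h0
    simp [h3]
  refine ae_eq_zero_of_integral_contDiff_smul_eq_zero hh.locallyIntegrable fun g hg hgc => ?_
  have hg₁ : HasCompactSupport (Complex.ofRealCLM ∘ g) := hgc.comp_left rfl
  have hg₂ : ContDiff ℝ ∞ (Complex.ofRealCLM ∘ g) := by fun_prop
  rw [← key (hg₁.toSchwartzMap hg₂)]
  refine integral_congr_ae (Filter.Eventually.of_forall fun x => ?_)
  simp [mul_comm]

variable {n : ℕ}

theorem bargmann_sub (φ ψ : L2 n) (z : Fin n → ℂ) :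
    bargmann (φ - ψ) z = bargmann φ z - bargmann ψ z := by
  simp only [bargmann_eq_inner, inner_sub_right]

/-- At `z = -2πiξ` the transform is a nonzero multiple of the Fourier transform at `ξ` of the
integrable function `e^{-x²/2} φ`. -/
theorem eq_zero_of_bargmann_eq_zero {φ : L2 n} (h : ∀ z, bargmann φ z = 0) : φ = 0 := by
  rw [Lp.eq_zero_iff_ae_eq_zero]
  have hint : Integrable fun x => bargmannExp 0 x * φ x :=
    (memLp_bargmannExp 0).integrable_mul (Lp.memLp φ)
  have h0 : (fun x => bargmannExp 0 x * φ x) =ᵐ[volume] 0 := by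
    refine hint.ae_eq_zero_of_fourier_eq_zero fun ξ => ?_
    have h1 := h fun k => -2 * Real.pi * Complex.I * (ξ k : ℂ)
    rw [bargmann, mul_eq_zero] at h1
    have h2 := h1.resolve_left (by
      rw [Complex.ofReal_eq_zero]; exact (Real.rpow_pos_of_pos Real.pi_pos _).ne')
    set c : ℂ := -(1 / 4) * ∑ k, (-2 * Real.pi * Complex.I * (ξ k : ℂ)) ^ 2 with hc
    have h3 : (fun x : EuclideanSpace ℝ (Fin n) => Complex.exp (-(1 / 4) *
        ∑ k, (-2 * Real.pi * Complex.I * (ξ k : ℂ)) ^ 2 +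
        ∑ k, -2 * Real.pi * Complex.I * (ξ k : ℂ) * (x k : ℂ) - (1 / 2) * ∑ k, (x k : ℂ) ^ 2) * φ x)
        = fun x => Complex.exp c * (Complex.exp (((-2 * Real.pi * inner ℝ x ξ : ℝ) : ℂ) *
          Complex.I) • (bargmannExp 0 x * φ x)) := by
      funext x
      rw [bargmannExp, smul_eq_mul, ← mul_assoc, ← mul_assoc, ← Complex.exp_add, ← Complex.exp_add,
        hc]
      congr 2
      simp only [PiLp.inner_apply, RCLike.inner_apply, conj_trivial]
      push_cast
      simp only [Pi.zero_apply, zero_mul, Finset.mul_sum, Finset.sum_mul, Finset.sum_const_zero,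
        ne_eq, OfNat.ofNat_ne_zero, not_false_eq_true, zero_pow, mul_zero, add_zero, zero_sub]
      rw [sub_eq_add_neg]
      congr 2
      exact Finset.sum_congr rfl fun k _ => by ring
    rw [h3, integral_const_mul, mul_eq_zero] at h2
    rw [Real.fourier_eq']
    exact h2.resolve_left (Complex.exp_ne_zero _)
  filter_upwards [h0] with x hx
  simpa [bargmannExp, Complex.exp_ne_zero] using hx

theorem bargmann_injective : Function.Injective (bargmann (n := n)) := by
  intro φ ψ h
  rw [← sub_eq_zero]
  refine eq_zero_of_bargmann_eq_zero fun z => ?_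
  rw [bargmann_sub, h, sub_self]

end Injectivity

/-! ### Mean value and reproducing properties in the Fock space. -/

section MeanValue

variable {n : ℕ}

/-- The Gaussian weight `e^{-|w|²/2}` of the Fock space. -/
noncomputable def fockWeight (w : Fin n → ℂ) : ℝ := Real.exp (-(1 / 2) * ∑ j, ‖w j‖ ^ 2)

theorem fockWeight_pos (w : Fin n → ℂ) : 0 < fockWeight w := Real.exp_pos _

theorem continuous_fockWeight : Continuous (fockWeight (n := n)) := by
  unfold fockWeight; fun_prop

theorem integral_fockWeight : ∫ w : Fin n → ℂ, fockWeight w = (2 * Real.pi) ^ n := by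
  have h : ∀ w : Fin n → ℂ, fockWeight w = ∏ j, Real.exp (-(1 / 2) * ‖w j‖ ^ 2) := by
    intro w
    rw [fockWeight, Finset.mul_sum, Real.exp_sum]
  simp only [h]
  rw [integral_fintype_prod_volume_eq_prod (f := fun _ (v : ℂ) => Real.exp (-(1 / 2) * ‖v‖ ^ 2)),
    GaussianFourier.integral_rexp_neg_mul_sq_norm (by norm_num)]
  simp [Complex.finrank_real_complex, mul_comm]

theorem measurePreserving_smul_circle (c : Circle) :
    MeasurePreserving (fun w : Fin n → ℂ => (c : ℂ) • w) volume volume := by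
  have := volume_preserving_pi (fun _ : Fin n => (rotation c).measurePreserving)
  convert! this using 1

theorem fockWeight_smul_circle (c : Circle) (w : Fin n → ℂ) :
    fockWeight ((c : ℂ) • w) = fockWeight w := by
  simp only [fockWeight, Pi.smul_apply, norm_smul, Circle.norm_coe, one_mul]

theorem circleMap_zero_one_eq_exp (θ : ℝ) : circleMap 0 1 θ = (Circle.exp θ : ℂ) := by
  simp [circleMap]

/-- Mean value property of entire functions for the Gaussian measure. -/
theorem integral_mul_fockWeight_of_entire {H : (Fin n → ℂ) → ℂ} (hc : Continuous H)
    (hd : ∀ w, Differentiable ℂ fun l : ℂ => H (l • w))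
    (hi : Integrable fun w => H w * (fockWeight w : ℂ)) :
    ∫ w, H w * (fockWeight w : ℂ) = (2 * Real.pi) ^ n * H 0 := by
  set G : (Fin n → ℂ) → ℂ := fun w => H w * (fockWeight w : ℂ) with hG
  have hGc : Continuous G := hc.mul (Complex.continuous_ofReal.comp continuous_fockWeight)
  let ν : Measure ℝ := volume.restrict (Set.Ioc 0 (2 * Real.pi))
  have hrot : ∀ θ : ℝ, MeasurePreserving (fun w : Fin n → ℂ => circleMap 0 1 θ • w) volume volume :=
    fun θ => by rw [circleMap_zero_one_eq_exp]; exact measurePreserving_smul_circle _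
  have hemb : ∀ θ : ℝ, MeasurableEmbedding (fun w : Fin n → ℂ => circleMap 0 1 θ • w) := fun θ =>
    (Homeomorph.smulOfNeZero (circleMap 0 1 θ) (by simp)).measurableEmbedding
  have hint1 : ∀ θ : ℝ, ∫ w, G (circleMap 0 1 θ • w) = ∫ w, G w := fun θ =>
    (hrot θ).integral_comp (hemb θ) G
  have hintegrable : Integrable (Function.uncurry fun (θ : ℝ) (w : Fin n → ℂ) =>
      G (circleMap 0 1 θ • w)) (ν.prod volume) := by
    have hcont : Continuous (Function.uncurry fun (θ : ℝ) (w : Fin n → ℂ) =>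
        G (circleMap 0 1 θ • w)) := by
      refine hGc.comp ?_
      have := continuous_circleMap 0 1
      fun_prop
    rw [integrable_prod_iff hcont.aestronglyMeasurable]
    constructor
    · exact Filter.Eventually.of_forall fun θ => ((hrot θ).integrable_comp_emb (hemb θ)).2 hi
    · have : (fun θ : ℝ => ∫ w, ‖Function.uncurry (fun (θ : ℝ) (w : Fin n → ℂ) =>
          G (circleMap 0 1 θ • w)) (θ, w)‖) = fun _ => ∫ w, ‖G w‖ := by
        funext θ
        exact (hrot θ).integral_comp (hemb θ) (fun w => ‖G w‖)
      rw [this]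
      exact integrable_const _
  -- Averaging over the rotations `w ↦ e^{iθ}w` does not change the integral over `w`; done first,
  -- the average over `θ` only sees `H`, since the weight is rotation invariant.
  have hswap := integral_integral_swap hintegrable
  simp only [hint1] at hswap
  have hinner : ∀ w : Fin n → ℂ, ∫ θ, G (circleMap 0 1 θ • w) ∂ν =
      (2 * Real.pi : ℂ) * H 0 * (fockWeight w : ℂ) := by
    intro w
    have h1 : ∀ θ : ℝ, G (circleMap 0 1 θ • w) = H (circleMap 0 1 θ • w) * (fockWeight w : ℂ) := by
      intro θ
      simp only [hG]
      rw [circleMap_zero_one_eq_exp, fockWeight_smul_circle]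
    simp only [h1]
    rw [integral_mul_const]
    congr 1
    -- The one-variable mean value property on the complex line through `w` gives the value `H 0`.
    have h2 := ((hd w).diffContOnCl (s := Metric.ball 0 |1|)).circleAverage
    rw [Real.circleAverage_def, intervalIntegral.integral_of_le (by positivity), zero_smul] at h2
    rw [← h2, Complex.real_smul]
    push_cast
    rw [mul_inv_cancel_left₀ (by simp [Real.pi_ne_zero])]
  simp only [hinner] at hswap
  rw [integral_const_mul, integral_const, integral_complex_ofReal, integral_fockWeight] at hswap
  have hν : ν.real Set.univ = 2 * Real.pi := by
    simp [ν, Real.pi_pos.le]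
  rw [hν, Complex.real_smul] at hswap
  push_cast at hswap
  have hpi : (2 * Real.pi : ℂ) ≠ 0 := by simp [Real.pi_ne_zero]
  refine mul_left_cancel₀ hpi ?_
  rw [hswap]
  ring

/-- The kernel `e^{z·w̄/2}` reproduces entire functions in the Fock space. -/
theorem integral_mul_reproducing {H : (Fin n → ℂ) → ℂ} (hc : Continuous H)
    (hd : ∀ z w, Differentiable ℂ fun l : ℂ => H (z + l • w)) (z : Fin n → ℂ)
    (hi : Integrable fun w => H w * Complex.exp ((1 / 2) * ∑ k, z k * star (w k)) *
      (fockWeight w : ℂ)) :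
    ∫ w, H w * Complex.exp ((1 / 2) * ∑ k, z k * star (w k)) * (fockWeight w : ℂ) =
      (2 * Real.pi) ^ n * H z := by
  -- Translating by `z` turns `z·w̄/2 - |w|²/2` into `-z̄·w/2 - |w|²/2`, which is holomorphic in `w`
  -- apart from the weight. The mean value property applies to `G`, and `G 0 = H z`.
  set G : (Fin n → ℂ) → ℂ := fun w => H (z + w) * Complex.exp (-(1 / 2) * ∑ k, star (z k) * w k)
  have hG : ∀ w, H (z + w) * Complex.exp ((1 / 2) * ∑ k, z k * star ((z + w) k)) *
      (fockWeight (z + w) : ℂ) = G w * (fockWeight w : ℂ) := by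
    intro w
    simp only [G, fockWeight, Complex.ofReal_exp, mul_assoc, ← Complex.exp_add]
    congr 2
    push_cast
    simp only [← Complex.mul_conj', Finset.mul_sum, ← Finset.sum_add_distrib]
    refine Finset.sum_congr rfl fun k _ => ?_
    simp only [Pi.add_apply, map_add, star_add, RCLike.star_def]
    ring
  have hi' := hi.comp_add_left z
  have h1 := integral_add_left_eq_self (μ := (volume : Measure (Fin n → ℂ))) (fun w => H w *
    Complex.exp ((1 / 2) * ∑ k, z k * star (w k)) * (fockWeight w : ℂ)) z
  simp only [hG] at h1 hi'
  rw [← h1, integral_mul_fockWeight_of_entire (H := G)]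
  · simp [G]
  · fun_prop
  · intro w
    simp only [G]
    refine (hd z w).mul ?_
    simp only [Pi.smul_apply]
    fun_prop
  · exact hi'

end MeanValue

/-! ### Bargmann transforms of Schwartz functions: ladder operators and decay. -/

section SchwartzBargmann

open scoped LineDeriv

variable {n : ℕ}

/-- Multiplication by the coordinate `xⱼ` on Schwartz space. -/
noncomputable def coordMul (j : Fin n) :
    𝓢(EuclideanSpace ℝ (Fin n), ℂ) →ₗ[ℂ] 𝓢(EuclideanSpace ℝ (Fin n), ℂ) :=
  (SchwartzMap.smulLeftCLM ℂ fun x : EuclideanSpace ℝ (Fin n) => (x j : ℂ)).toLinearMap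

/-- The partial derivative `∂ⱼ` on Schwartz space. -/
noncomputable def coordDeriv (j : Fin n) :
    𝓢(EuclideanSpace ℝ (Fin n), ℂ) →ₗ[ℂ] 𝓢(EuclideanSpace ℝ (Fin n), ℂ) :=
  (LineDeriv.lineDerivOpCLM ℂ 𝓢(EuclideanSpace ℝ (Fin n), ℂ)
    (EuclideanSpace.single j (1 : ℝ))).toLinearMap

/-- The creation operator `xⱼ - ∂ⱼ`. -/
noncomputable def creation (j : Fin n) :
    𝓢(EuclideanSpace ℝ (Fin n), ℂ) →ₗ[ℂ] 𝓢(EuclideanSpace ℝ (Fin n), ℂ) :=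
  coordMul j - coordDeriv j

/-- The annihilation operator `xⱼ + ∂ⱼ`. -/
noncomputable def annihilation (j : Fin n) :
    𝓢(EuclideanSpace ℝ (Fin n), ℂ) →ₗ[ℂ] 𝓢(EuclideanSpace ℝ (Fin n), ℂ) :=
  coordMul j + coordDeriv j

theorem coordMul_apply (j : Fin n) (φ : 𝓢(EuclideanSpace ℝ (Fin n), ℂ))
    (x : EuclideanSpace ℝ (Fin n)) : coordMul j φ x = (x j : ℂ) * φ x := by
  have h : Function.HasTemperateGrowth fun x : EuclideanSpace ℝ (Fin n) => (x j : ℂ) :=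
    (Complex.ofRealCLM.comp (EuclideanSpace.proj (𝕜 := ℝ) j)).hasTemperateGrowth
  simp [coordMul, SchwartzMap.smulLeftCLM_apply_apply h]

theorem coordDeriv_apply (j : Fin n) (φ : 𝓢(EuclideanSpace ℝ (Fin n), ℂ))
    (x : EuclideanSpace ℝ (Fin n)) :
    coordDeriv j φ x = lineDeriv ℝ φ x (EuclideanSpace.single j 1) := by
  simp [coordDeriv, SchwartzMap.lineDerivOp_apply]

/-- The Bargmann transform of Schwartz functions. -/
noncomputable def schwartzBargmann :
    𝓢(EuclideanSpace ℝ (Fin n), ℂ) →ₗ[ℂ] (Fin n → ℂ) → ℂ where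
  toFun φ := bargmann (φ.toLp 2)
  map_add' φ ψ := by
    funext z
    simp only [bargmann_eq_inner, Pi.add_apply]
    rw [← inner_add_right]
    congr 1
  map_smul' c φ := by
    funext z
    simp only [bargmann_eq_inner, Pi.smul_apply, RingHom.id_apply, smul_eq_mul]
    rw [← inner_smul_right]
    congr 1

theorem schwartzBargmann_def (φ : 𝓢(EuclideanSpace ℝ (Fin n), ℂ)) :
    schwartzBargmann φ = bargmann (φ.toLp 2) := rfl

theorem schwartzBargmann_apply (φ : 𝓢(EuclideanSpace ℝ (Fin n), ℂ)) (z : Fin n → ℂ) :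
    schwartzBargmann φ z =
      ((Real.pi ^ (-(n : ℝ) / 4) : ℝ) : ℂ) * ∫ x, bargmannExp z x * φ x := by
  rw [schwartzBargmann_def, bargmann]
  congr 1
  refine integral_congr_ae ?_
  filter_upwards [φ.coeFn_toLp 2] with x hx
  rw [hx]
  rfl

theorem integrable_bargmannExp_mul_schwartz (z : Fin n → ℂ)
    (φ : 𝓢(EuclideanSpace ℝ (Fin n), ℂ)) : Integrable fun x => bargmannExp z x * φ x :=
  (memLp_bargmannExp z).integrable_mul (φ.memLp 2)

theorem hasLineDerivAt_bargmannExp (z : Fin n → ℂ) (j : Fin n) (x : EuclideanSpace ℝ (Fin n)) :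
    HasLineDerivAt ℝ (bargmannExp z) ((z j - (x j : ℂ)) * bargmannExp z x) x
      (EuclideanSpace.single j 1) := by
  unfold HasLineDerivAt bargmannExp
  have h1 : ∀ k, HasDerivAt (fun t : ℝ =>
      (((x + t • EuclideanSpace.single j (1 : ℝ)) k : ℝ) : ℂ)) (if k = j then 1 else 0) 0 := by
    intro k
    simp only [PiLp.add_apply, PiLp.smul_apply, PiLp.single_apply, smul_eq_mul]
    split_ifs
    · simpa using ((hasDerivAt_id (0 : ℝ)).ofReal_comp.const_add ((x k : ℂ)))
    · simpa using hasDerivAt_const (0 : ℝ) (x k : ℂ)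
  have h2 := HasDerivAt.fun_sum (u := Finset.univ) fun k _ => (h1 k).const_mul (z k)
  have h3 := HasDerivAt.fun_sum (u := Finset.univ) fun k _ => (h1 k).pow 2
  have h4 := ((h2.const_add (-(1 / 4) * ∑ k, z k ^ 2)).sub (h3.const_mul (1 / 2 : ℂ))).cexp
  convert! h4 using 1
  simp
  ring

/-- Integration by parts, since `∂_j` multiplies the kernel by `z_j - x_j`. -/
theorem schwartzBargmann_creation (j : Fin n) (φ : 𝓢(EuclideanSpace ℝ (Fin n), ℂ))
    (z : Fin n → ℂ) : schwartzBargmann (creation j φ) z = z j * schwartzBargmann φ z := by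
  have hd : ∫ x, bargmannExp z x * coordDeriv j φ x =
      -∫ x, ((z j - (x j : ℂ)) * bargmannExp z x) * φ x := by
    refine integral_bilinear_hasLineDerivAt_right_eq_neg_left_of_integrable
      (v := EuclideanSpace.single j 1) (B := ContinuousLinearMap.mul ℝ ℂ)
      (f := bargmannExp z) (g := φ) ?_ ?_ ?_ ?_ ?_
    · have h := ((integrable_bargmannExp_mul_schwartz z φ).const_mul (z j)).sub
        (integrable_bargmannExp_mul_schwartz z (coordMul j φ))
      refine h.congr (Filter.Eventually.of_forall fun x => ?_)
      simp only [Pi.sub_apply, coordMul_apply, ContinuousLinearMap.mul_apply']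
      ring
    · exact integrable_bargmannExp_mul_schwartz z (coordDeriv j φ)
    · exact integrable_bargmannExp_mul_schwartz z φ
    · exact fun x _ => hasLineDerivAt_bargmannExp z j x
    · intro x _
      rw [coordDeriv_apply]
      exact (φ.differentiableAt.lineDifferentiableAt).hasLineDerivAt
  have h1 : ∫ x, ((z j - (x j : ℂ)) * bargmannExp z x) * φ x =
      z j * (∫ x, bargmannExp z x * φ x) - ∫ x, bargmannExp z x * coordMul j φ x := by
    rw [← integral_const_mul, ← integral_sub
      ((integrable_bargmannExp_mul_schwartz z φ).const_mul (z j))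
      (integrable_bargmannExp_mul_schwartz z (coordMul j φ))]
    refine integral_congr_ae (Filter.Eventually.of_forall fun x => ?_)
    simp only [coordMul_apply]
    ring
  rw [creation, LinearMap.sub_apply, map_sub, Pi.sub_apply]
  simp only [schwartzBargmann_apply]
  rw [hd, h1]
  ring

theorem norm_bargmannExp_le {R : ℝ} {z : Fin n → ℂ} (hz : ∀ k, ‖z k‖ ≤ R)
    (x : EuclideanSpace ℝ (Fin n)) :
    ‖bargmannExp z x‖ ≤ Real.exp (∑ k : Fin n, ((9 / 4) * R ^ 2 - (3 / 8) * x k ^ 2)) := by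
  have h : -(1 / 4) * ∑ k, z k ^ 2 + ∑ k, z k * (x k : ℂ) - (1 / 2) * ∑ k, (x k : ℂ) ^ 2 =
      ∑ k, (-(1 / 4) * z k ^ 2 + z k * (x k : ℂ) - (1 / 2) * (x k : ℂ) ^ 2) := by
    simp only [Finset.mul_sum, Finset.sum_sub_distrib, Finset.sum_add_distrib]
  rw [bargmannExp, Complex.norm_exp, h, Complex.re_sum]
  refine Real.exp_le_exp.2 (Finset.sum_le_sum fun k _ => ?_)
  have h1 : (-(1 / 4) * z k ^ 2 + z k * (x k : ℂ) - (1 / 2) * (x k : ℂ) ^ 2).re =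
      -(1 / 4) * ((z k).re ^ 2 - (z k).im ^ 2) + (z k).re * x k - (1 / 2) * x k ^ 2 := by
    simp [sq, Complex.mul_re]
  have h2 : (z k).re ^ 2 + (z k).im ^ 2 ≤ R ^ 2 := by
    have := pow_le_pow_left₀ (norm_nonneg _) (hz k) 2
    rwa [← Complex.normSq_eq_norm_sq, Complex.normSq_apply, ← sq, ← sq] at this
  rw [h1]
  -- Twice the first square gives `Re z · x ≤ 2 (Re z)² + x²/8`, which leaves `-3x²/8`; what remains
  -- in `z` is at most `9R²/4`.
  nlinarith [sq_nonneg ((z k).re - x k / 4), sq_nonneg (z k).re, sq_nonneg (z k).im]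

theorem integrable_exp_sum_const_sub (R : ℝ) : Integrable fun x : EuclideanSpace ℝ (Fin n) =>
    Real.exp (∑ k : Fin n, ((9 / 4) * R ^ 2 - (3 / 8) * x k ^ 2)) := by
  have h := (integrable_cexp_neg_mul_sum_sq_add (n := n) (b := 3 / 8) (by norm_num) 0).norm.const_mul
    (Real.exp (∑ _k : Fin n, (9 / 4) * R ^ 2))
  refine h.congr (Filter.Eventually.of_forall fun x => ?_)
  simp only [Complex.norm_exp]
  rw [← Real.exp_add, Finset.sum_sub_distrib]
  have : (-(3 / 8 : ℂ) * ∑ k, (x k : ℂ) ^ 2 + ∑ k, (0 : Fin n → ℂ) k * (x k : ℂ)) =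
      ((-(3 / 8) * ∑ k, x k ^ 2 : ℝ) : ℂ) := by
    push_cast
    simp
  rw [this, Complex.ofReal_re, Finset.mul_sum, sub_eq_add_neg, ← Finset.sum_neg_distrib]
  simp only [neg_mul]

theorem hasDerivAt_bargmannExp (z v : Fin n → ℂ) (x : EuclideanSpace ℝ (Fin n)) (l : ℂ) :
    HasDerivAt (fun l : ℂ => bargmannExp (z + l • v) x)
      (bargmannExp (z + l • v) x * ∑ k, v k * (-(1 / 2) * (z + l • v) k + (x k : ℂ))) l := by
  unfold bargmannExp
  have h1 : ∀ k, HasDerivAt (fun l : ℂ => (z + l • v) k) (v k) l := by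
    intro k
    simpa using ((hasDerivAt_id l).mul_const (v k)).const_add (z k)
  have h2 := HasDerivAt.fun_sum (u := Finset.univ) fun k _ => (h1 k).mul_const (x k : ℂ)
  have h3 := HasDerivAt.fun_sum (u := Finset.univ) fun k _ => (h1 k).fun_pow 2
  have h4 := (((h3.const_mul (-(1 / 4) : ℂ)).add h2).sub_const
    ((1 / 2) * ∑ k, (x k : ℂ) ^ 2)).cexp
  convert! h4 using 1
  congr 1
  rw [Finset.mul_sum, ← Finset.sum_add_distrib]
  exact Finset.sum_congr rfl fun k _ => by push_cast; ring

/-- Differentiating the kernel in `z_k` brings down `x_k - z_k/2`. As `z_k` acts as `x_k - ∂_k`, the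
result is `(x_k + ∂_k)/2`. Besides the annihilation operators, this yields holomorphy along complex
lines, the only form of holomorphy used. -/
theorem hasDerivAt_schwartzBargmann (φ : 𝓢(EuclideanSpace ℝ (Fin n), ℂ)) (z v : Fin n → ℂ)
    (l : ℂ) : HasDerivAt (fun l : ℂ => schwartzBargmann φ (z + l • v))
      ((1 / 2) * ∑ k, v k * schwartzBargmann (annihilation k φ) (z + l • v)) l := by
  have hF' : ∀ (l : ℂ) (x : EuclideanSpace ℝ (Fin n)),
      bargmannExp (z + l • v) x * (∑ k, v k * (-(1 / 2) * (z + l • v) k + (x k : ℂ))) * φ x =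
      ∑ k, v k * (-(1 / 2) * (z + l • v) k * (bargmannExp (z + l • v) x * φ x) +
        bargmannExp (z + l • v) x * coordMul k φ x) := by
    intro l x
    simp only [coordMul_apply, Finset.mul_sum, Finset.sum_mul]
    exact Finset.sum_congr rfl fun k _ => by ring
  obtain ⟨R, hR⟩ : ∃ R, ∀ m ∈ Metric.ball l 1, ∀ k, ‖(z + m • v) k‖ ≤ R := by
    refine ⟨‖z‖ + (‖l‖ + 1) * ‖v‖, fun m hm k => ?_⟩
    refine (norm_le_pi_norm _ k).trans ((norm_add_le _ _).trans ?_)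
    rw [norm_smul]
    gcongr
    have := norm_sub_norm_le m l
    rw [Metric.mem_ball, dist_eq_norm] at hm
    linarith
  obtain ⟨C, hC0, hC, hCk⟩ : ∃ C, 0 ≤ C ∧ (∀ x, ‖φ x‖ ≤ C) ∧ ∀ k x, ‖coordMul k φ x‖ ≤ C := by
    refine ⟨SchwartzMap.seminorm ℂ 0 0 φ + ∑ k, SchwartzMap.seminorm ℂ 0 0 (coordMul k φ),
      add_nonneg (apply_nonneg _ _) (Finset.sum_nonneg fun _ _ => apply_nonneg _ _),
      fun x => ?_, fun k x => ?_⟩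
    · exact (φ.norm_le_seminorm ℂ x).trans
        (le_add_of_nonneg_right (Finset.sum_nonneg fun _ _ => apply_nonneg _ _))
    · exact ((coordMul k φ).norm_le_seminorm ℂ x).trans <|
        (Finset.single_le_sum (f := fun k => SchwartzMap.seminorm ℂ 0 0 (coordMul k φ))
          (fun _ _ => apply_nonneg _ _) (Finset.mem_univ k)).trans
        (le_add_of_nonneg_left (apply_nonneg _ _))
  have key := hasDerivAt_integral_of_dominated_loc_of_deriv_le (𝕜 := ℂ) (μ := volume) (x₀ := l)
    (s := Metric.ball l 1) (F := fun m x => bargmannExp (z + m • v) x * φ x)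
    (F' := fun m x => bargmannExp (z + m • v) x *
      (∑ k, v k * (-(1 / 2) * (z + m • v) k + (x k : ℂ))) * φ x)
    (bound := fun x => (∑ k, ‖v k‖ * ((1 / 2) * R * C + C)) *
      Real.exp (∑ k : Fin n, ((9 / 4) * R ^ 2 - (3 / 8) * x k ^ 2)))
    (Metric.ball_mem_nhds l one_pos)
    (Filter.Eventually.of_forall fun m =>
      (integrable_bargmannExp_mul_schwartz _ φ).aestronglyMeasurable)
    (integrable_bargmannExp_mul_schwartz _ φ)
    (by
      have := continuous_bargmannExp_right (z + l • v)
      have := φ.continuous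
      exact Continuous.aestronglyMeasurable (by fun_prop))
    (Filter.Eventually.of_forall fun x m hm => by
      rw [hF', Finset.sum_mul]
      refine norm_sum_le_of_le _ fun k _ => ?_
      have hE := norm_bargmannExp_le (hR m hm) x
      have hz := hR m hm k
      rw [norm_mul, mul_assoc ‖v k‖]
      refine mul_le_mul_of_nonneg_left ((norm_add_le _ _).trans ?_) (norm_nonneg _)
      rw [norm_mul, norm_mul, norm_mul, norm_mul, add_mul]
      have e1 : ‖(-(1 / 2) : ℂ)‖ = 1 / 2 := by norm_num
      rw [e1]
      have := (norm_nonneg _).trans hz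
      refine add_le_add ?_ ?_
      · rw [mul_assoc, mul_assoc, mul_assoc]
        refine mul_le_mul_of_nonneg_left ?_ (by norm_num)
        refine mul_le_mul hz ?_ (by positivity) this
        rw [mul_comm]
        exact mul_le_mul (hC x) hE (norm_nonneg _) hC0
      · rw [mul_comm]
        exact mul_le_mul (hCk k x) hE (norm_nonneg _) hC0)
    ((integrable_exp_sum_const_sub R).const_mul _)
    (Filter.Eventually.of_forall fun x m _ => (hasDerivAt_bargmannExp z v x m).mul_const (φ x))
  have h2 := key.2.const_mul ((Real.pi ^ (-(n : ℝ) / 4) : ℝ) : ℂ)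
  simp only [← schwartzBargmann_apply] at h2
  refine h2.congr_deriv (Eq.symm ?_)
  have h3 : ∫ x, bargmannExp (z + l • v) x *
      (∑ k, v k * (-(1 / 2) * (z + l • v) k + (x k : ℂ))) * φ x =
      ∑ k, v k * (-(1 / 2) * (z + l • v) k * (∫ x, bargmannExp (z + l • v) x * φ x) +
        ∫ x, bargmannExp (z + l • v) x * coordMul k φ x) := by
    simp only [hF']
    have i1 := integrable_bargmannExp_mul_schwartz (z + l • v) φ
    have i2 := fun k => integrable_bargmannExp_mul_schwartz (z + l • v) (coordMul k φ)
    have i3 : ∀ k ∈ Finset.univ, Integrable fun x => v k * (-(1 / 2) * (z + l • v) k *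
        (bargmannExp (z + l • v) x * φ x) + bargmannExp (z + l • v) x * coordMul k φ x) :=
      fun k _ => ((i1.const_mul _).add (i2 k)).const_mul _
    rw [integral_finsetSum _ i3]
    refine Finset.sum_congr rfl fun k _ => ?_
    rw [integral_const_mul, integral_add (i1.const_mul _) (i2 k), integral_const_mul]
  rw [h3, Finset.mul_sum, Finset.mul_sum]
  refine Finset.sum_congr rfl fun k _ => ?_
  have h4 := schwartzBargmann_creation k φ (z + l • v)
  rw [creation, LinearMap.sub_apply, map_sub, Pi.sub_apply] at h4
  rw [annihilation, LinearMap.add_apply, map_add, Pi.add_apply]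
  have e1 := schwartzBargmann_apply φ (z + l • v)
  have e2 := schwartzBargmann_apply (coordMul k φ) (z + l • v)
  linear_combination (-(1 / 2) * v k) * h4 - (1 / 2) * v k * (z + l • v) k * e1 + v k * e2

theorem continuous_schwartzBargmann (φ : 𝓢(EuclideanSpace ℝ (Fin n), ℂ)) :
    Continuous (schwartzBargmann φ) := continuous_bargmann _

/-- A factor `|w_k|²` is absorbed by applying the creation operator twice, which stays in the
Schwartz space; the case `N = 0` is the Cauchy–Schwarz bound `norm_bargmann_le`. -/
theorem schwartzBargmann_rapid_decay (N : ℕ) : ∀ φ : 𝓢(EuclideanSpace ℝ (Fin n), ℂ),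
    ∃ C, 0 ≤ C ∧ ∀ w, (1 + ∑ k, ‖w k‖ ^ 2) ^ N * ‖schwartzBargmann φ w‖ ≤
      C * Real.exp ((1 / 4) * ∑ k, ‖w k‖ ^ 2) := by
  induction N with
  | zero =>
    intro φ
    refine ⟨‖φ.toLp 2‖, norm_nonneg _, fun w => ?_⟩
    rw [pow_zero, one_mul, mul_comm]
    exact norm_bargmann_le _ _
  | succ N ih =>
    intro φ
    obtain ⟨C, hC0, hC⟩ := ih φ
    choose D hD0 hD using fun k : Fin n => ih (creation k (creation k φ))
    refine ⟨C + ∑ k, D k, add_nonneg hC0 (Finset.sum_nonneg fun k _ => hD0 k), fun w => ?_⟩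
    have h : (1 + ∑ k, ‖w k‖ ^ 2) ^ (N + 1) * ‖schwartzBargmann φ w‖ =
        (1 + ∑ k, ‖w k‖ ^ 2) ^ N * ‖schwartzBargmann φ w‖ + ∑ k, (1 + ∑ k, ‖w k‖ ^ 2) ^ N *
          ‖schwartzBargmann (creation k (creation k φ)) w‖ := by
      simp only [schwartzBargmann_creation, norm_mul, ← mul_assoc, ← Finset.sum_mul]
      rw [pow_succ, mul_add, mul_one, add_mul]
      congr 2
      rw [Finset.mul_sum]
      exact Finset.sum_congr rfl fun k _ => by ring
    rw [h, add_mul, Finset.sum_mul]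
    exact add_le_add (hC w) (Finset.sum_le_sum fun k _ => hD k w)

end SchwartzBargmann

/-! ### Integration against `w̄` in the Fock space. -/

section Reproducing

variable {n : ℕ}

theorem integrable_exp_sum_norm_sub (b : ℝ) : Integrable fun w : Fin n → ℂ =>
    Real.exp (∑ k, (b * ‖w k‖ - (1 / 4) * ‖w k‖ ^ 2)) := by
  simp only [Real.exp_sum]
  refine Integrable.fintype_prod (f := fun _ (v : ℂ) =>
    Real.exp (b * ‖v‖ - (1 / 4) * ‖v‖ ^ 2)) fun _ => ?_
  -- The constants come from `b|v| ≤ 2b² + |v|²/8`, that is, `(|v| - 4b)² ≥ 0`.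
  have h := (GaussianFourier.integrable_cexp_neg_mul_sq_norm_add (V := ℂ) (b := 1 / 8)
    (by norm_num) 0 0).norm.const_mul (Real.exp (2 * b ^ 2))
  refine h.mono' (Continuous.aestronglyMeasurable (by fun_prop))
    (Filter.Eventually.of_forall fun v => ?_)
  have : (-(1 / 8 : ℂ) * (‖v‖ : ℂ) ^ 2 + 0 * ((inner ℝ (0 : ℂ) v : ℝ) : ℂ)) =
      ((-(1 / 8) * ‖v‖ ^ 2 : ℝ) : ℂ) := by
    push_cast
    ring
  rw [Real.norm_eq_abs, Real.abs_exp, this, Complex.norm_exp, Complex.ofReal_re, ← Real.exp_add]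
  refine Real.exp_le_exp.2 ?_
  nlinarith [sq_nonneg (‖v‖ - 4 * b)]

theorem norm_cexp_half_sum_le {R : ℝ} {z : Fin n → ℂ} (hz : ∀ k, ‖z k‖ ≤ R) (w : Fin n → ℂ) :
    ‖Complex.exp ((1 / 2) * ∑ k, z k * star (w k))‖ ≤ Real.exp (∑ k, R * ‖w k‖) := by
  refine (Complex.norm_exp_le_exp_norm _).trans (Real.exp_le_exp.2 ?_)
  rw [norm_mul]
  have h1 : ‖∑ k, z k * star (w k)‖ ≤ ∑ k, R * ‖w k‖ := by
    refine norm_sum_le_of_le _ fun k _ => ?_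
    rw [norm_mul, norm_star]
    exact mul_le_mul_of_nonneg_right (hz k) (norm_nonneg _)
  have h2 : ‖(1 / 2 : ℂ)‖ = 1 / 2 := by norm_num
  rw [h2]
  linarith [norm_nonneg (∑ k, z k * star (w k))]

theorem exists_norm_schwartzBargmann_le (φ : 𝓢(EuclideanSpace ℝ (Fin n), ℂ)) :
    ∃ M, 0 ≤ M ∧ ∀ w, ‖schwartzBargmann φ w‖ ≤ M * Real.exp ((1 / 4) * ∑ k, ‖w k‖ ^ 2) := by
  simpa using schwartzBargmann_rapid_decay 0 φ

/-- The weight `e^{-|w|²/2}` beats the growth `e^{|w|²/4}` of `f` and leaves `e^{-|w|²/4}` to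
control the exponential factors, uniformly for bounded `z`. This is the majorant for differentiating
in `z`. -/
theorem norm_mul_mul_reproducing_le {A f : (Fin n → ℂ) → ℂ} {a R M : ℝ}
    (hA : ∀ w, ‖A w‖ ≤ Real.exp (∑ k, a * ‖w k‖))
    (hf : ∀ w, ‖f w‖ ≤ M * Real.exp ((1 / 4) * ∑ k, ‖w k‖ ^ 2))
    {z : Fin n → ℂ} (hz : ∀ k, ‖z k‖ ≤ R) (w : Fin n → ℂ) :
    ‖A w * f w * Complex.exp ((1 / 2) * ∑ k, z k * star (w k)) *
      (fockWeight w : ℂ)‖ ≤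
      M * Real.exp (∑ k, ((a + R) * ‖w k‖ - (1 / 4) * ‖w k‖ ^ 2)) := by
  rw [norm_mul, norm_mul, norm_mul, Complex.norm_real, Real.norm_of_nonneg (fockWeight_pos w).le]
  calc ‖A w‖ * ‖f w‖ * ‖Complex.exp ((1 / 2) * ∑ k, z k * star (w k))‖ *
        fockWeight w
      ≤ Real.exp (∑ k, a * ‖w k‖) * (M * Real.exp ((1 / 4) * ∑ k, ‖w k‖ ^ 2)) *
        Real.exp (∑ k, R * ‖w k‖) * fockWeight w := by
        gcongr
        · exact (fockWeight_pos w).le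
        · exact mul_nonneg (Real.exp_pos _).le ((norm_nonneg _).trans (hf w))
        · exact hA w
        · exact hf w
        · exact norm_cexp_half_sum_le hz w
    _ = _ := by
        have : ∀ p q r s t : ℝ, p * (t * q) * r * s = t * (p * q * r * s) := by intros; ring
        rw [this, fockWeight, ← Real.exp_add, ← Real.exp_add, ← Real.exp_add]
        congr 2
        simp only [Finset.mul_sum, ← Finset.sum_add_distrib]
        exact Finset.sum_congr rfl fun k _ => by ring

theorem integrable_mul_schwartzBargmann_mul {A : (Fin n → ℂ) → ℂ} (hAc : Continuous A) {a : ℝ}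
    (hA : ∀ w, ‖A w‖ ≤ Real.exp (∑ k, a * ‖w k‖)) (φ : 𝓢(EuclideanSpace ℝ (Fin n), ℂ))
    (z : Fin n → ℂ) :
    Integrable fun w => A w * schwartzBargmann φ w *
      Complex.exp ((1 / 2) * ∑ k, z k * star (w k)) * (fockWeight w : ℂ) := by
  obtain ⟨M, -, hM⟩ := exists_norm_schwartzBargmann_le φ
  refine ((integrable_exp_sum_norm_sub (n := n) (a + ‖z‖)).const_mul M).mono' ?_
    (Filter.Eventually.of_forall
      (norm_mul_mul_reproducing_le hA hM fun k => norm_le_pi_norm z k))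
  have h1 := continuous_schwartzBargmann φ
  have h2 := Complex.continuous_ofReal.comp (continuous_fockWeight (n := n))
  exact Continuous.aestronglyMeasurable (((hAc.mul h1).mul (by fun_prop)).mul h2)

theorem integral_schwartzBargmann_mul_reproducing (φ : 𝓢(EuclideanSpace ℝ (Fin n), ℂ))
    (z : Fin n → ℂ) :
    ∫ w, schwartzBargmann φ w * Complex.exp ((1 / 2) * ∑ k, z k * star (w k)) *
      (fockWeight w : ℂ) = (2 * Real.pi) ^ n * schwartzBargmann φ z := by
  refine integral_mul_reproducing (continuous_schwartzBargmann φ)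
    (fun z w l => (hasDerivAt_schwartzBargmann φ z w l).differentiableAt) z ?_
  simpa using integrable_mul_schwartzBargmann_mul (A := fun _ => 1) (a := 0) continuous_const
    (by simp) φ z

theorem norm_le_exp_sum_norm (k : Fin n) (w : Fin n → ℂ) :
    ‖w k‖ ≤ Real.exp (∑ k, 1 * ‖w k‖) := by
  have h1 : ‖w k‖ ≤ ∑ k, 1 * ‖w k‖ := by
    simp only [one_mul]
    exact Finset.single_le_sum (f := fun k => ‖w k‖) (fun _ _ => norm_nonneg _) (Finset.mem_univ k)
  linarith [Real.add_one_le_exp (∑ k, 1 * ‖w k‖)]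

theorem hasDerivAt_cexp_half_sum (z w : Fin n → ℂ) (k : Fin n) (l : ℂ) :
    HasDerivAt (fun l : ℂ =>
      Complex.exp ((1 / 2) * ∑ i, (z + l • Pi.single k (1 : ℂ) : Fin n → ℂ) i * star (w i)))
      ((1 / 2) * star (w k) *
        Complex.exp ((1 / 2) * ∑ i, (z + l • Pi.single k (1 : ℂ) : Fin n → ℂ) i * star (w i))) l := by
  have h0 : ∀ i, HasDerivAt (fun l : ℂ => (z + l • Pi.single k (1 : ℂ) : Fin n → ℂ) i *
      star (w i)) ((Pi.single k (1 : ℂ) : Fin n → ℂ) i * star (w i)) l := by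
    intro i
    simpa using (((hasDerivAt_id l).mul_const ((Pi.single k (1 : ℂ) : Fin n → ℂ) i)).const_add
      (z i)).mul_const (star (w i))
  have h2 := ((HasDerivAt.fun_sum (u := Finset.univ) fun i _ => h0 i).const_mul (1 / 2)).cexp
  refine h2.congr_deriv ?_
  have h3 : ∑ i, (Pi.single k (1 : ℂ) : Fin n → ℂ) i * star (w i) = star (w k) := by
    simp [Pi.single_apply]
  rw [h3]
  ring

theorem hasDerivAt_integral_mul_schwartzBargmann {A : (Fin n → ℂ) → ℂ} (hAc : Continuous A) {a : ℝ}
    (hA : ∀ w, ‖A w‖ ≤ Real.exp (∑ k, a * ‖w k‖)) (φ : 𝓢(EuclideanSpace ℝ (Fin n), ℂ))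
    (z : Fin n → ℂ) (k : Fin n) :
    HasDerivAt (fun l : ℂ => ∫ w, A w * schwartzBargmann φ w *
      Complex.exp ((1 / 2) * ∑ i, (z + l • Pi.single k (1 : ℂ) : Fin n → ℂ) i * star (w i)) *
        (fockWeight w : ℂ))
      ((1 / 2) * ∫ w, (star (w k) * A w) * schwartzBargmann φ w *
        Complex.exp ((1 / 2) * ∑ i, z i * star (w i)) * (fockWeight w : ℂ)) 0 := by
  have hA' : ∀ w, ‖star (w k) * A w‖ ≤ Real.exp (∑ k, (1 + a) * ‖w k‖) := by
    intro w
    simp only [add_mul, Finset.sum_add_distrib, Real.exp_add, norm_mul, norm_star]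
    exact mul_le_mul (norm_le_exp_sum_norm k w) (hA w) (norm_nonneg _) (Real.exp_pos _).le
  have hAc' : Continuous fun w : Fin n → ℂ => star (w k) * A w := by fun_prop
  have hR : ∀ l ∈ Metric.ball (0 : ℂ) 1, ∀ i,
      ‖(z + l • Pi.single k (1 : ℂ) : Fin n → ℂ) i‖ ≤ ‖z‖ + 1 := by
    intro l hl i
    rw [mem_ball_zero_iff] at hl
    refine (norm_add_le _ _).trans (add_le_add (norm_le_pi_norm z i) ?_)
    rw [Pi.smul_apply, norm_smul, Pi.single_apply]
    split_ifs
    · simpa using hl.le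
    · simp
  obtain ⟨M, -, hM⟩ := exists_norm_schwartzBargmann_le φ
  have hb := fun (w : Fin n → ℂ) (l : ℂ) (hl : l ∈ Metric.ball (0 : ℂ) 1) =>
    norm_mul_mul_reproducing_le hA' hM (hR l hl) w
  have hi := fun l : ℂ => integrable_mul_schwartzBargmann_mul hAc hA φ
    (z + l • Pi.single k (1 : ℂ) : Fin n → ℂ)
  have hi' := fun l : ℂ => integrable_mul_schwartzBargmann_mul hAc' hA' φ
    (z + l • Pi.single k (1 : ℂ) : Fin n → ℂ)
  have hder := fun (w : Fin n → ℂ) (l : ℂ) => ((hasDerivAt_cexp_half_sum z w k l).const_mul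
        (A w * schwartzBargmann φ w)).mul_const (fockWeight w : ℂ)
  obtain ⟨E, hE⟩ : ∃ E : ℂ → (Fin n → ℂ) → ℂ, ∀ l w, Complex.exp ((1 / 2) *
      ∑ i, (z + l • Pi.single k (1 : ℂ) : Fin n → ℂ) i * star (w i)) = E l w :=
    ⟨fun l w => _, fun l w => rfl⟩
  have hE0 : ∀ w, Complex.exp ((1 / 2) * ∑ i, z i * star (w i)) = E 0 w := by
    intro w
    rw [← hE, zero_smul, add_zero]
  simp only [hE, hE0] at hi hi' hder hb ⊢
  rw [← integral_const_mul]
  refine (hasDerivAt_integral_of_dominated_loc_of_deriv_le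
    (F' := fun l w => (1 / 2) * ((star (w k) * A w) * schwartzBargmann φ w * E l w *
        (fockWeight w : ℂ)))
    (bound := fun w => M *
      Real.exp (∑ k, ((1 + a + (‖z‖ + 1)) * ‖w k‖ - (1 / 4) * ‖w k‖ ^ 2)))
    (Metric.ball_mem_nhds (0 : ℂ) one_pos)
    (Filter.Eventually.of_forall fun l => (hi l).aestronglyMeasurable) (hi 0)
    ((hi' 0).const_mul _).aestronglyMeasurable ?_
    ((integrable_exp_sum_norm_sub _).const_mul M) ?_).2
  · refine Filter.Eventually.of_forall fun w l hl => ?_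
    rw [norm_mul]
    have h2 : ‖(1 / 2 : ℂ)‖ ≤ 1 := by norm_num
    exact (mul_le_of_le_one_left (norm_nonneg _) h2).trans (hb w l hl)
  · refine Filter.Eventually.of_forall fun w l _ => (hder w l).congr_deriv ?_
    ring

/-- Differentiate the reproducing identity in `z_k`: under the integral this brings down `w̄_k/2`,
on the other side it gives half the transform of `annihilation k φ`. -/
theorem integral_star_mul_schwartzBargmann (φ : 𝓢(EuclideanSpace ℝ (Fin n), ℂ))
    (z : Fin n → ℂ) (k : Fin n) :
    ∫ w, star (w k) * schwartzBargmann φ w * Complex.exp ((1 / 2) * ∑ i, z i * star (w i)) *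
      (fockWeight w : ℂ) = (2 * Real.pi) ^ n * schwartzBargmann (annihilation k φ) z := by
  have h1 := hasDerivAt_integral_mul_schwartzBargmann (A := fun _ => 1) (a := 0) continuous_const
    (by simp) φ z k
  simp only [one_mul, mul_one, integral_schwartzBargmann_mul_reproducing] at h1
  have h2 := h1.unique ((hasDerivAt_schwartzBargmann φ z (Pi.single k 1) 0).const_mul
    ((2 * Real.pi : ℂ) ^ n))
  simp only [zero_smul, add_zero, Pi.single_apply, ite_mul, one_mul, zero_mul, Finset.sum_ite_eq',
    Finset.mem_univ, if_true] at h2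
  linear_combination 2 * h2

theorem integral_star_mul_star_mul_schwartzBargmann (φ : 𝓢(EuclideanSpace ℝ (Fin n), ℂ))
    (z : Fin n → ℂ) (k j : Fin n) :
    ∫ w, (star (w k) * star (w j)) * schwartzBargmann φ w *
      Complex.exp ((1 / 2) * ∑ i, z i * star (w i)) * (fockWeight w : ℂ) =
      (2 * Real.pi) ^ n * schwartzBargmann (annihilation k (annihilation j φ)) z := by
  have h1 := hasDerivAt_integral_mul_schwartzBargmann (A := fun w => star (w j)) (a := 1)
    (by fun_prop) (fun w => by rw [norm_star]; exact norm_le_exp_sum_norm j w) φ z k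
  simp only [integral_star_mul_schwartzBargmann] at h1
  have h2 := h1.unique ((hasDerivAt_schwartzBargmann (annihilation j φ) z
    (Pi.single k 1) 0).const_mul ((2 * Real.pi : ℂ) ^ n))
  simp only [zero_smul, add_zero, Pi.single_apply, ite_mul, one_mul, zero_mul, Finset.sum_ite_eq',
    Finset.mem_univ, if_true] at h2
  linear_combination 2 * h2

end Reproducing

/-! ### Gaussian kernels: uniform bounds and differentiation of `L²`-valued integrals. -/

section Superposition

variable {n : ℕ}

/-- The exponent `¼(z·Sz + 2z·Rw̄ - w̄·Kw̄)` of a Gaussian kernel on the Fock space. -/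
noncomputable def kernelPhase (S R K : Matrix (Fin n) (Fin n) ℂ) (z w : Fin n → ℂ) : ℂ :=
  (1 / 4) * (z ⬝ᵥ (S *ᵥ z) + 2 * (z ⬝ᵥ (R *ᵥ star w)) - star w ⬝ᵥ (K *ᵥ star w))

theorem continuous_kernelPhase (S R K : Matrix (Fin n) (Fin n) ℂ) :
    Continuous fun p : (Fin n → ℂ) × (Fin n → ℂ) => kernelPhase S R K p.1 p.2 := by
  unfold kernelPhase dotProduct Matrix.mulVec dotProduct
  simp only [Pi.star_apply]
  fun_prop

theorem differentiable_kernelPhase_line (S R K : Matrix (Fin n) (Fin n) ℂ) (z v w : Fin n → ℂ) :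
    Differentiable ℂ fun l : ℂ => kernelPhase S R K (z + l • v) w := by
  unfold kernelPhase dotProduct Matrix.mulVec dotProduct
  simp only [Pi.add_apply, Pi.smul_apply]
  fun_prop

theorem sum_norm_mulVec_sq_le (M : Matrix (Fin n) (Fin n) ℂ) (v : Fin n → ℂ) :
    ∑ i, ‖(M *ᵥ v) i‖ ^ 2 ≤ (∑ i, ∑ j, ‖M i j‖ ^ 2) * ∑ j, ‖v j‖ ^ 2 := by
  rw [Finset.sum_mul]
  refine Finset.sum_le_sum fun i _ => ?_
  have h1 : ‖(M *ᵥ v) i‖ ≤ ∑ j, ‖M i j‖ * ‖v j‖ := by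
    change ‖∑ j, M i j * v j‖ ≤ _
    exact norm_sum_le_of_le _ fun j _ => (norm_mul _ _).le
  exact (pow_le_pow_left₀ (norm_nonneg _) h1 2).trans (Finset.sum_mul_sq_le_sq_mul_sq _ _ _)

/-- The rate `1/8` is the Gaussian gain in `ScatteringBound` after division by 4. -/
theorem one_add_pow_le_exp (N : ℕ) {s : ℝ} (hs : 0 ≤ s) :
    (1 + s) ^ N ≤ 8 ^ N * N.factorial * Real.exp (1 / 8) * Real.exp ((1 / 8) * s) := by
  have h := Real.pow_div_factorial_le_exp ((1 + s) / 8) (by positivity) N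
  rw [div_le_iff₀ (by positivity), div_pow, div_le_iff₀ (by positivity)] at h
  calc (1 + s) ^ N ≤ Real.exp ((1 + s) / 8) * N.factorial * 8 ^ N := h
    _ = _ := by
      rw [show (1 + s) / 8 = 1 / 8 + (1 / 8) * s by ring, Real.exp_add]
      ring

/-- The kernel `exp (kernelPhase S R K)` is dominated as a Gaussian kernel coming from a unitary
scattering matrix `(S R; Rᵗ -K)`. -/
def ScatteringBound (S R K : Matrix (Fin n) (Fin n) ℂ) : Prop :=
  ∀ z w : Fin n → ℂ, 4 * (kernelPhase S R K z w).re ≤ ∑ k, ‖z k‖ ^ 2 + ∑ k, ‖w k‖ ^ 2 -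
    (1 / 2) * ∑ k, ‖star (z k) - (S *ᵥ z) k - (R *ᵥ star w) k‖ ^ 2

/-- Split `z̄` into `z̄ - Sz - Rw̄`, `Sz` and `Rw̄`. The squared triangle inequality costs a factor
3, and `3 · 1/6 = 1/2` lets the `Sz` term be absorbed on the left. -/
theorem one_add_sum_sq_le {S R : Matrix (Fin n) (Fin n) ℂ} {ρ : ℝ}
    (hS : ∑ i, ∑ j, ‖S i j‖ ^ 2 ≤ 1 / 6) (hR : ∑ i, ∑ j, ‖R i j‖ ^ 2 ≤ ρ) (z w : Fin n → ℂ) :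
    1 + ∑ k, ‖z k‖ ^ 2 ≤ (6 + 6 * ρ) *
      ((1 + ∑ k, ‖star (z k) - (S *ᵥ z) k - (R *ᵥ star w) k‖ ^ 2) * (1 + ∑ k, ‖w k‖ ^ 2)) := by
  set y := ∑ k, ‖star (z k) - (S *ᵥ z) k - (R *ᵥ star w) k‖ ^ 2 with hy
  have hy0 : 0 ≤ y := Finset.sum_nonneg fun _ _ => by positivity
  have hz0 : 0 ≤ ∑ k, ‖z k‖ ^ 2 := Finset.sum_nonneg fun _ _ => by positivity
  have hw0 : 0 ≤ ∑ k, ‖w k‖ ^ 2 := Finset.sum_nonneg fun _ _ => by positivity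
  have hρ : 0 ≤ ρ := le_trans (Finset.sum_nonneg fun _ _ => Finset.sum_nonneg fun _ _ => by
    positivity) hR
  have h1 := (sum_norm_mulVec_sq_le S z).trans (mul_le_mul_of_nonneg_right hS hz0)
  have h2 := sum_norm_mulVec_sq_le R (star w)
  simp only [Pi.star_apply, norm_star] at h2
  have h3 := h2.trans (mul_le_mul_of_nonneg_right hR hw0)
  have h4 : ∑ k, ‖z k‖ ^ 2 ≤ 3 * (y + ∑ k, ‖(S *ᵥ z) k‖ ^ 2 + ∑ k, ‖(R *ᵥ star w) k‖ ^ 2) := by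
    rw [hy, ← Finset.sum_add_distrib, ← Finset.sum_add_distrib, Finset.mul_sum]
    refine Finset.sum_le_sum fun k _ => ?_
    have : ‖z k‖ ≤ ‖star (z k) - (S *ᵥ z) k - (R *ᵥ star w) k‖ + ‖(S *ᵥ z) k‖ +
        ‖(R *ᵥ star w) k‖ := by
      rw [← norm_star (z k)]
      refine le_trans (le_of_eq ?_) (norm_add₃_le)
      congr 1
      ring
    refine (pow_le_pow_left₀ (norm_nonneg _) this 2).trans ?_
    generalize ‖star (z k) - (S *ᵥ z) k - (R *ᵥ star w) k‖ = a
    generalize ‖(S *ᵥ z) k‖ = b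
    generalize ‖(R *ᵥ star w) k‖ = c
    nlinarith [sq_nonneg (a - b), sq_nonneg (b - c), sq_nonneg (a - c)]
  nlinarith [mul_nonneg hy0 hw0, mul_nonneg hρ hw0, mul_nonneg hρ hy0,
    mul_nonneg hρ (mul_nonneg hy0 hw0)]

/-- Powers of `1 + |z|²` are bounded by powers of `1 + |w|²` and of one plus the squared distance to
`z̄ = Sz + Rw̄`; the Gaussian gain absorbs the latter. The constant depends only on `n`, `N` and
`ρ`, hence is uniform along a family of kernels. -/
theorem norm_cexp_kernelPhase_decay (N : ℕ) (ρ : ℝ) : ∃ C, 0 ≤ C ∧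
    ∀ S R K : Matrix (Fin n) (Fin n) ℂ, ScatteringBound S R K → ∑ i, ∑ j, ‖S i j‖ ^ 2 ≤ 1 / 6 →
      ∑ i, ∑ j, ‖R i j‖ ^ 2 ≤ ρ → ∀ z w : Fin n → ℂ,
        (1 + ∑ k, ‖z k‖ ^ 2) ^ N * ‖Complex.exp (kernelPhase S R K z w)‖ ≤
          C * (1 + ∑ k, ‖w k‖ ^ 2) ^ N *
            Real.exp ((1 / 4) * ∑ k, ‖z k‖ ^ 2 + (1 / 4) * ∑ k, ‖w k‖ ^ 2) := by
  refine ⟨|6 + 6 * ρ| ^ N * (8 ^ N * N.factorial * Real.exp (1 / 8)), by positivity,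
    fun S R K hb hS hR z w => ?_⟩
  have h1 := one_add_sum_sq_le hS hR z w
  have h2 := hb z w
  set y := ∑ k, ‖star (z k) - (S *ᵥ z) k - (R *ᵥ star w) k‖ ^ 2 with hy
  have hy0 : 0 ≤ y := Finset.sum_nonneg fun _ _ => by positivity
  set a := ∑ k, ‖z k‖ ^ 2
  set b := ∑ k, ‖w k‖ ^ 2
  have ha0 : 0 ≤ a := Finset.sum_nonneg fun _ _ => by positivity
  have hb0 : 0 ≤ b := Finset.sum_nonneg fun _ _ => by positivity
  rw [Complex.norm_exp]
  have h3 : Real.exp (kernelPhase S R K z w).re ≤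
      Real.exp ((1 / 4) * a + (1 / 4) * b - (1 / 8) * y) := Real.exp_le_exp.2 (by linarith)
  have h4 : (1 + a) ^ N ≤ |6 + 6 * ρ| ^ N * ((8 ^ N * N.factorial * Real.exp (1 / 8) *
      Real.exp ((1 / 8) * y)) * (1 + b) ^ N) := by
    calc (1 + a) ^ N ≤ (|6 + 6 * ρ| * ((1 + y) * (1 + b))) ^ N := by
          refine pow_le_pow_left₀ (by positivity) (h1.trans ?_) N
          exact mul_le_mul_of_nonneg_right (le_abs_self _) (by positivity)
      _ = |6 + 6 * ρ| ^ N * ((1 + y) ^ N * (1 + b) ^ N) := by rw [mul_pow, mul_pow]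
      _ ≤ _ := by
          gcongr
          exact one_add_pow_le_exp N hy0
  calc (1 + a) ^ N * Real.exp (kernelPhase S R K z w).re
      ≤ (|6 + 6 * ρ| ^ N * ((8 ^ N * N.factorial * Real.exp (1 / 8) *
        Real.exp ((1 / 8) * y)) * (1 + b) ^ N)) *
        Real.exp ((1 / 4) * a + (1 / 4) * b - (1 / 8) * y) := by gcongr
    _ = _ := by
        rw [show (1 / 4) * a + (1 / 4) * b - (1 / 8) * y =
          ((1 / 4) * a + (1 / 4) * b) + -((1 / 8) * y) by ring, Real.exp_add, Real.exp_neg]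
        have := (Real.exp_pos ((1 / 8) * y)).ne'
        field_simp

/-- Rapid decay of a function on `ℂⁿ` relative to `e^{|w|²/4}`. -/
def FockRapidDecay (f : (Fin n → ℂ) → ℂ) : Prop :=
  ∀ N : ℕ, ∃ C, 0 ≤ C ∧ ∀ w, (1 + ∑ k, ‖w k‖ ^ 2) ^ N * ‖f w‖ ≤
    C * Real.exp ((1 / 4) * ∑ k, ‖w k‖ ^ 2)

/-- The integrand of a superposition of coherent vectors with kernel `G` and density `f`. -/
noncomputable def superposition (G : (Fin n → ℂ) → (Fin n → ℂ) → ℂ) (f : (Fin n → ℂ) → ℂ)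
    (p : (Fin n → ℂ) × (Fin n → ℂ)) : L2 n :=
  (G p.1 p.2 * f p.2 * (fockWeight p.1 : ℂ) * (fockWeight p.2 : ℂ)) • coherent p.1

theorem continuous_superposition {G : (Fin n → ℂ) → (Fin n → ℂ) → ℂ} {f : (Fin n → ℂ) → ℂ}
    (hG : Continuous fun p : (Fin n → ℂ) × (Fin n → ℂ) => G p.1 p.2) (hf : Continuous f) :
    Continuous (superposition G f) := by
  have h1 := Complex.continuous_ofReal.comp (continuous_fockWeight (n := n))
  exact (((hG.mul (hf.comp continuous_snd)).mul (h1.comp continuous_fst)).mul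
    (h1.comp continuous_snd)).smul (continuous_coherent.comp continuous_fst)

/-- The integrable majorant `((1+|u|²)(1+|w|²))^{-(n+1)}` on `ℂⁿ × ℂⁿ`. -/
noncomputable def fockMajorant (p : (Fin n → ℂ) × (Fin n → ℂ)) : ℝ :=
  ((1 + ∑ k, ‖p.1 k‖ ^ 2) ^ (n + 1))⁻¹ * ((1 + ∑ k, ‖p.2 k‖ ^ 2) ^ (n + 1))⁻¹

theorem integrable_inv_one_add_sum_sq_pow :
    Integrable fun w : Fin n → ℂ => ((1 + ∑ k, ‖w k‖ ^ 2) ^ (n + 1))⁻¹ := by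
  -- The decay exponent `2(n + 1)` exceeds the real dimension `2n`.
  have h := integrable_rpow_neg_one_add_norm_sq (E := Fin n → ℂ) (μ := volume)
    (r := 2 * ((n : ℝ) + 1)) (by
      simp [Complex.finrank_real_complex,
        Module.finrank_pi_fintype]
      linarith)
  refine h.mono' (Continuous.aestronglyMeasurable ?_) (Filter.Eventually.of_forall fun w => ?_)
  · refine Continuous.inv₀ (by fun_prop) fun w => ?_
    have : 0 ≤ ∑ k, ‖w k‖ ^ 2 := Finset.sum_nonneg fun _ _ => by positivity
    positivity
  · have h0 : 0 ≤ ∑ k, ‖w k‖ ^ 2 := Finset.sum_nonneg fun _ _ => by positivity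
    rw [Real.norm_of_nonneg (by positivity), show -(2 * ((n : ℝ) + 1)) / 2 = -((n + 1 : ℕ) : ℝ) by
      push_cast; ring, Real.rpow_neg (by positivity), Real.rpow_natCast]
    gcongr
    have h1 : ‖w‖ ≤ Real.sqrt (∑ k, ‖w k‖ ^ 2) := by
      rw [pi_norm_le_iff_of_nonneg (Real.sqrt_nonneg _)]
      intro k
      refine Real.le_sqrt_of_sq_le ?_
      exact Finset.single_le_sum (f := fun k => ‖w k‖ ^ 2) (fun _ _ => by positivity)
        (Finset.mem_univ k)
    calc ‖w‖ ^ 2 ≤ Real.sqrt (∑ k, ‖w k‖ ^ 2) ^ 2 := by gcongr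
      _ = _ := Real.sq_sqrt h0

theorem integrable_fockMajorant : Integrable (fockMajorant (n := n)) :=
  integrable_inv_one_add_sum_sq_pow.mul_prod integrable_inv_one_add_sum_sq_pow

/-- All exponentials cancel: the kernel gives `e^{(|z|²+|w|²)/4}`, the coherent vector `e^{|z|²/4}`,
`f` gives `e^{|w|²/4}`, and the weights `e^{-(|z|²+|w|²)/2}`. Only powers remain. -/
theorem norm_superposition_le {f : (Fin n → ℂ) → ℂ} (hf : FockRapidDecay f) (ρ c : ℝ) (hc : 0 ≤ c) :
    ∃ C, ∀ S R K : Matrix (Fin n) (Fin n) ℂ, ScatteringBound S R K →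
      ∑ i, ∑ j, ‖S i j‖ ^ 2 ≤ 1 / 6 → ∑ i, ∑ j, ‖R i j‖ ^ 2 ≤ ρ →
      ∀ A : (Fin n → ℂ) → (Fin n → ℂ) → ℂ,
      (∀ z w, ‖A z w‖ ≤ c * ((1 + ∑ k, ‖z k‖ ^ 2) * (1 + ∑ k, ‖w k‖ ^ 2))) →
      ∀ p, ‖superposition (fun z w => A z w * Complex.exp (kernelPhase S R K z w)) f p‖ ≤
        C * fockMajorant p := by
  -- In each variable `n + 1` powers form the majorant and one pays for the amplitude; in `w`
  -- another `n + 2` pay for the growth of the kernel bound, whence `n + 2 + (n + 2)` for `f`.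
  obtain ⟨C₁, hC₁, h1⟩ := norm_cexp_kernelPhase_decay (n := n) (n + 2) ρ
  obtain ⟨C₂, hC₂, h2⟩ := hf (n + 2 + (n + 2))
  refine ⟨c * C₁ * C₂, fun S R K hb hS hR A hA p => ?_⟩
  obtain ⟨z, w⟩ := p
  have e1 := h1 S R K hb hS hR z w
  have e2 := h2 w
  have e3 := hA z w
  simp only [superposition, fockMajorant, norm_smul, norm_mul, norm_coherent, Complex.norm_real,
    Real.norm_of_nonneg (fockWeight_pos _).le]
  simp only [fockWeight]
  set a := ∑ k, ‖z k‖ ^ 2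
  set b := ∑ k, ‖w k‖ ^ 2
  have ha0 : 0 ≤ a := Finset.sum_nonneg fun _ _ => by positivity
  have hb0 : 0 ≤ b := Finset.sum_nonneg fun _ _ => by positivity
  generalize ‖A z w‖ = α at *
  generalize hβ : ‖Complex.exp (kernelPhase S R K z w)‖ = β at *
  generalize hγ : ‖f w‖ = γ at *
  have hγ0 : 0 ≤ γ := hγ ▸ norm_nonneg _
  have e4 : β ≤ C₁ * (1 + b) ^ (n + 2) * Real.exp ((1 / 4) * a + (1 / 4) * b) /
      (1 + a) ^ (n + 2) := by
    rw [le_div_iff₀ (by positivity), mul_comm]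
    exact e1
  have e5 : γ ≤ C₂ * Real.exp ((1 / 4) * b) / (1 + b) ^ (n + 2 + (n + 2)) := by
    rw [le_div_iff₀ (by positivity), mul_comm]
    exact e2
  have hβ0 : 0 ≤ β := hβ ▸ norm_nonneg _
  have hE : Real.exp ((1 / 4) * a + (1 / 4) * b) * Real.exp ((1 / 4) * b) *
      Real.exp (-(1 / 2) * a) * Real.exp (-(1 / 2) * b) * Real.exp ((1 / 4) * a) = 1 := by
    simp only [← Real.exp_add]
    rw [Real.exp_eq_one_iff]
    ring
  calc α * β * γ * Real.exp (-(1 / 2) * a) * Real.exp (-(1 / 2) * b) * Real.exp ((1 / 4) * a)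
      ≤ (c * ((1 + a) * (1 + b))) * (C₁ * (1 + b) ^ (n + 2) *
          Real.exp ((1 / 4) * a + (1 / 4) * b) / (1 + a) ^ (n + 2)) *
          (C₂ * Real.exp ((1 / 4) * b) / (1 + b) ^ (n + 2 + (n + 2))) *
          Real.exp (-(1 / 2) * a) * Real.exp (-(1 / 2) * b) * Real.exp ((1 / 4) * a) := by
        gcongr
    _ = c * C₁ * C₂ * (((1 + a) / (1 + a) ^ (n + 2)) *
          ((1 + b) * (1 + b) ^ (n + 2) / (1 + b) ^ (n + 2 + (n + 2)))) *
          (Real.exp ((1 / 4) * a + (1 / 4) * b) * Real.exp ((1 / 4) * b) *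
          Real.exp (-(1 / 2) * a) * Real.exp (-(1 / 2) * b) * Real.exp ((1 / 4) * a)) := by ring
    _ = _ := by
        rw [hE, mul_one]
        congr 1
        congr 1
        · rw [pow_succ (1 + a) (n + 1)]
          field_simp
        · rw [pow_add (1 + b) (n + 2) (n + 2), pow_succ (1 + b) (n + 1)]
          field_simp

/-- Pairing with `coherent z` replaces the vector by the reproducing kernel. By Fubini the integral
over the first variable then reproduces the entire function `G · w` at `z`. -/
theorem bargmann_integral_superposition {G : (Fin n → ℂ) → (Fin n → ℂ) → ℂ}
    {f : (Fin n → ℂ) → ℂ} (hG : Continuous fun p : (Fin n → ℂ) × (Fin n → ℂ) => G p.1 p.2)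
    (hd : ∀ w z v, Differentiable ℂ fun l : ℂ => G (z + l • v) w)
    (hi : Integrable (superposition G f)) (z : Fin n → ℂ) :
    bargmann (∫ p, superposition G f p) z =
      (2 * Real.pi) ^ n * ∫ w, G z w * f w * (fockWeight w : ℂ) := by
  rw [bargmann_eq_inner, ← integral_inner hi]
  have h1 : ∀ p : (Fin n → ℂ) × (Fin n → ℂ), inner ℂ (coherent z) (superposition G f p) =
      (f p.2 * (fockWeight p.2 : ℂ)) * (G p.1 p.2 *
        Complex.exp ((1 / 2) * ∑ k, z k * star (p.1 k)) * (fockWeight p.1 : ℂ)) := by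
    intro p
    rw [superposition, inner_smul_right, inner_coherent]
    ring
  have hi' := hi.const_inner (𝕜 := ℂ) (coherent z)
  simp only [h1] at hi' ⊢
  rw [Measure.volume_eq_prod] at hi' ⊢
  rw [integral_prod_symm _ hi', ← integral_const_mul]
  refine integral_congr_ae ?_
  filter_upwards [hi'.prod_left_ae] with w hw
  rw [integral_const_mul]
  -- Integrability of the slice is known only after multiplication by this scalar; where the scalar
  -- vanishes, so do both sides.
  by_cases h0 : f w * (fockWeight w : ℂ) = 0
  · rw [h0, zero_mul, mul_assoc, h0, mul_zero, mul_zero]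
  · rw [integrable_const_mul_iff (Ne.isUnit h0)] at hw
    rw [integral_mul_reproducing (H := fun u => G u w) (by fun_prop) (hd w) z hw]
    ring

theorem norm_sum_mul_mulVec_le {M : Matrix (Fin n) (Fin n) ℂ} {c : ℝ} (hM : ∀ i j, ‖M i j‖ ≤ c)
    (u v : Fin n → ℂ) {W : ℝ} (hW : ∀ i j, ‖u i‖ * ‖v j‖ ≤ W) (hc : 0 ≤ c) :
    ‖u ⬝ᵥ (M *ᵥ v)‖ ≤ n ^ 2 * (c * W) := by
  have h : u ⬝ᵥ (M *ᵥ v) = ∑ i, ∑ j, u i * (M i j * v j) := by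
    simp only [dotProduct, Matrix.mulVec, Finset.mul_sum]
  rw [h]
  have h1 : ‖∑ i, ∑ j, u i * (M i j * v j)‖ ≤ ∑ _i : Fin n, ∑ _j : Fin n, c * W := by
    refine norm_sum_le_of_le _ fun i _ => norm_sum_le_of_le _ fun j _ => ?_
    rw [norm_mul, norm_mul]
    calc ‖u i‖ * (‖M i j‖ * ‖v j‖) = ‖M i j‖ * (‖u i‖ * ‖v j‖) := by ring
      _ ≤ c * W := mul_le_mul (hM i j) (hW i j) (by positivity) hc
  refine h1.trans (le_of_eq ?_)
  simp
  ring

theorem norm_kernelPhase_le {S R K : Matrix (Fin n) (Fin n) ℂ} {c : ℝ} (hc : 0 ≤ c)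
    (hS : ∀ i j, ‖S i j‖ ≤ c) (hR : ∀ i j, ‖R i j‖ ≤ c) (hK : ∀ i j, ‖K i j‖ ≤ c)
    (z w : Fin n → ℂ) : ‖kernelPhase S R K z w‖ ≤
      n ^ 2 * c * ((1 + ∑ k, ‖z k‖ ^ 2) * (1 + ∑ k, ‖w k‖ ^ 2)) := by
  have hz : ∀ i, ‖z i‖ ^ 2 ≤ ∑ k, ‖z k‖ ^ 2 := fun i =>
    Finset.single_le_sum (f := fun k => ‖z k‖ ^ 2) (fun _ _ => by positivity) (Finset.mem_univ i)
  have hw : ∀ i, ‖w i‖ ^ 2 ≤ ∑ k, ‖w k‖ ^ 2 := fun i =>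
    Finset.single_le_sum (f := fun k => ‖w k‖ ^ 2) (fun _ _ => by positivity) (Finset.mem_univ i)
  have hz0 : 0 ≤ ∑ k, ‖z k‖ ^ 2 := Finset.sum_nonneg fun _ _ => by positivity
  have hw0 : 0 ≤ ∑ k, ‖w k‖ ^ 2 := Finset.sum_nonneg fun _ _ => by positivity
  set a := ∑ k, ‖z k‖ ^ 2
  set b := ∑ k, ‖w k‖ ^ 2
  have h1 := norm_sum_mul_mulVec_le hS z z (W := (1 + a) * (1 + b))
    (fun i j => by nlinarith [hz i, hz j, sq_nonneg (‖z i‖ - ‖z j‖), mul_nonneg hz0 hw0]) hc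
  have h2 := norm_sum_mul_mulVec_le hR z (star w) (W := (1 + a) * (1 + b))
    (fun i j => by
      rw [Pi.star_apply, norm_star]
      nlinarith [hz i, hw j, sq_nonneg (‖z i‖ - ‖w j‖), mul_nonneg hz0 hw0]) hc
  have h3 := norm_sum_mul_mulVec_le hK (star w) (star w) (W := (1 + a) * (1 + b))
    (fun i j => by
      rw [Pi.star_apply, norm_star, Pi.star_apply, norm_star]
      nlinarith [hw i, hw j, sq_nonneg (‖w i‖ - ‖w j‖), mul_nonneg hz0 hw0]) hc
  rw [kernelPhase, norm_mul]
  have h4 : ‖z ⬝ᵥ (S *ᵥ z) + 2 * (z ⬝ᵥ (R *ᵥ star w)) - star w ⬝ᵥ (K *ᵥ star w)‖ ≤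
      ‖z ⬝ᵥ (S *ᵥ z)‖ + 2 * ‖z ⬝ᵥ (R *ᵥ star w)‖ + ‖star w ⬝ᵥ (K *ᵥ star w)‖ := by
    refine (norm_sub_le _ _).trans (add_le_add_left ((norm_add_le _ _).trans ?_) _)
    rw [norm_mul, Complex.norm_ofNat]
  have h5 : ‖(1 / 4 : ℂ)‖ = 1 / 4 := by norm_num
  rw [h5]
  linarith

/-- A differentiable family of Gaussian kernels `D_t exp (kernelPhase S_t R_t K_t)`, uniformly
bounded near `t = 0`. -/
structure KernelFamily (n : ℕ) where
  D : ℝ → ℂ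
  D' : ℝ → ℂ
  S : ℝ → Matrix (Fin n) (Fin n) ℂ
  S' : ℝ → Matrix (Fin n) (Fin n) ℂ
  R : ℝ → Matrix (Fin n) (Fin n) ℂ
  R' : ℝ → Matrix (Fin n) (Fin n) ℂ
  K : ℝ → Matrix (Fin n) (Fin n) ℂ
  K' : ℝ → Matrix (Fin n) (Fin n) ℂ
  nhd : Set ℝ
  nhd_mem : nhd ∈ nhds 0
  bound : ℝ
  hD : ∀ t ∈ nhd, HasDerivAt D (D' t) t
  hS : ∀ t ∈ nhd, ∀ i j, HasDerivAt (fun t => S t i j) (S' t i j) t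
  hR : ∀ t ∈ nhd, ∀ i j, HasDerivAt (fun t => R t i j) (R' t i j) t
  hK : ∀ t ∈ nhd, ∀ i j, HasDerivAt (fun t => K t i j) (K' t i j) t
  norm_D : ∀ t ∈ nhd, ‖D t‖ ≤ bound
  norm_D' : ∀ t ∈ nhd, ‖D' t‖ ≤ bound
  norm_S' : ∀ t ∈ nhd, ∀ i j, ‖S' t i j‖ ≤ bound
  norm_R' : ∀ t ∈ nhd, ∀ i j, ‖R' t i j‖ ≤ bound
  norm_K' : ∀ t ∈ nhd, ∀ i j, ‖K' t i j‖ ≤ bound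
  norm_S : ∀ t ∈ nhd, ∑ i, ∑ j, ‖S t i j‖ ^ 2 ≤ 1 / 6
  norm_R : ∀ t ∈ nhd, ∑ i, ∑ j, ‖R t i j‖ ^ 2 ≤ bound
  scattering : ∀ t ∈ nhd, ScatteringBound (S t) (R t) (K t)

namespace KernelFamily

variable (k : KernelFamily n)

/-- The kernel at time `t`. -/
noncomputable def kernel (t : ℝ) (z w : Fin n → ℂ) : ℂ :=
  k.D t * Complex.exp (kernelPhase (k.S t) (k.R t) (k.K t) z w)

/-- The amplitude of the time derivative of the kernel. -/
noncomputable def amplitude (t : ℝ) (z w : Fin n → ℂ) : ℂ :=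
  k.D' t + k.D t * kernelPhase (k.S' t) (k.R' t) (k.K' t) z w

/-- The time derivative of the kernel. -/
noncomputable def kernel' (t : ℝ) (z w : Fin n → ℂ) : ℂ :=
  k.amplitude t z w * Complex.exp (kernelPhase (k.S t) (k.R t) (k.K t) z w)

theorem hasDerivAt_kernelPhase {t : ℝ} (ht : t ∈ k.nhd) (z w : Fin n → ℂ) :
    HasDerivAt (fun t => kernelPhase (k.S t) (k.R t) (k.K t) z w)
      (kernelPhase (k.S' t) (k.R' t) (k.K' t) z w) t := by
  have key : ∀ {M : ℝ → Matrix (Fin n) (Fin n) ℂ} {M' : Matrix (Fin n) (Fin n) ℂ}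
      (_ : ∀ i j, HasDerivAt (fun t => M t i j) (M' i j) t) (u v : Fin n → ℂ),
      HasDerivAt (fun t => u ⬝ᵥ (M t *ᵥ v)) (u ⬝ᵥ (M' *ᵥ v)) t := by
    intro M M' h u v
    unfold dotProduct Matrix.mulVec dotProduct
    exact HasDerivAt.fun_sum fun i _ => (HasDerivAt.fun_sum fun j _ =>
      (h i j).mul_const (v j)).const_mul (u i)
  exact (((key (k.hS t ht) z z).add ((key (k.hR t ht) z (star w)).const_mul 2)).sub
    (key (k.hK t ht) (star w) (star w))).const_mul (1 / 4)

theorem hasDerivAt_kernel {t : ℝ} (ht : t ∈ k.nhd) (z w : Fin n → ℂ) :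
    HasDerivAt (fun t => k.kernel t z w) (k.kernel' t z w) t := by
  refine ((k.hD t ht).mul (k.hasDerivAt_kernelPhase ht z w).cexp).congr_deriv ?_
  rw [kernel', amplitude]
  ring

theorem continuous_kernel (t : ℝ) :
    Continuous fun p : (Fin n → ℂ) × (Fin n → ℂ) => k.kernel t p.1 p.2 :=
  continuous_const.mul (continuous_kernelPhase _ _ _).cexp

theorem continuous_kernel' (t : ℝ) :
    Continuous fun p : (Fin n → ℂ) × (Fin n → ℂ) => k.kernel' t p.1 p.2 :=
  (continuous_const.add (continuous_const.mul (continuous_kernelPhase _ _ _))).mul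
    (continuous_kernelPhase _ _ _).cexp

theorem differentiable_kernel (t : ℝ) (w z v : Fin n → ℂ) :
    Differentiable ℂ fun l : ℂ => k.kernel t (z + l • v) w :=
  (differentiable_kernelPhase_line _ _ _ z v w).cexp.const_mul _

theorem differentiable_kernel' (t : ℝ) (w z v : Fin n → ℂ) :
    Differentiable ℂ fun l : ℂ => k.kernel' t (z + l • v) w :=
  (((differentiable_kernelPhase_line _ _ _ z v w).const_mul _).const_add _).mul
    (differentiable_kernelPhase_line _ _ _ z v w).cexp

variable {k}

theorem bound_nonneg : 0 ≤ k.bound :=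
  (norm_nonneg _).trans (k.norm_D 0 (mem_of_mem_nhds k.nhd_mem))

theorem one_le_weights (z w : Fin n → ℂ) :
    1 ≤ (1 + ∑ k, ‖z k‖ ^ 2) * (1 + ∑ k, ‖w k‖ ^ 2) := by
  have h1 : 0 ≤ ∑ k, ‖z k‖ ^ 2 := Finset.sum_nonneg fun _ _ => by positivity
  have h2 : 0 ≤ ∑ k, ‖w k‖ ^ 2 := Finset.sum_nonneg fun _ _ => by positivity
  nlinarith [mul_nonneg h1 h2]

theorem integrable_superposition_kernel {f : (Fin n → ℂ) → ℂ} (hfc : Continuous f)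
    (hf : FockRapidDecay f) {t : ℝ} (ht : t ∈ k.nhd) :
    Integrable (superposition (k.kernel t) f) := by
  obtain ⟨C, hC⟩ := norm_superposition_le hf k.bound k.bound k.bound_nonneg
  refine (integrable_fockMajorant.const_mul C).mono'
    (continuous_superposition (k.continuous_kernel t) hfc).aestronglyMeasurable
    (Filter.Eventually.of_forall fun p => ?_)
  exact hC _ _ _ (k.scattering t ht) (k.norm_S t ht) (k.norm_R t ht) (fun _ _ => k.D t)
    (fun z w => (k.norm_D t ht).trans (le_mul_of_one_le_right k.bound_nonneg (one_le_weights z w))) p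

/-- Differentiation in `t` only multiplies the Gaussian by an amplitude quadratic in `z` and `w̄`,
so `norm_superposition_le` dominates the derivative uniformly in `t`. The integral is `L²`-valued,
hence the derivative is one in norm. -/
theorem hasDerivAt_integral_superposition {f : (Fin n → ℂ) → ℂ} (hfc : Continuous f)
    (hf : FockRapidDecay f) :
    Integrable (superposition (k.kernel' 0) f) ∧
      HasDerivAt (fun t => ∫ p, superposition (k.kernel t) f p)
        (∫ p, superposition (k.kernel' 0) f p) 0 := by
  have hb := k.bound_nonneg
  obtain ⟨C, hC⟩ := norm_superposition_le hf k.bound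
    (k.bound + k.bound * (n ^ 2 * k.bound)) (by positivity)
  refine hasDerivAt_integral_of_dominated_loc_of_deriv_le (F' := fun t => superposition (k.kernel' t) f)
    (bound := fun p => C * fockMajorant p) k.nhd_mem
    (Filter.Eventually.of_forall fun t =>
      (continuous_superposition (k.continuous_kernel t) hfc).aestronglyMeasurable)
    (integrable_superposition_kernel hfc hf (mem_of_mem_nhds k.nhd_mem))
    (continuous_superposition (k.continuous_kernel' 0) hfc).aestronglyMeasurable
    (Filter.Eventually.of_forall fun p t ht => ?_) (integrable_fockMajorant.const_mul C)
    (Filter.Eventually.of_forall fun p t ht => ?_)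
  · refine hC _ _ _ (k.scattering t ht) (k.norm_S t ht) (k.norm_R t ht) (k.amplitude t)
      (fun z w => ?_) p
    have h1 := one_le_weights z w
    have h2 := norm_kernelPhase_le hb (k.norm_S' t ht) (k.norm_R' t ht) (k.norm_K' t ht) z w
    set W := (1 + ∑ k, ‖z k‖ ^ 2) * (1 + ∑ k, ‖w k‖ ^ 2)
    calc ‖k.amplitude t z w‖ ≤ ‖k.D' t‖ + ‖k.D t‖ *
          ‖kernelPhase (k.S' t) (k.R' t) (k.K' t) z w‖ := by
          rw [amplitude, ← norm_mul]
          exact norm_add_le _ _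
      _ ≤ k.bound * W + k.bound * (n ^ 2 * k.bound * W) := by
          refine add_le_add ((k.norm_D' t ht).trans (le_mul_of_one_le_right hb h1)) ?_
          exact mul_le_mul (k.norm_D t ht) h2 (norm_nonneg _) hb
      _ = _ := by ring
  · simp only [superposition]
    exact ((((k.hasDerivAt_kernel ht p.1 p.2).mul_const (f p.2)).mul_const _).mul_const _).smul_const _

end KernelFamily

end Superposition

/-! ### The kernel bound from invariance of the form of signature `(n, n)`. -/

section Scattering

variable {n : ℕ}

/-- The Hermitian form of signature `(n, n)`. -/
def signatureForm (n : ℕ) : Matrix (Fin n ⊕ Fin n) (Fin n ⊕ Fin n) ℂ :=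
  Matrix.fromBlocks 1 0 0 (-1)

theorem star_dotProduct_self_eq (z : Fin n → ℂ) : star z ⬝ᵥ z = ((∑ k, ‖z k‖ ^ 2 : ℝ) : ℂ) := by
  push_cast
  exact Finset.sum_congr rfl fun k _ => Complex.conj_mul' _

theorem norm_sq_sub_of_signatureForm {P Q P' Q' : Matrix (Fin n) (Fin n) ℂ}
    (hk : (Matrix.fromBlocks P Q Q' P')ᴴ * signatureForm n * Matrix.fromBlocks P Q Q' P' =
      signatureForm n) (v s : Fin n → ℂ) :
    ∑ i, ‖(P *ᵥ v + Q *ᵥ s) i‖ ^ 2 - ∑ i, ‖(Q' *ᵥ v + P' *ᵥ s) i‖ ^ 2 =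
      ∑ i, ‖v i‖ ^ 2 - ∑ i, ‖s i‖ ^ 2 := by
  have hI : ∀ a b : Fin n → ℂ, star (Sum.elim a b) ⬝ᵥ (signatureForm n *ᵥ Sum.elim a b) =
      ((∑ i, ‖a i‖ ^ 2 - ∑ i, ‖b i‖ ^ 2 : ℝ) : ℂ) := by
    intro a b
    have h1 : star (Sum.elim a b) = Sum.elim (star a) (star b) := by
      ext i; cases i <;> rfl
    rw [h1, signatureForm, Matrix.fromBlocks_mulVec]
    simp only [Sum.elim_comp_inl, Sum.elim_comp_inr, sumElim_dotProduct_sumElim,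
      Matrix.one_mulVec, Matrix.zero_mulVec, add_zero, zero_add, Matrix.neg_mulVec,
      dotProduct_neg, star_dotProduct_self_eq]
    push_cast
    ring
  have h := congrArg (fun M => star (Sum.elim v s) ⬝ᵥ (M *ᵥ Sum.elim v s)) hk
  rw [hI, ← Matrix.mulVec_mulVec, ← Matrix.mulVec_mulVec, Matrix.dotProduct_mulVec,
    ← Matrix.star_mulVec, Matrix.fromBlocks_mulVec] at h
  simp only [Sum.elim_comp_inl, Sum.elim_comp_inr, hI] at h
  exact_mod_cast h

/-- Put `s = w̄` and choose `v`, `y` so that the block matrix sends `(v, s)` to `(z, y)`. Then `y =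
Sz + Rs`, invariance of the form says `|z|² + |s|² = |y|² + |v|²`, and four times the phase is `z·y
+ s·v`. Now `2 Re(z·y) = |z|² + |y|² - |z̄ - y|²` and `2 Re(s·v) ≤ |s|² + |v|²` add up to the bound.
-/
theorem scatteringBound_of_signatureForm {P Q : Matrix (Fin n) (Fin n) ℂ}
    (hk : (Matrix.fromBlocks P Q (Q.map star) (P.map star))ᴴ * signatureForm n *
      Matrix.fromBlocks P Q (Q.map star) (P.map star) = signatureForm n) (hP : IsUnit P.det) :
    ScatteringBound (Q.map star * P⁻¹) (Pᵀ)⁻¹ (P⁻¹ * Q) := by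
  have hk2 := hk
  rw [signatureForm, Matrix.fromBlocks_conjTranspose, Matrix.fromBlocks_multiply,
    Matrix.fromBlocks_multiply, Matrix.fromBlocks_inj] at hk2
  obtain ⟨-, -, h21, h22⟩ := hk2
  have hPt : (P.map star)ᴴ = Pᵀ := by ext; simp
  simp only [hPt, mul_one, mul_zero, add_zero, zero_add, mul_neg, neg_mul] at h21 h22
  have hPR : P.map star - Q.map star * P⁻¹ * Q = (Pᵀ)⁻¹ := by
    refine (Matrix.inv_eq_right_inv ?_).symm
    have h3 : Pᵀ * P.map star = Qᴴ * Q + 1 := by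
      rw [add_neg_eq_iff_eq_add] at h22
      rw [h22]
      abel
    rw [mul_sub, h3, ← mul_assoc, ← mul_assoc, ← add_neg_eq_zero.1 h21, mul_assoc Qᴴ P,
      Matrix.mul_nonsing_inv _ hP, mul_one, add_sub_cancel_left]
  intro z w
  set s := star w with hs
  set v := P⁻¹ *ᵥ (z - Q *ᵥ s) with hv
  set y := Q.map star *ᵥ v + P.map star *ᵥ s with hy
  have hz : P *ᵥ v + Q *ᵥ s = z := by
    rw [hv, Matrix.mulVec_mulVec, Matrix.mul_nonsing_inv _ hP, Matrix.one_mulVec, sub_add_cancel]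
  have hySR : y = (Q.map star * P⁻¹) *ᵥ z + (Pᵀ)⁻¹ *ᵥ s := by
    rw [hy, hv, Matrix.mulVec_sub, Matrix.mulVec_sub, ← hPR, Matrix.sub_mulVec]
    simp only [Matrix.mulVec_mulVec, mul_assoc]
    abel
  have hnorm := norm_sq_sub_of_signatureForm hk v s
  rw [hz, ← hy] at hnorm
  have hs2 : ∑ i, ‖s i‖ ^ 2 = ∑ i, ‖w i‖ ^ 2 := by simp [hs]
  have hphase : 4 * kernelPhase (Q.map star * P⁻¹) (Pᵀ)⁻¹ (P⁻¹ * Q) z w = z ⬝ᵥ y + s ⬝ᵥ v := by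
    rw [kernelPhase, hySR, hv, ← hs, dotProduct_add, Matrix.mulVec_sub, dotProduct_sub,
      Matrix.mulVec_mulVec]
    have h5 : s ⬝ᵥ (P⁻¹ *ᵥ z) = z ⬝ᵥ ((Pᵀ)⁻¹ *ᵥ s) := by
      rw [Matrix.dotProduct_mulVec, ← Matrix.mulVec_transpose, Matrix.transpose_nonsing_inv,
        dotProduct_comm]
    rw [h5]
    ring
  have hre : 4 * (kernelPhase (Q.map star * P⁻¹) (Pᵀ)⁻¹ (P⁻¹ * Q) z w).re =
      ∑ i, (z i * y i).re + ∑ i, (s i * v i).re := by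
    have := congrArg Complex.re hphase
    rw [Complex.add_re, dotProduct, dotProduct, Complex.re_sum, Complex.re_sum] at this
    rw [← this]
    simp
  have hdist : ∑ k, ‖star (z k) - ((Q.map star * P⁻¹) *ᵥ z) k - ((Pᵀ)⁻¹ *ᵥ s) k‖ ^ 2 =
      ∑ i, ‖z i‖ ^ 2 + ∑ i, ‖y i‖ ^ 2 - 2 * ∑ i, (z i * y i).re := by
    rw [Finset.mul_sum, ← Finset.sum_add_distrib, ← Finset.sum_sub_distrib]
    refine Finset.sum_congr rfl fun i _ => ?_
    rw [sub_sub, ← Pi.add_apply, ← hySR, ← Complex.normSq_eq_norm_sq, ← Complex.normSq_eq_norm_sq,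
      ← Complex.normSq_eq_norm_sq, Complex.normSq_sub]
    simp [Complex.normSq_conj, Complex.mul_re]
  have ham : 2 * ∑ i, (s i * v i).re ≤ ∑ i, ‖s i‖ ^ 2 + ∑ i, ‖v i‖ ^ 2 := by
    rw [Finset.mul_sum, ← Finset.sum_add_distrib]
    refine Finset.sum_le_sum fun i _ => ?_
    have h6 : (s i * v i).re ≤ ‖s i‖ * ‖v i‖ := by
      rw [← norm_mul]
      exact Complex.re_le_norm _
    nlinarith [sq_nonneg (‖s i‖ - ‖v i‖)]
  rw [hre, hdist, ← hs2]
  linarith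

end Scattering

/-! ### Derivatives of matrix exponentials, determinants and inverses. -/

section MatrixCalculus

variable {n : ℕ}

open scoped Matrix.Norms.Operator in
theorem contDiff_exp_smul_apply {m : Type*} [Fintype m] [DecidableEq m] (X : Matrix m m ℝ)
    (i j : m) : ContDiff ℝ 1 fun t : ℝ => NormedSpace.exp (t • X) i j := by
  have h1 : ContDiff ℝ 1 fun t : ℝ => NormedSpace.exp (t • X) := by
    rw [contDiff_iff_contDiffAt]
    intro t
    refine ContDiffAt.comp (g := NormedSpace.exp) t
      ((NormedSpace.exp_analytic (𝕂 := ℝ) (t • X)).contDiffAt) ?_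
    fun_prop
  exact (Matrix.entryLinearMap ℝ ℝ i j).toContinuousLinearMap.contDiff.comp h1

open scoped Matrix.Norms.Operator in
theorem hasDerivAt_exp_smul_apply_zero {m : Type*} [Fintype m] [DecidableEq m] (X : Matrix m m ℝ)
    (i j : m) : HasDerivAt (fun t : ℝ => NormedSpace.exp (t • X) i j) (X i j) 0 := by
  have h := hasDerivAt_exp_smul_const (𝕂 := ℝ) X (0 : ℝ)
  rw [zero_smul, NormedSpace.exp_zero, one_mul] at h
  exact (Matrix.entryLinearMap ℝ ℝ i j).toContinuousLinearMap.hasFDerivAt.comp_hasDerivAt 0 h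

theorem hasDerivAt_det_of_eq_one {P : ℝ → Matrix (Fin n) (Fin n) ℂ} {p : Matrix (Fin n) (Fin n) ℂ}
    (h0 : P 0 = 1) (h : ∀ i j, HasDerivAt (fun t => P t i j) (p i j) 0) :
    HasDerivAt (fun t => (P t).det) p.trace 0 := by
  simp only [Matrix.det_apply']
  refine (HasDerivAt.fun_sum fun σ _ => (HasDerivAt.fun_finsetProd fun i _ =>
    h (σ i) i).const_mul _).congr_deriv ?_
  rw [Finset.sum_eq_single 1]
  · simp only [Equiv.Perm.sign_one, Equiv.Perm.one_apply, h0, Matrix.one_apply_eq, smul_eq_mul]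
    simp [Matrix.trace]
  · intro σ _ hσ
    rw [Finset.sum_eq_zero, mul_zero]
    intro i _
    -- A nontrivial permutation moves at least two points, so after the differentiated factor `i` is
    -- removed an off-diagonal entry of `P 0 = 1` remains.
    obtain ⟨j, hji, hj⟩ : ∃ j, j ≠ i ∧ σ j ≠ j := by
      by_contra! hcon
      refine hσ (Equiv.ext fun j => ?_)
      by_cases hj : j = i
      · subst hj
        by_contra hne
        exact hne (σ.injective (hcon (σ j) hne))
      · exact hcon j hj
    rw [Finset.prod_eq_zero (Finset.mem_erase.2 ⟨hji, Finset.mem_univ j⟩), zero_smul]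
    rw [h0, Matrix.one_apply_ne hj]
  · simp

theorem contDiffAt_det {P : ℝ → Matrix (Fin n) (Fin n) ℂ} {t : ℝ}
    (h : ∀ i j, ContDiffAt ℝ 1 (fun t => P t i j) t) : ContDiffAt ℝ 1 (fun t => (P t).det) t := by
  simp only [Matrix.det_apply']
  exact ContDiffAt.sum fun σ _ => contDiffAt_const.mul (contDiffAt_prod fun i _ => h (σ i) i)

theorem contDiffAt_inv_apply {P : ℝ → Matrix (Fin n) (Fin n) ℂ} {t : ℝ}
    (h : ∀ i j, ContDiffAt ℝ 1 (fun t => P t i j) t) (hdet : (P t).det ≠ 0) (i j : Fin n) :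
    ContDiffAt ℝ 1 (fun t => (P t)⁻¹ i j) t := by
  simp only [Matrix.inv_def, Ring.inverse_eq_inv', Matrix.smul_apply, smul_eq_mul,
    Matrix.adjugate_apply]
  refine ((contDiffAt_det h).inv hdet).mul (contDiffAt_det fun a b => ?_)
  simp only [Matrix.updateRow_apply]
  split_ifs
  · exact contDiffAt_const
  · exact h a b

theorem contDiffAt_mul_apply {P Q : ℝ → Matrix (Fin n) (Fin n) ℂ} {t : ℝ}
    (hP : ∀ i j, ContDiffAt ℝ 1 (fun t => P t i j) t)
    (hQ : ∀ i j, ContDiffAt ℝ 1 (fun t => Q t i j) t) (i j : Fin n) :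
    ContDiffAt ℝ 1 (fun t => (P t * Q t) i j) t := by
  simp only [Matrix.mul_apply]
  exact ContDiffAt.sum fun l _ => (hP i l).mul (hQ l j)

theorem hasDerivAt_mul_apply {P Q : ℝ → Matrix (Fin n) (Fin n) ℂ}
    {p q : Matrix (Fin n) (Fin n) ℂ} {t : ℝ}
    (hP : ∀ i j, HasDerivAt (fun t => P t i j) (p i j) t)
    (hQ : ∀ i j, HasDerivAt (fun t => Q t i j) (q i j) t) (i j : Fin n) :
    HasDerivAt (fun t => (P t * Q t) i j) ((p * Q t + P t * q) i j) t := by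
  simp only [Matrix.mul_apply, Matrix.add_apply, ← Finset.sum_add_distrib]
  exact HasDerivAt.fun_sum fun l _ => (hP i l).mul (hQ l j)

theorem hasDerivAt_inv_apply_of_eq_one {P : ℝ → Matrix (Fin n) (Fin n) ℂ}
    {p : Matrix (Fin n) (Fin n) ℂ} (h0 : P 0 = 1)
    (hc : ∀ i j, ContDiffAt ℝ 1 (fun t => P t i j) 0)
    (hP : ∀ i j, HasDerivAt (fun t => P t i j) (p i j) 0) (i j : Fin n) :
    HasDerivAt (fun t => (P t)⁻¹ i j) ((-p) i j) 0 := by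
  have hdet : (P 0).det ≠ 0 := by simp [h0]
  have hd : ∀ i j, HasDerivAt (fun t => (P t)⁻¹ i j)
      ((Matrix.of fun i j => deriv (fun t => (P t)⁻¹ i j) 0) i j) 0 := fun i j =>
    ((contDiffAt_inv_apply hc hdet i j).differentiableAt one_ne_zero).hasDerivAt
  set m := Matrix.of fun i j => deriv (fun t => (P t)⁻¹ i j) 0
  -- Differentiate `P P⁻¹ = 1`, valid near `0`, at `P 0 = 1`.
  have h1 : p + m = 0 := by
    ext a b
    have h2 := hasDerivAt_mul_apply hP hd a b
    have h3 : (fun t => (P t * (P t)⁻¹) a b) =ᶠ[nhds 0] fun _ => (1 : Matrix _ _ ℂ) a b := by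
      filter_upwards [(contDiffAt_det hc).continuousAt.eventually_ne hdet] with t ht
      rw [Matrix.mul_nonsing_inv _ (isUnit_iff_ne_zero.2 ht)]
    have h4 := (h2.congr_of_eventuallyEq h3.symm).unique (hasDerivAt_const 0 _)
    simpa [h0] using h4
  rw [← eq_neg_of_add_eq_zero_right h1]
  exact hd i j

theorem contDiffAt_cpow_const {f : ℝ → ℂ} {t : ℝ} (hf : ContDiffAt ℝ 1 f t)
    (h : f t ∈ Complex.slitPlane) (c : ℂ) : ContDiffAt ℝ 1 (fun t => f t ^ c) t := by
  have h1 : (fun t => f t ^ c) =ᶠ[nhds t] fun t => Complex.exp (Complex.log (f t) * c) := by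
    filter_upwards [hf.continuousAt.eventually_ne (Complex.slitPlane_ne_zero h)] with s hs
    rw [Complex.cpow_def_of_ne_zero hs]
  refine ContDiffAt.congr_of_eventuallyEq ?_ h1
  have h2 : ContDiffAt ℝ 1 (fun t => Complex.log (f t)) t :=
    ((Complex.contDiffAt_log h).restrict_scalars ℝ).comp t hf
  exact (h2.mul contDiffAt_const).cexp

end MatrixCalculus

/-! ### From the real symplectic group to the pseudo-unitary group. -/

section CayleyConjugate

variable {n : ℕ}

/-- The image `UgU⁻¹` of a real matrix under the Cayley transform. -/
noncomputable def cayleyConj (g : Matrix (Fin n ⊕ Fin n) (Fin n ⊕ Fin n) ℝ) :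
    Matrix (Fin n ⊕ Fin n) (Fin n ⊕ Fin n) ℂ :=
  cayleyU n * g.map Complex.ofReal * (cayleyU n)⁻¹

theorem cayleyU_mul_explicit_inverse : cayleyU n * ((1 / 2 : ℂ) • Matrix.fromBlocks 1 1
    (-(Complex.I • 1)) (Complex.I • (1 : Matrix (Fin n) (Fin n) ℂ))) = 1 := by
  rw [cayleyU, Matrix.mul_smul, Matrix.fromBlocks_multiply, ← Matrix.fromBlocks_one,
    Matrix.fromBlocks_smul]
  have : (2⁻¹ : ℂ) • (1 : Matrix (Fin n) (Fin n) ℂ) + (2⁻¹ : ℂ) • 1 = 1 := by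
    rw [← add_smul]; norm_num
  simp [smul_smul, this]

theorem cayleyU_inv : (cayleyU n)⁻¹ = (1 / 2 : ℂ) • Matrix.fromBlocks 1 1
    (-(Complex.I • 1)) (Complex.I • (1 : Matrix (Fin n) (Fin n) ℂ)) :=
  Matrix.inv_eq_right_inv cayleyU_mul_explicit_inverse

theorem cayleyConj_fromBlocks (a b c d : Matrix (Fin n) (Fin n) ℝ) :
    cayleyConj (Matrix.fromBlocks a b c d) = Matrix.fromBlocks
      (Matrix.of fun i j => (1 / 2) * ((a i j + d i j : ℂ) + Complex.I * (c i j - b i j)))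
      (Matrix.of fun i j => (1 / 2) * ((a i j - d i j : ℂ) + Complex.I * (b i j + c i j)))
      (Matrix.of fun i j => (1 / 2) * ((a i j - d i j : ℂ) - Complex.I * (b i j + c i j)))
      (Matrix.of fun i j => (1 / 2) * ((a i j + d i j : ℂ) - Complex.I * (c i j - b i j))) := by
  rw [cayleyConj, cayleyU_inv, cayleyU, Matrix.fromBlocks_map, Matrix.fromBlocks_multiply,
    Matrix.mul_smul, Matrix.fromBlocks_multiply, Matrix.fromBlocks_smul, Matrix.fromBlocks_inj]
  refine ⟨?_, ?_, ?_, ?_⟩ <;> ext i j <;> simp <;> ring_nf <;> simp <;> ring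

/-- The upper left block of the Cayley transform. -/
noncomputable def cayleyP (g : Matrix (Fin n ⊕ Fin n) (Fin n ⊕ Fin n) ℝ) :
    Matrix (Fin n) (Fin n) ℂ := (cayleyConj g).toBlocks₁₁

/-- The upper right block of the Cayley transform. -/
noncomputable def cayleyQ (g : Matrix (Fin n ⊕ Fin n) (Fin n ⊕ Fin n) ℝ) :
    Matrix (Fin n) (Fin n) ℂ := (cayleyConj g).toBlocks₁₂

theorem cayleyP_apply (g : Matrix (Fin n ⊕ Fin n) (Fin n ⊕ Fin n) ℝ) (i j : Fin n) :
    cayleyP g i j = (1 / 2) * ((g (Sum.inl i) (Sum.inl j) + g (Sum.inr i) (Sum.inr j) : ℂ) +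
      Complex.I * (g (Sum.inr i) (Sum.inl j) - g (Sum.inl i) (Sum.inr j))) := by
  rw [cayleyP, ← Matrix.fromBlocks_toBlocks g, cayleyConj_fromBlocks, Matrix.toBlocks_fromBlocks₁₁]
  rfl

theorem cayleyQ_apply (g : Matrix (Fin n ⊕ Fin n) (Fin n ⊕ Fin n) ℝ) (i j : Fin n) :
    cayleyQ g i j = (1 / 2) * ((g (Sum.inl i) (Sum.inl j) - g (Sum.inr i) (Sum.inr j) : ℂ) +
      Complex.I * (g (Sum.inl i) (Sum.inr j) + g (Sum.inr i) (Sum.inl j))) := by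
  rw [cayleyQ, ← Matrix.fromBlocks_toBlocks g, cayleyConj_fromBlocks, Matrix.toBlocks_fromBlocks₁₂]
  rfl

theorem cayleyConj_eq_fromBlocks (g : Matrix (Fin n ⊕ Fin n) (Fin n ⊕ Fin n) ℝ) :
    cayleyConj g = Matrix.fromBlocks (cayleyP g) (cayleyQ g) ((cayleyQ g).map star)
      ((cayleyP g).map star) := by
  rw [← Matrix.fromBlocks_toBlocks (cayleyConj g), Matrix.fromBlocks_inj]
  refine ⟨rfl, rfl, ?_, ?_⟩
  · ext i j
    rw [Matrix.map_apply, cayleyQ_apply, ← Matrix.fromBlocks_toBlocks g, cayleyConj_fromBlocks,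
      Matrix.toBlocks_fromBlocks₂₁]
    simp
    ring
  · ext i j
    rw [Matrix.map_apply, cayleyP_apply, ← Matrix.fromBlocks_toBlocks g, cayleyConj_fromBlocks,
      Matrix.toBlocks_fromBlocks₂₂]
    simp
    ring

theorem cayleyConj_signatureForm {g : Matrix (Fin n ⊕ Fin n) (Fin n ⊕ Fin n) ℝ}
    (hg : gᵀ * Matrix.J (Fin n) ℝ * g = Matrix.J (Fin n) ℝ) :
    (cayleyConj g)ᴴ * signatureForm n * cayleyConj g = signatureForm n := by
  set V := (cayleyU n)⁻¹ with hV
  have hUV : cayleyU n * V = 1 := by rw [hV, cayleyU_inv, cayleyU_mul_explicit_inverse]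
  set Jc : Matrix (Fin n ⊕ Fin n) (Fin n ⊕ Fin n) ℂ := (Matrix.J (Fin n) ℝ).map Complex.ofReal
  -- `U` carries the Hermitian form to a multiple of the symplectic one, and real `g` satisfies `gᴴ
  -- = gᵀ`. Note that `Matrix.J` is the negative of `standardJ`.
  have hJ : (cayleyU n)ᴴ * signatureForm n * cayleyU n = (-(2 * Complex.I)) • Jc := by
    rw [cayleyU, signatureForm, Matrix.fromBlocks_conjTranspose, Matrix.fromBlocks_multiply,
      Matrix.fromBlocks_multiply]
    simp only [Jc, Matrix.J, Matrix.fromBlocks_map, Matrix.fromBlocks_smul]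
    rw [Matrix.fromBlocks_inj]
    refine ⟨?_, ?_, ?_, ?_⟩ <;> ext i j <;> by_cases hij : i = j <;>
      simp [hij] <;> ring
  set G := g.map Complex.ofReal
  have hGH : Gᴴ = (gᵀ).map Complex.ofReal := by
    ext i j
    simp [G]
  have hG : Gᴴ * Jc * G = Jc := by
    have := congrArg (fun M => M.map Complex.ofRealHom) hg
    simp only [Matrix.map_mul] at this
    rw [hGH]
    exact this
  calc (cayleyConj g)ᴴ * signatureForm n * cayleyConj g
      = Vᴴ * (Gᴴ * ((cayleyU n)ᴴ * signatureForm n * cayleyU n) * G) * V := by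
        rw [cayleyConj, Matrix.conjTranspose_mul, Matrix.conjTranspose_mul]
        simp only [mul_assoc, G, hV]
    _ = Vᴴ * ((cayleyU n)ᴴ * signatureForm n * cayleyU n) * V := by
        rw [hJ, Matrix.mul_smul, Matrix.smul_mul, hG]
    _ = (cayleyU n * V)ᴴ * signatureForm n * (cayleyU n * V) := by
        rw [Matrix.conjTranspose_mul]
        simp only [mul_assoc]
    _ = signatureForm n := by rw [hUV, Matrix.conjTranspose_one, one_mul, mul_one]

theorem transpose_mul_J_of_mem_sp {X : Matrix (Fin n ⊕ Fin n) (Fin n ⊕ Fin n) ℝ}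
    (hX : X ∈ LieAlgebra.Symplectic.sp (Fin n) ℝ) :
    Xᵀ * Matrix.J (Fin n) ℝ = Matrix.J (Fin n) ℝ * (-X) := by
  rw [LieAlgebra.Symplectic.sp, mem_skewAdjointMatricesLieSubalgebra,
    mem_skewAdjointMatricesSubmodule] at hX
  exact hX

theorem exp_transpose_mul_mul_exp {m : Type*} [Fintype m] [DecidableEq m] {X J : Matrix m m ℝ}
    (hJ : IsUnit J) (hX : Xᵀ * J = J * (-X)) :
    (NormedSpace.exp X)ᵀ * J * NormedSpace.exp X = J := by
  have hJd := (Matrix.isUnit_iff_isUnit_det _).1 hJ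
  have h1 : Xᵀ = J * (-X) * J⁻¹ := by
    rw [← hX, mul_assoc, Matrix.mul_nonsing_inv _ hJd, mul_one]
  have h2 : (NormedSpace.exp X)ᵀ = J * (NormedSpace.exp X)⁻¹ * J⁻¹ := by
    have e1 := Matrix.exp_transpose X
    have e2 := Matrix.exp_conj J (-X) hJ
    have e3 := Matrix.exp_neg X
    rw [← e1, h1, e2, e3]
  have hE : IsUnit (NormedSpace.exp X).det :=
    (Matrix.isUnit_iff_isUnit_det _).1 (Matrix.isUnit_exp X)
  generalize NormedSpace.exp X = E at *
  rw [h2, mul_assoc (J * E⁻¹), Matrix.nonsing_inv_mul _ hJd, mul_one, mul_assoc,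
    Matrix.nonsing_inv_mul _ hE, mul_one]

theorem exp_smul_symplectic {X : Matrix (Fin n ⊕ Fin n) (Fin n ⊕ Fin n) ℝ}
    (hX : X ∈ LieAlgebra.Symplectic.sp (Fin n) ℝ) (t : ℝ) :
    (NormedSpace.exp (t • X))ᵀ * Matrix.J (Fin n) ℝ * NormedSpace.exp (t • X) =
      Matrix.J (Fin n) ℝ := by
  refine exp_transpose_mul_mul_exp
    ((Matrix.isUnit_iff_isUnit_det _).2 (Matrix.isUnit_det_J (Fin n) ℝ)) ?_
  rw [Matrix.transpose_smul, Matrix.smul_mul, transpose_mul_J_of_mem_sp hX, ← Matrix.mul_smul,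
    smul_neg]

end CayleyConjugate

/-! ### The metaplectic kernels along a one-parameter group. -/

section MetaplecticFamily

variable {n : ℕ}

theorem eventually_hasDerivAt_deriv {f : ℝ → ℂ} (hf : ContDiffAt ℝ 1 f 0) :
    (∀ᶠ t in nhds 0, HasDerivAt f (deriv f t) t) ∧ ContinuousAt (deriv f) 0 := by
  constructor
  · filter_upwards [hf.eventually (by simp)] with t ht
    exact (ht.differentiableAt one_ne_zero).hasDerivAt
  · have h := hf.fderiv_right (m := 0) (by norm_num)
    have h2 : deriv f = fun t => fderiv ℝ f t 1 := by
      funext t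
      exact (fderiv_apply_one_eq_deriv).symm
    rw [h2]
    exact h.continuousAt.clm_apply continuousAt_const

theorem exists_kernelFamily_of_contDiffAt {D : ℝ → ℂ} {S R K : ℝ → Matrix (Fin n) (Fin n) ℂ}
    (hD : ContDiffAt ℝ 1 D 0) (hS : ∀ i j, ContDiffAt ℝ 1 (fun t => S t i j) 0)
    (hR : ∀ i j, ContDiffAt ℝ 1 (fun t => R t i j) 0)
    (hK : ∀ i j, ContDiffAt ℝ 1 (fun t => K t i j) 0) (hS0 : S 0 = 0)
    (hscat : ∀ᶠ t in nhds 0, ScatteringBound (S t) (R t) (K t)) :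
    ∃ k : KernelFamily n, k.D = D ∧ k.S = S ∧ k.R = R ∧ k.K = K := by
  have dD := eventually_hasDerivAt_deriv hD
  have dS := fun i j => eventually_hasDerivAt_deriv (hS i j)
  have dR := fun i j => eventually_hasDerivAt_deriv (hR i j)
  have dK := fun i j => eventually_hasDerivAt_deriv (hK i j)
  let T₁ : ℝ → ℝ := fun t => ∑ i, ∑ j, (‖deriv (fun t => S t i j) t‖ +
    ‖deriv (fun t => R t i j) t‖ + ‖deriv (fun t => K t i j) t‖)
  let T₂ : ℝ → ℝ := fun t => ∑ i, ∑ j, ‖R t i j‖ ^ 2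
  -- One function, continuous at `0`, dominates every quantity to be bounded except the norm of `S`,
  -- which is small because `S 0 = 0`.
  let T : ℝ → ℝ := fun t => ‖D t‖ + ‖deriv D t‖ + T₁ t + T₂ t
  have hT : ContinuousAt T 0 := by
    have h1 : ContinuousAt T₁ 0 := by
      refine tendsto_finsetSum _ fun i _ => tendsto_finsetSum _ fun j _ => ?_
      exact ((dS i j).2.norm.add (dR i j).2.norm).add (dK i j).2.norm
    have h2 : ContinuousAt T₂ 0 := by
      refine tendsto_finsetSum _ fun i _ => tendsto_finsetSum _ fun j _ => ?_
      exact ((hR i j).continuousAt.norm.pow 2)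
    exact ((hD.continuousAt.norm.add dD.2.norm).add h1).add h2
  have hSs : ContinuousAt (fun t => ∑ i, ∑ j, ‖S t i j‖ ^ 2) 0 := by
    refine tendsto_finsetSum _ fun i _ => tendsto_finsetSum _ fun j _ => ?_
    exact ((hS i j).continuousAt.norm.pow 2)
  have e1 : ∀ᶠ t in nhds 0, T t ≤ T 0 + 1 :=
    (hT.eventually_lt_const (lt_add_one (T 0))).mono fun _ h => h.le
  have e2 : ∀ᶠ t in nhds 0, ∑ i, ∑ j, ‖S t i j‖ ^ 2 ≤ 1 / 6 :=
    (hSs.eventually_lt_const (u := 1 / 6) (by simp [hS0])).mono fun _ h => h.le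
  have e3 := Filter.eventually_all.2 fun i => Filter.eventually_all.2 fun j => (dS i j).1
  have e4 := Filter.eventually_all.2 fun i => Filter.eventually_all.2 fun j => (dR i j).1
  have e5 := Filter.eventually_all.2 fun i => Filter.eventually_all.2 fun j => (dK i j).1
  have hmem := dD.1.and (e1.and (e2.and (e3.and (e4.and (e5.and hscat)))))
  have hT₁ : ∀ t, 0 ≤ T₁ t := fun t => Finset.sum_nonneg fun i _ => Finset.sum_nonneg fun j _ => by
    positivity
  have hT₂ : ∀ t, 0 ≤ T₂ t := fun t => Finset.sum_nonneg fun i _ => Finset.sum_nonneg fun j _ => by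
    positivity
  have hle : ∀ t i j, ‖deriv (fun t => S t i j) t‖ + ‖deriv (fun t => R t i j) t‖ +
      ‖deriv (fun t => K t i j) t‖ ≤ T₁ t := by
    intro t i j
    refine le_trans ?_ (Finset.single_le_sum (f := fun i => ∑ j, (‖deriv (fun t => S t i j) t‖ +
      ‖deriv (fun t => R t i j) t‖ + ‖deriv (fun t => K t i j) t‖))
      (fun i _ => Finset.sum_nonneg fun j _ => by positivity) (Finset.mem_univ i))
    exact Finset.single_le_sum (f := fun j => ‖deriv (fun t => S t i j) t‖ +
      ‖deriv (fun t => R t i j) t‖ + ‖deriv (fun t => K t i j) t‖)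
      (fun j _ => by positivity) (Finset.mem_univ j)
  have hsum : ∀ t, T t = ‖D t‖ + ‖deriv D t‖ + T₁ t + T₂ t := fun t => rfl
  refine ⟨{ D := D, D' := deriv D, S := S, R := R, K := K
            S' := fun t => Matrix.of fun i j => deriv (fun t => S t i j) t
            R' := fun t => Matrix.of fun i j => deriv (fun t => R t i j) t
            K' := fun t => Matrix.of fun i j => deriv (fun t => K t i j) t
            nhd := _, nhd_mem := hmem, bound := T 0 + 1
            hD := fun t ht => ht.1
            hS := fun t ht => ht.2.2.2.1
            hR := fun t ht => ht.2.2.2.2.1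
            hK := fun t ht => ht.2.2.2.2.2.1
            norm_D := fun t ht => ?_
            norm_D' := fun t ht => ?_
            norm_S' := fun t ht i j => ?_
            norm_R' := fun t ht i j => ?_
            norm_K' := fun t ht i j => ?_
            norm_S := fun t ht => ht.2.2.1
            norm_R := fun t ht => ?_
            scattering := fun t ht => ht.2.2.2.2.2.2 }, rfl, rfl, rfl, rfl⟩
  all_goals
    have h1 := ht.2.1
    rw [hsum t] at h1
    have h2 := norm_nonneg (D t)
    have h3 := norm_nonneg (deriv D t)
    have h4 := hT₁ t
    have h5 := hT₂ t
  · linarith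
  · linarith
  · have := hle t i j
    have h6 := norm_nonneg (deriv (fun t => S t i j) t)
    have h7 := norm_nonneg (deriv (fun t => R t i j) t)
    have h8 := norm_nonneg (deriv (fun t => K t i j) t)
    rw [Matrix.of_apply]
    linarith
  · have := hle t i j
    have h6 := norm_nonneg (deriv (fun t => S t i j) t)
    have h7 := norm_nonneg (deriv (fun t => R t i j) t)
    have h8 := norm_nonneg (deriv (fun t => K t i j) t)
    rw [Matrix.of_apply]
    linarith
  · have := hle t i j
    have h6 := norm_nonneg (deriv (fun t => S t i j) t)
    have h7 := norm_nonneg (deriv (fun t => R t i j) t)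
    have h8 := norm_nonneg (deriv (fun t => K t i j) t)
    rw [Matrix.of_apply]
    linarith
  · have : ∑ i, ∑ j, ‖R t i j‖ ^ 2 = T₂ t := rfl
    linarith

theorem metaplecticKernel_cayleyConj (g : Matrix (Fin n ⊕ Fin n) (Fin n ⊕ Fin n) ℝ)
    (z w : Fin n → ℂ) : metaplecticKernel (cayleyConj g) z w =
      (cayleyP g).det ^ (-(1 / 2) : ℂ) * Complex.exp (kernelPhase
        ((cayleyQ g).map star * (cayleyP g)⁻¹) ((cayleyP g)ᵀ)⁻¹ ((cayleyP g)⁻¹ * cayleyQ g) z w) :=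
  rfl

/-- At `t = 0` one has `P = 1` and `Q = 0`: the principal root is smooth near `det P = 1`, the
kernel starts as the reproducing kernel, and `S = Q̄P⁻¹` starts at zero, so the smallness required
of `S` holds for small `t`. -/
theorem exists_metaplectic_kernelFamily {X : Matrix (Fin n ⊕ Fin n) (Fin n ⊕ Fin n) ℝ}
    (hX : X ∈ LieAlgebra.Symplectic.sp (Fin n) ℝ) :
    ∃ k : KernelFamily n, (∀ t z w, metaplecticKernel (cayleyConj (NormedSpace.exp (t • X))) z w =
        k.kernel t z w) ∧ k.D 0 = 1 ∧ k.S 0 = 0 ∧ k.R 0 = 1 ∧ k.K 0 = 0 ∧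
      k.D' 0 = -(1 / 2) * (cayleyP X).trace ∧ k.S' 0 = (cayleyQ X).map star ∧
      k.R' 0 = -(cayleyP X)ᵀ ∧ k.K' 0 = cayleyQ X := by
  set P : ℝ → Matrix (Fin n) (Fin n) ℂ := fun t => cayleyP (NormedSpace.exp (t • X)) with hPdef
  set Q : ℝ → Matrix (Fin n) (Fin n) ℂ := fun t => cayleyQ (NormedSpace.exp (t • X)) with hQdef
  have hof : ∀ i j, ContDiff ℝ 1 fun t : ℝ => (NormedSpace.exp (t • X) i j : ℂ) := fun i j =>
    Complex.ofRealCLM.contDiff.comp (contDiff_exp_smul_apply X i j)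
  have hofd : ∀ i j, HasDerivAt (fun t : ℝ => (NormedSpace.exp (t • X) i j : ℂ)) (X i j : ℂ) 0 :=
    fun i j => (hasDerivAt_exp_smul_apply_zero X i j).ofReal_comp
  have cP : ∀ i j, ContDiffAt ℝ 1 (fun t => P t i j) 0 := by
    intro i j
    simp only [hPdef, cayleyP_apply]
    exact (contDiff_const.mul (((hof _ _).add (hof _ _)).add
      (contDiff_const.mul ((hof _ _).sub (hof _ _))))).contDiffAt
  have cQ : ∀ i j, ContDiffAt ℝ 1 (fun t => Q t i j) 0 := by
    intro i j
    simp only [hQdef, cayleyQ_apply]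
    exact (contDiff_const.mul (((hof _ _).sub (hof _ _)).add
      (contDiff_const.mul ((hof _ _).add (hof _ _))))).contDiffAt
  have dP : ∀ i j, HasDerivAt (fun t => P t i j) (cayleyP X i j) 0 := by
    intro i j
    simp only [hPdef, cayleyP_apply]
    exact (((hofd _ _).add (hofd _ _)).add (((hofd _ _).sub (hofd _ _)).const_mul _)).const_mul _
  have dQ : ∀ i j, HasDerivAt (fun t => Q t i j) (cayleyQ X i j) 0 := by
    intro i j
    simp only [hQdef, cayleyQ_apply]
    exact (((hofd _ _).sub (hofd _ _)).add (((hofd _ _).add (hofd _ _)).const_mul _)).const_mul _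
  have hP0 : P 0 = 1 := by
    ext i j
    simp only [hPdef, cayleyP_apply, zero_smul, NormedSpace.exp_zero, Matrix.one_apply]
    by_cases h : i = j <;> simp [h]
    norm_num
  have hQ0 : Q 0 = 0 := by
    ext i j
    simp only [hQdef, cayleyQ_apply, zero_smul, NormedSpace.exp_zero, Matrix.one_apply]
    by_cases h : i = j <;> simp [h]
  have hdet0 : (P 0).det ≠ 0 := by simp [hP0]
  have hslit : (P 0).det ∈ Complex.slitPlane := by simp [hP0]
  have cPi := contDiffAt_inv_apply cP hdet0
  have dPi := hasDerivAt_inv_apply_of_eq_one hP0 cP dP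
  have cQs : ∀ i j, ContDiffAt ℝ 1 (fun t => (Q t).map star i j) 0 := fun i j =>
    Complex.conjCLE.contDiff.contDiffAt.comp 0 (cQ i j)
  have dQs : ∀ i j, HasDerivAt (fun t => (Q t).map star i j) ((cayleyQ X).map star i j) 0 :=
    fun i j => (dQ i j).star
  have cD : ContDiffAt ℝ 1 (fun t => (P t).det ^ (-(1 / 2) : ℂ)) 0 :=
    contDiffAt_cpow_const (contDiffAt_det cP) hslit _
  have cS := contDiffAt_mul_apply cQs cPi
  have cR : ∀ i j, ContDiffAt ℝ 1 (fun t => ((P t)ᵀ)⁻¹ i j) 0 := by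
    intro i j
    simp only [← Matrix.transpose_nonsing_inv, Matrix.transpose_apply]
    exact cPi j i
  have cK := contDiffAt_mul_apply cPi cQ
  have hscat : ∀ᶠ t in nhds 0, ScatteringBound ((Q t).map star * (P t)⁻¹) ((P t)ᵀ)⁻¹
      ((P t)⁻¹ * Q t) := by
    filter_upwards [(contDiffAt_det cP).continuousAt.eventually_ne hdet0] with t ht
    refine scatteringBound_of_signatureForm ?_ (isUnit_iff_ne_zero.2 ht)
    have := cayleyConj_signatureForm (exp_smul_symplectic hX t)
    rwa [cayleyConj_eq_fromBlocks] at this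
  obtain ⟨k, hkD, hkS, hkR, hkK⟩ := exists_kernelFamily_of_contDiffAt cD cS cR cK
    (by rw [hQ0, Matrix.map_zero _ (star_zero ℂ), zero_mul]) hscat
  have hmem := mem_of_mem_nhds k.nhd_mem
  refine ⟨k, fun t z w => ?_, ?_, ?_, ?_, ?_, ?_, ?_, ?_, ?_⟩
  · rw [metaplecticKernel_cayleyConj, KernelFamily.kernel, hkD, hkS, hkR, hkK]
  · simp only [hkD]
    rw [hP0, Matrix.det_one, Complex.one_cpow]
  · simp only [hkS]
    rw [hQ0, Matrix.map_zero _ (star_zero ℂ), zero_mul]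
  · simp only [hkR]
    rw [hP0, Matrix.transpose_one, inv_one]
  · simp only [hkK]
    rw [hQ0, mul_zero]
  · have h1 := k.hD 0 hmem
    simp only [hkD] at h1
    have h2 := ((hasDerivAt_id (P 0).det).cpow_const (c := (-(1 / 2) : ℂ)) hslit).comp (0 : ℝ)
      (hasDerivAt_det_of_eq_one hP0 dP)
    rw [h1.unique h2, id, hP0, Matrix.det_one, Complex.one_cpow, mul_one, mul_one]
  · ext i j
    have h1 := k.hS 0 hmem i j
    simp only [hkS] at h1
    rw [h1.unique (hasDerivAt_mul_apply dQs dPi i j), hP0, hQ0, Matrix.map_zero _ (star_zero ℂ)]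
    simp
  · ext i j
    have h1 := k.hR 0 hmem i j
    simp only [hkR, ← Matrix.transpose_nonsing_inv, Matrix.transpose_apply] at h1
    rw [h1.unique (dPi j i)]
    rfl
  · ext i j
    have h1 := k.hK 0 hmem i j
    simp only [hkK] at h1
    rw [h1.unique (hasDerivAt_mul_apply dPi dQ i j), hP0, hQ0]
    simp

end MetaplecticFamily

/-! ### The generator in terms of ladder operators. -/

section Generator

variable {n : ℕ}

/-- The operator `d + ¼(c·Sc + 2c·Ra - a·Ka)` on Schwartz space, where `c` and `a` are the vectors of
the creation and of the annihilation operators. -/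
noncomputable def ladderOp (d : ℂ) (S R K : Matrix (Fin n) (Fin n) ℂ)
    (φ : 𝓢(EuclideanSpace ℝ (Fin n), ℂ)) : 𝓢(EuclideanSpace ℝ (Fin n), ℂ) :=
  d • φ + (1 / 4 : ℂ) • ((∑ i, ∑ j, S i j • creation i (creation j φ)) +
    (2 : ℂ) • (∑ i, ∑ j, R i j • creation i (annihilation j φ)) -
    ∑ i, ∑ j, K i j • annihilation i (annihilation j φ))

theorem dotProduct_mulVec_eq_sum (M : Matrix (Fin n) (Fin n) ℂ) (u v : Fin n → ℂ) :
    u ⬝ᵥ (M *ᵥ v) = ∑ i, ∑ j, M i j * (u i * v j) := by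
  simp only [dotProduct, Matrix.mulVec, Finset.mul_sum]
  exact Finset.sum_congr rfl fun i _ => Finset.sum_congr rfl fun j _ => by ring

/-- Each `w̄_j` becomes an annihilation operator acting first, each `z_i` leaves the integral and
becomes a creation operator. Hence the normal ordering in `ladderOp`. -/
theorem integral_kernelPhase_mul_schwartzBargmann (d : ℂ) (S R K : Matrix (Fin n) (Fin n) ℂ)
    (φ : 𝓢(EuclideanSpace ℝ (Fin n), ℂ)) (z : Fin n → ℂ) :
    ∫ w, (d + kernelPhase S R K z w) * Complex.exp ((1 / 2) * ∑ i, z i * star (w i)) *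
      schwartzBargmann φ w * (fockWeight w : ℂ) =
      (2 * Real.pi) ^ n * schwartzBargmann (ladderOp d S R K φ) z := by
  set f := schwartzBargmann φ
  have i0 : Integrable fun w => f w * Complex.exp ((1 / 2) * ∑ i, z i * star (w i)) *
      (fockWeight w : ℂ) := by
    simpa using integrable_mul_schwartzBargmann_mul (A := fun _ => 1) (a := 0) continuous_const
      (by simp) φ z
  have i1 : ∀ k, Integrable fun w => star (w k) * f w *
      Complex.exp ((1 / 2) * ∑ i, z i * star (w i)) * (fockWeight w : ℂ) := fun k =>
    integrable_mul_schwartzBargmann_mul (A := fun w => star (w k)) (a := 1) (by fun_prop)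
      (fun w => by rw [norm_star]; exact norm_le_exp_sum_norm k w) φ z
  have i2 : ∀ k j, Integrable fun w => (star (w k) * star (w j)) * f w *
      Complex.exp ((1 / 2) * ∑ i, z i * star (w i)) * (fockWeight w : ℂ) := fun k j =>
    integrable_mul_schwartzBargmann_mul (A := fun w => star (w k) * star (w j)) (a := 2)
      (by fun_prop) (fun w => by
        rw [norm_mul, norm_star, norm_star]
        refine (mul_le_mul (norm_le_exp_sum_norm k w) (norm_le_exp_sum_norm j w) (norm_nonneg _)
          (Real.exp_nonneg _)).trans_eq ?_
        rw [← Real.exp_add, ← Finset.sum_add_distrib]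
        exact congrArg _ (Finset.sum_congr rfl fun _ _ => by ring)) φ z
  have e : ∀ w, (d + kernelPhase S R K z w) * Complex.exp ((1 / 2) * ∑ i, z i * star (w i)) *
      f w * (fockWeight w : ℂ) =
      (d + (1 / 4) * ∑ i, ∑ j, S i j * (z i * z j)) *
        (f w * Complex.exp ((1 / 2) * ∑ i, z i * star (w i)) * (fockWeight w : ℂ)) +
      (∑ i, ∑ j, (1 / 2 * (R i j * z i)) * (star (w j) * f w *
        Complex.exp ((1 / 2) * ∑ i, z i * star (w i)) * (fockWeight w : ℂ))) -
      ∑ i, ∑ j, (1 / 4 * K i j) * ((star (w i) * star (w j)) * f w *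
        Complex.exp ((1 / 2) * ∑ i, z i * star (w i)) * (fockWeight w : ℂ)) := by
    intro w
    have h1 : (∑ i, ∑ j, (1 / 2 * (R i j * z i)) * (star (w j) * f w *
        Complex.exp ((1 / 2) * ∑ i, z i * star (w i)) * (fockWeight w : ℂ))) =
        (1 / 2) * (∑ i, ∑ j, R i j * (z i * star w j)) * (f w *
        Complex.exp ((1 / 2) * ∑ i, z i * star (w i)) * (fockWeight w : ℂ)) := by
      simp only [Finset.mul_sum (s := Finset.univ) (f := fun i => ∑ j, R i j * _),
        Finset.mul_sum (s := Finset.univ) (f := fun j => R _ j * _), Finset.sum_mul]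
      exact Finset.sum_congr rfl fun i _ => Finset.sum_congr rfl fun j _ => by
        rw [Pi.star_apply]; ring
    have h2 : (∑ i, ∑ j, (1 / 4 * K i j) * ((star (w i) * star (w j)) * f w *
        Complex.exp ((1 / 2) * ∑ i, z i * star (w i)) * (fockWeight w : ℂ))) =
        (1 / 4) * (∑ i, ∑ j, K i j * (star w i * star w j)) * (f w *
        Complex.exp ((1 / 2) * ∑ i, z i * star (w i)) * (fockWeight w : ℂ)) := by
      simp only [Finset.mul_sum (s := Finset.univ) (f := fun i => ∑ j, K i j * _),
        Finset.mul_sum (s := Finset.univ) (f := fun j => K _ j * _), Finset.sum_mul]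
      exact Finset.sum_congr rfl fun i _ => Finset.sum_congr rfl fun j _ => by
        rw [Pi.star_apply, Pi.star_apply]; ring
    rw [h1, h2, kernelPhase, dotProduct_mulVec_eq_sum, dotProduct_mulVec_eq_sum,
      dotProduct_mulVec_eq_sum]
    ring
  simp only [e]
  have s1 : Integrable fun w => ∑ i, ∑ j, (1 / 2 * (R i j * z i)) * (star (w j) * f w *
      Complex.exp ((1 / 2) * ∑ i, z i * star (w i)) * (fockWeight w : ℂ)) :=
    integrable_finsetSum _ fun i _ => integrable_finsetSum _ fun j _ => (i1 j).const_mul _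
  have s2 : Integrable fun w => ∑ i, ∑ j, (1 / 4 * K i j) * ((star (w i) * star (w j)) * f w *
      Complex.exp ((1 / 2) * ∑ i, z i * star (w i)) * (fockWeight w : ℂ)) :=
    integrable_finsetSum _ fun i _ => integrable_finsetSum _ fun j _ => (i2 i j).const_mul _
  have t1 : ∫ w, ∑ i, ∑ j, (1 / 2 * (R i j * z i)) * (star (w j) * f w *
      Complex.exp ((1 / 2) * ∑ i, z i * star (w i)) * (fockWeight w : ℂ)) =
      ∑ i, ∑ j, (1 / 2 * (R i j * z i)) *
        ((2 * Real.pi) ^ n * schwartzBargmann (annihilation j φ) z) := by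
    rw [integral_finsetSum _ fun i _ => integrable_finsetSum _ fun j _ => (i1 j).const_mul _]
    refine Finset.sum_congr rfl fun i _ => ?_
    rw [integral_finsetSum _ fun j _ => (i1 j).const_mul _]
    refine Finset.sum_congr rfl fun j _ => ?_
    rw [integral_const_mul, integral_star_mul_schwartzBargmann]
  have t2 : ∫ w, ∑ i, ∑ j, (1 / 4 * K i j) * ((star (w i) * star (w j)) * f w *
      Complex.exp ((1 / 2) * ∑ i, z i * star (w i)) * (fockWeight w : ℂ)) =
      ∑ i, ∑ j, (1 / 4 * K i j) *
        ((2 * Real.pi) ^ n * schwartzBargmann (annihilation i (annihilation j φ)) z) := by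
    rw [integral_finsetSum _ fun i _ => integrable_finsetSum _ fun j _ => (i2 i j).const_mul _]
    refine Finset.sum_congr rfl fun i _ => ?_
    rw [integral_finsetSum _ fun j _ => (i2 i j).const_mul _]
    refine Finset.sum_congr rfl fun j _ => ?_
    rw [integral_const_mul, integral_star_mul_star_mul_schwartzBargmann]
  have s0 := i0.const_mul (d + (1 / 4) * ∑ i, ∑ j, S i j * (z i * z j))
  refine (integral_sub (s0.add s1) s2).trans ?_
  simp only [Pi.add_apply]
  rw [integral_add s0 s1, integral_const_mul, integral_schwartzBargmann_mul_reproducing, t1, t2, ladderOp]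
  simp only [map_add, map_sub, map_smul, map_sum, Pi.add_apply, Pi.sub_apply, Pi.smul_apply,
    Finset.sum_apply, schwartzBargmann_creation, smul_eq_mul]
  simp only [mul_add, mul_sub, add_mul, Finset.mul_sum, Finset.sum_mul]
  rw [← add_sub_assoc, ← add_assoc]
  refine congrArg₂ _ (congrArg₂ _ (congrArg₂ _ (by ring) ?_) ?_) ?_ <;>
  exact Finset.sum_congr rfl fun i _ => Finset.sum_congr rfl fun j _ => by ring

/-- A preimage is given, so injectivity determines `bargmannInv` and surjectivity onto the Fock
space is not needed. -/
theorem metaplectic_eq_of_bargmann_eq {g : Matrix (Fin n ⊕ Fin n) (Fin n ⊕ Fin n) ℝ} {φ ψ : L2 n}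
    (h : bargmann ψ = fockMetaplectic (cayleyConj g) (bargmann φ)) : metaplectic g φ = ψ := by
  unfold metaplectic bargmannInv
  rw [← cayleyConj, ← h]
  exact Function.leftInverse_invFun bargmann_injective ψ

theorem hasDerivAt_metaplectic {X : Matrix (Fin n ⊕ Fin n) (Fin n ⊕ Fin n) ℝ}
    (hX : X ∈ LieAlgebra.Symplectic.sp (Fin n) ℝ) (φ : 𝓢(EuclideanSpace ℝ (Fin n), ℂ)) :
    HasDerivAt (fun t : ℝ => metaplectic (NormedSpace.exp (t • X)) (φ.toLp 2))
      ((ladderOp (-(1 / 2) * (cayleyP X).trace) ((cayleyQ X).map star) (-(cayleyP X)ᵀ) (cayleyQ X)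
        φ).toLp 2) 0 := by
  obtain ⟨k, hk, hD, hS, hR, hK, hD', hS', hR', hK'⟩ := exists_metaplectic_kernelFamily hX
  set f := schwartzBargmann φ with hf
  have hfc : Continuous f := continuous_schwartzBargmann φ
  have hfd : FockRapidDecay f := fun N => schwartzBargmann_rapid_decay N φ
  obtain ⟨hi, hder⟩ := k.hasDerivAt_integral_superposition hfc hfd
  have hpi : ((2 * Real.pi : ℂ) ^ n) ≠ 0 := pow_ne_zero _ (by simp [Real.pi_ne_zero])
  -- One factor `(2π)^{-n}` is the normalization of `fockMetaplectic`, the other offsets the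
  -- `(2π)^n` of the reproducing identity.
  set c : ℂ := (((2 * Real.pi : ℂ) ^ n)⁻¹) ^ 2 with hc
  have hsm : ∀ (ψ : L2 n) z, bargmann (c • ψ) z = c * bargmann ψ z := fun ψ z => by
    simp only [bargmann_eq_inner, inner_smul_right]
  have hev : (fun t : ℝ => metaplectic (NormedSpace.exp (t • X)) (φ.toLp 2)) =ᶠ[nhds 0]
      fun t => c • ∫ p, superposition (k.kernel t) f p := by
    filter_upwards [k.nhd_mem] with t ht
    refine metaplectic_eq_of_bargmann_eq (funext fun z => ?_)
    rw [hsm, bargmann_integral_superposition (k.continuous_kernel t) (k.differentiable_kernel t)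
      (k.integrable_superposition_kernel hfc hfd ht), fockMetaplectic, ← schwartzBargmann_def, ← hf]
    simp only [hk, fockWeight, hc]
    push_cast
    field_simp
  have hval : c • ∫ p, superposition (k.kernel' 0) f p =
      (ladderOp (-(1 / 2) * (cayleyP X).trace) ((cayleyQ X).map star) (-(cayleyP X)ᵀ) (cayleyQ X)
        φ).toLp 2 := by
    refine bargmann_injective (funext fun z => ?_)
    rw [hsm, bargmann_integral_superposition (k.continuous_kernel' 0) (k.differentiable_kernel' 0)
      hi, ← schwartzBargmann_def]
    have h1 : ∀ w, k.kernel' 0 z w = (-(1 / 2) * (cayleyP X).trace +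
        kernelPhase ((cayleyQ X).map star) (-(cayleyP X)ᵀ) (cayleyQ X) z w) *
        Complex.exp ((1 / 2) * ∑ i, z i * star (w i)) := by
      intro w
      rw [KernelFamily.kernel', KernelFamily.amplitude, hD, hS, hR, hK, hD', hS', hR', hK', one_mul]
      congr 2
      simp [kernelPhase, dotProduct]
      ring
    simp only [h1]
    rw [integral_kernelPhase_mul_schwartzBargmann, hc]
    field_simp
  rw [← hval]
  exact (hder.const_smul c).congr_of_eventuallyEq hev

end Generator

/-! ### Calculus of the operators `(i∂)^α`. -/

section PartialDerivatives

open scoped ContDiff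

variable {n : ℕ}

/-- The operator `i ∂/∂sⱼ`. -/
noncomputable def iPartial (j : Fin n) (u : EuclideanSpace ℝ (Fin n) → ℂ)
    (s : EuclideanSpace ℝ (Fin n)) : ℂ :=
  Complex.I * lineDeriv ℝ u s (EuclideanSpace.single j 1)

/-- The composition of the operators `(i ∂/∂sⱼ)^{αⱼ}` over the indices `j` in a list. -/
noncomputable def iPartialList (L : List (Fin n)) (α : Fin n → ℕ)
    (g : EuclideanSpace ℝ (Fin n) → ℂ) : EuclideanSpace ℝ (Fin n) → ℂ :=
  L.foldr (fun j h => (iPartial j)^[α j] h) g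

theorem iPartialPow_eq_iPartialList (α : Fin n → ℕ) (g : EuclideanSpace ℝ (Fin n) → ℂ) :
    iPartialPow α g = iPartialList (List.finRange n) α g := rfl

theorem iPartialList_cons (j : Fin n) (L : List (Fin n)) (α : Fin n → ℕ)
    (g : EuclideanSpace ℝ (Fin n) → ℂ) :
    iPartialList (j :: L) α g = (iPartial j)^[α j] (iPartialList L α g) := rfl

/-- Joint smoothness in the parameter `p` and the variable `s` is kept so that Weyl operators later
have continuous output in `p`; plain smoothness is the case of constant `F`. -/
theorem contDiff_uncurry_iPartial (j : Fin n)
    {F : EuclideanSpace ℝ (Fin n) → EuclideanSpace ℝ (Fin n) → ℂ}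
    (hF : ContDiff ℝ ∞ (Function.uncurry F)) :
    ContDiff ℝ ∞ (Function.uncurry fun p => iPartial j (F p)) := by
  have h1 : (Function.uncurry fun p => iPartial j (F p)) = fun q =>
      Complex.I * fderiv ℝ (Function.uncurry F) q (0, EuclideanSpace.single j 1) := by
    funext ⟨p, s⟩
    have h2 := (hF.differentiable (by simp) (p, s)).hasFDerivAt
    have h3 : HasFDerivAt (F p) ((fderiv ℝ (Function.uncurry F) (p, s)).comp
        (ContinuousLinearMap.inr ℝ _ _)) s :=
      HasFDerivAt.comp s h2 (hasFDerivAt_prodMk_right p s)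
    simp only [Function.uncurry_apply_pair, iPartial]
    rw [h3.hasLineDerivAt _ |>.lineDeriv]
    simp
  rw [h1]
  exact contDiff_const.mul ((hF.fderiv_right (m := ∞) (by simp)).clm_apply contDiff_const)

theorem contDiff_uncurry_iPartial_iterate (j : Fin n) (m : ℕ)
    {F : EuclideanSpace ℝ (Fin n) → EuclideanSpace ℝ (Fin n) → ℂ}
    (hF : ContDiff ℝ ∞ (Function.uncurry F)) :
    ContDiff ℝ ∞ (Function.uncurry fun p => (iPartial j)^[m] (F p)) := by
  induction m with
  | zero => exact hF
  | succ m ih =>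
    simp only [Function.iterate_succ_apply']
    exact contDiff_uncurry_iPartial j ih

theorem contDiff_uncurry_iPartialList (L : List (Fin n)) (α : Fin n → ℕ)
    {F : EuclideanSpace ℝ (Fin n) → EuclideanSpace ℝ (Fin n) → ℂ}
    (hF : ContDiff ℝ ∞ (Function.uncurry F)) :
    ContDiff ℝ ∞ (Function.uncurry fun p => iPartialList L α (F p)) := by
  induction L with
  | nil => exact hF
  | cons j L ih =>
    simp only [iPartialList_cons]
    exact contDiff_uncurry_iPartial_iterate j (α j) ih

variable {g h : EuclideanSpace ℝ (Fin n) → ℂ}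

theorem contDiff_iPartial_iterate (hg : ContDiff ℝ ∞ g) (j : Fin n) (m : ℕ) :
    ContDiff ℝ ∞ ((iPartial j)^[m] g) :=
  (contDiff_uncurry_iPartial_iterate j m (F := fun _ => g) (hg.comp contDiff_snd)).comp
    (contDiff_prodMk_right (0 : EuclideanSpace ℝ (Fin n)))

theorem contDiff_iPartial (hg : ContDiff ℝ ∞ g) (j : Fin n) : ContDiff ℝ ∞ (iPartial j g) :=
  contDiff_iPartial_iterate hg j 1

theorem contDiff_iPartialList (hg : ContDiff ℝ ∞ g) (L : List (Fin n)) (α : Fin n → ℕ) :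
    ContDiff ℝ ∞ (iPartialList L α g) :=
  (contDiff_uncurry_iPartialList L α (F := fun _ => g) (hg.comp contDiff_snd)).comp
    (contDiff_prodMk_right (0 : EuclideanSpace ℝ (Fin n)))

theorem iPartial_apply_eq_fderiv (hg : ContDiff ℝ ∞ g) (j : Fin n) (s : EuclideanSpace ℝ (Fin n)) :
    iPartial j g s = Complex.I * fderiv ℝ g s (EuclideanSpace.single j 1) := by
  rw [iPartial, (hg.differentiable (by simp) s).lineDeriv_eq_fderiv]

theorem iPartial_comm (hg : ContDiff ℝ ∞ g) (j k : Fin n) :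
    iPartial j (iPartial k g) = iPartial k (iPartial j g) := by
  have key : ∀ (j k : Fin n) s, iPartial j (iPartial k g) s =
      Complex.I * (Complex.I * fderiv ℝ (fderiv ℝ g) s (EuclideanSpace.single j 1)
        (EuclideanSpace.single k 1)) := by
    intro j k s
    have h1 : iPartial k g = fun s => Complex.I * fderiv ℝ g s (EuclideanSpace.single k 1) :=
      funext (iPartial_apply_eq_fderiv hg k)
    have h2 : HasFDerivAt (fderiv ℝ g) (fderiv ℝ (fderiv ℝ g) s) s :=
      ((hg.fderiv_right (m := ∞) (by simp)).differentiable (by simp) s).hasFDerivAt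
    have h3 := (h2.clm_apply (hasFDerivAt_const (EuclideanSpace.single k (1 : ℝ)) s)).const_mul
      Complex.I
    rw [h1, iPartial, h3.hasLineDerivAt _ |>.lineDeriv]
    simp
  funext s
  rw [key, key, ((contDiff_infty.1 hg 2).contDiffAt.isSymmSndFDerivAt (by simp)).eq]

theorem iPartial_const_mul_add (c : ℂ) (hg : ContDiff ℝ ∞ g) (hh : ContDiff ℝ ∞ h) (j : Fin n) :
    iPartial j (fun s => c * g s + h s) = fun s => c * iPartial j g s + iPartial j h s := by
  funext s
  have h1 := (hg.differentiable (by simp) s).hasFDerivAt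
  have h2 := (hh.differentiable (by simp) s).hasFDerivAt
  have h3 := (h1.const_mul c).fun_add h2
  rw [iPartial, h3.hasLineDerivAt _ |>.lineDeriv, iPartial_apply_eq_fderiv hg,
    iPartial_apply_eq_fderiv hh]
  simp
  ring

theorem iPartial_iterate_const_mul_add (c : ℂ) (hg : ContDiff ℝ ∞ g) (hh : ContDiff ℝ ∞ h)
    (j : Fin n) (m : ℕ) : (iPartial j)^[m] (fun s => c * g s + h s) =
      fun s => c * (iPartial j)^[m] g s + (iPartial j)^[m] h s := by
  induction m with
  | zero => rfl
  | succ m ih =>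
    simp only [Function.iterate_succ_apply', ih]
    exact iPartial_const_mul_add c (contDiff_iPartial_iterate hg j m)
      (contDiff_iPartial_iterate hh j m) j

theorem iPartialList_const_mul_add (c : ℂ) (hg : ContDiff ℝ ∞ g) (hh : ContDiff ℝ ∞ h)
    (L : List (Fin n)) (α : Fin n → ℕ) : iPartialList L α (fun s => c * g s + h s) =
      fun s => c * iPartialList L α g s + iPartialList L α h s := by
  induction L with
  | nil => rfl
  | cons j L ih =>
    rw [iPartialList_cons, ih]
    exact iPartial_iterate_const_mul_add c (contDiff_iPartialList hg L α)
      (contDiff_iPartialList hh L α) j _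

theorem contDiff_coord (k : Fin n) : ContDiff ℝ ∞ fun s : EuclideanSpace ℝ (Fin n) => (s k : ℂ) :=
  (Complex.ofRealCLM.comp (EuclideanSpace.proj (𝕜 := ℝ) k)).contDiff

theorem iPartial_coord_mul (hg : ContDiff ℝ ∞ g) (j k : Fin n) :
    iPartial j (fun s => (s k : ℂ) * g s) =
      fun s => (if j = k then Complex.I else 0) * g s + (s k : ℂ) * iPartial j g s := by
  funext s
  have h1 := (hg.differentiable (by simp) s).hasFDerivAt
  have h2 := (Complex.ofRealCLM.comp (EuclideanSpace.proj (𝕜 := ℝ) k)).hasFDerivAt (x := s)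
  have h3 := h2.mul h1
  have h4 : lineDeriv ℝ (fun s => (s k : ℂ) * g s) s (EuclideanSpace.single j 1) = _ :=
    (h3.hasLineDerivAt (EuclideanSpace.single j 1)).lineDeriv
  rw [iPartial, h4, iPartial_apply_eq_fderiv hg]
  by_cases hjk : j = k
  · subst hjk
    simp
    ring
  · simp [hjk, Ne.symm hjk]
    ring

/-- Leibniz rule. At `m = 0` the truncated exponent `m - 1` is harmless, because its coefficient
vanishes. -/
theorem iPartial_iterate_coord_mul (hg : ContDiff ℝ ∞ g) (j k : Fin n) (m : ℕ) :
    (iPartial j)^[m] (fun s => (s k : ℂ) * g s) =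
      fun s => (if j = k then m * Complex.I else 0) * (iPartial j)^[m - 1] g s +
        (s k : ℂ) * (iPartial j)^[m] g s := by
  induction m with
  | zero => simp
  | succ m ih =>
    rw [Function.iterate_succ_apply', ih,
      iPartial_const_mul_add _ (contDiff_iPartial_iterate hg j _)
        ((contDiff_coord k).mul (contDiff_iPartial_iterate hg j m)),
      iPartial_coord_mul (contDiff_iPartial_iterate hg j m)]
    funext s
    simp only [Nat.add_sub_cancel, Function.iterate_succ_apply']
    rcases m with _ | m
    · simp
    · simp only [Nat.add_sub_cancel, Function.iterate_succ_apply']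
      split_ifs
      · push_cast
        ring
      · ring

theorem iPartialList_congr {L : List (Fin n)} {α β : Fin n → ℕ} (hL : ∀ j ∈ L, α j = β j)
    (g : EuclideanSpace ℝ (Fin n) → ℂ) : iPartialList L α g = iPartialList L β g := by
  induction L with
  | nil => rfl
  | cons j L ih =>
    rw [iPartialList_cons, iPartialList_cons, hL j (by simp),
      ih fun i hi => hL i (List.mem_cons_of_mem _ hi)]

theorem iPartialList_coord_mul (hg : ContDiff ℝ ∞ g) {L : List (Fin n)} (hL : L.Nodup)
    (α : Fin n → ℕ) (k : Fin n) :
    iPartialList L α (fun s => (s k : ℂ) * g s) =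
      fun s => (if k ∈ L then α k * Complex.I else 0) * iPartialList L (α - Pi.single k 1) g s +
        (s k : ℂ) * iPartialList L α g s := by
  induction L with
  | nil => simp [iPartialList]
  | cons j L ih =>
    obtain ⟨hj, hL⟩ := List.nodup_cons.1 hL
    rw [iPartialList_cons, ih hL, iPartial_iterate_const_mul_add _ (contDiff_iPartialList hg _ _)
      ((contDiff_coord k).mul (contDiff_iPartialList hg _ _)),
      iPartial_iterate_coord_mul (contDiff_iPartialList hg _ _)]
    funext s
    by_cases hjk : j = k
    · subst hjk
      have h1 : iPartialList L (α - Pi.single j 1) g = iPartialList L α g :=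
        iPartialList_congr (fun i hi => by
          have : i ≠ j := fun h => hj (h ▸ hi)
          simp [this]) g
      simp [hj, iPartialList_cons, h1]
    · simp [hjk, Ne.symm hjk, iPartialList_cons]

theorem iPartial_iterate_iPartial (hg : ContDiff ℝ ∞ g) (j k : Fin n) (m : ℕ) :
    (iPartial j)^[m] (iPartial k g) = iPartial k ((iPartial j)^[m] g) := by
  induction m with
  | zero => rfl
  | succ m ih =>
    rw [Function.iterate_succ_apply', ih, iPartial_comm (contDiff_iPartial_iterate hg j m),
      Function.iterate_succ_apply']

theorem iPartialList_iPartial (hg : ContDiff ℝ ∞ g) (L : List (Fin n)) (α : Fin n → ℕ)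
    (k : Fin n) : iPartialList L α (iPartial k g) = iPartial k (iPartialList L α g) := by
  induction L with
  | nil => rfl
  | cons j L ih =>
    rw [iPartialList_cons, ih, iPartial_iterate_iPartial (contDiff_iPartialList hg L α),
      iPartialList_cons]

theorem iPartialList_add_single (hg : ContDiff ℝ ∞ g) {L : List (Fin n)} (hL : L.Nodup)
    (α : Fin n → ℕ) {k : Fin n} (hk : k ∈ L) :
    iPartialList L (α + Pi.single k 1) g = iPartialList L α (iPartial k g) := by
  induction L with
  | nil => simp at hk
  | cons j L ih =>
    obtain ⟨hj, hL⟩ := List.nodup_cons.1 hL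
    rw [iPartialList_cons, iPartialList_cons]
    by_cases hjk : j = k
    · subst hjk
      have h1 : iPartialList L (α + Pi.single j 1) g = iPartialList L α g :=
        iPartialList_congr (fun i hi => by
          have : i ≠ j := fun h => hj (h ▸ hi)
          simp [this]) g
      rw [h1, iPartialList_iPartial hg, ← Function.iterate_succ_apply]
      simp
    · rw [ih hL ((List.mem_cons.1 hk).resolve_left (Ne.symm hjk))]
      simp [hjk]

theorem iPartialPow_coord_mul_apply_zero (hg : ContDiff ℝ ∞ g) (α : Fin n → ℕ) (k : Fin n) :
    iPartialPow α (fun s => (s k : ℂ) * g s) 0 =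
      α k * Complex.I * iPartialPow (α - Pi.single k 1) g 0 := by
  rw [iPartialPow_eq_iPartialList, iPartialList_coord_mul hg (List.nodup_finRange n)]
  simp [iPartialPow_eq_iPartialList]

theorem iPartialPow_add_single (hg : ContDiff ℝ ∞ g) (α : Fin n → ℕ) (k : Fin n) :
    iPartialPow (α + Pi.single k 1) g = iPartialPow α (iPartial k g) :=
  iPartialList_add_single hg (List.nodup_finRange n) α (List.mem_finRange k)

theorem iPartialPow_zero (g : EuclideanSpace ℝ (Fin n) → ℂ) : iPartialPow 0 g = g := by
  rw [iPartialPow_eq_iPartialList]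
  induction List.finRange n with
  | nil => rfl
  | cons j L ih => rw [iPartialList_cons, ih]; rfl

end PartialDerivatives

/-! ### The Weyl correspondence and uniqueness of symbols. -/

section WeylCorrespondence

open scoped ContDiff

variable {n : ℕ}

/-- The function `s ↦ (p + s/2)^α φ(p + s)` to which the derivatives of the Weyl correspondence of
a monomial are applied. -/
noncomputable def weylIntegrand (m : Fin n ⊕ Fin n →₀ ℕ) (φ : EuclideanSpace ℝ (Fin n) → ℂ)
    (p s : EuclideanSpace ℝ (Fin n)) : ℂ :=
  (∏ j, ((p j + s j / 2 : ℝ) : ℂ) ^ m (Sum.inl j)) * φ (p + s)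

/-- The Weyl correspondence of a monomial. -/
noncomputable def weylMonomial (m : Fin n ⊕ Fin n →₀ ℕ) (φ : EuclideanSpace ℝ (Fin n) → ℂ)
    (p : EuclideanSpace ℝ (Fin n)) : ℂ :=
  iPartialPow (fun j => m (Sum.inr j)) (weylIntegrand m φ p) 0

/-- The Weyl correspondence as a linear functional of the symbol. -/
noncomputable def weylLinear (φ : EuclideanSpace ℝ (Fin n) → ℂ) (p : EuclideanSpace ℝ (Fin n)) :
    MvPolynomial (Fin n ⊕ Fin n) ℂ →ₗ[ℂ] ℂ :=
  (MvPolynomial.basisMonomials (Fin n ⊕ Fin n) ℂ).constr ℂ fun m => weylMonomial m φ p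

theorem weylOp_eq_weylLinear (f : MvPolynomial (Fin n ⊕ Fin n) ℂ)
    (φ : EuclideanSpace ℝ (Fin n) → ℂ) (p : EuclideanSpace ℝ (Fin n)) :
    weylOp f φ p = weylLinear φ p f := by
  rw [weylLinear, Module.Basis.constr_apply]
  rfl

theorem weylLinear_monomial (m : Fin n ⊕ Fin n →₀ ℕ) (c : ℂ)
    (φ : EuclideanSpace ℝ (Fin n) → ℂ) (p : EuclideanSpace ℝ (Fin n)) :
    weylLinear φ p (MvPolynomial.monomial m c) = c * weylMonomial m φ p := by
  have h1 : MvPolynomial.monomial m c =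
      c • MvPolynomial.basisMonomials (Fin n ⊕ Fin n) ℂ m := by
    rw [MvPolynomial.coe_basisMonomials, MvPolynomial.smul_monomial, smul_eq_mul, mul_one]
  rw [h1, map_smul, weylLinear, Module.Basis.constr_basis, smul_eq_mul]

theorem contDiff_uncurry_weylIntegrand (m : Fin n ⊕ Fin n →₀ ℕ)
    {φ : EuclideanSpace ℝ (Fin n) → ℂ} (hφ : ContDiff ℝ ∞ φ) :
    ContDiff ℝ ∞ (Function.uncurry (weylIntegrand m φ)) := by
  have h1 : Function.uncurry (weylIntegrand m φ) = fun q =>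
      (∏ j, ((q.1 j : ℂ) + (q.2 j : ℂ) * (1 / 2)) ^ m (Sum.inl j)) * φ (q.1 + q.2) := by
    funext ⟨p, s⟩
    simp only [Function.uncurry_apply_pair, weylIntegrand]
    push_cast
    simp only [div_eq_mul_inv, one_mul]
  rw [h1]
  refine (contDiff_prod fun j _ => ?_).mul (hφ.comp (contDiff_fst.add contDiff_snd))
  exact (((contDiff_coord j).comp contDiff_fst).add
    (((contDiff_coord j).comp contDiff_snd).mul contDiff_const)).pow _

theorem contDiff_weylIntegrand (m : Fin n ⊕ Fin n →₀ ℕ) {φ : EuclideanSpace ℝ (Fin n) → ℂ}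
    (hφ : ContDiff ℝ ∞ φ) (p : EuclideanSpace ℝ (Fin n)) : ContDiff ℝ ∞ (weylIntegrand m φ p) := by
  have h1 := contDiff_uncurry_weylIntegrand m hφ
  generalize weylIntegrand m φ = F at h1 ⊢
  exact h1.comp (contDiff_prodMk_right p)

theorem continuous_weylMonomial (m : Fin n ⊕ Fin n →₀ ℕ)
    {φ : EuclideanSpace ℝ (Fin n) → ℂ} (hφ : ContDiff ℝ ∞ φ) : Continuous (weylMonomial m φ) := by
  have h1 := (contDiff_uncurry_iPartialList (List.finRange n) (fun j => m (Sum.inr j))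
    (contDiff_uncurry_weylIntegrand m hφ)).continuous
  have h2 : weylMonomial m φ = fun p =>
      iPartialList (List.finRange n) (fun j => m (Sum.inr j)) (weylIntegrand m φ p) 0 := rfl
  rw [h2]
  generalize weylIntegrand m φ = F at h1 ⊢
  exact h1.comp (Continuous.prodMk_left 0)

theorem continuous_weylOp (f : MvPolynomial (Fin n ⊕ Fin n) ℂ)
    {φ : EuclideanSpace ℝ (Fin n) → ℂ} (hφ : ContDiff ℝ ∞ φ) : Continuous (weylOp f φ) :=
  continuous_finsetSum _ fun m _ => continuous_const.mul (continuous_weylMonomial m hφ)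

theorem weylMonomial_coord_mul (m : Fin n ⊕ Fin n →₀ ℕ) {φ : EuclideanSpace ℝ (Fin n) → ℂ}
    (hφ : ContDiff ℝ ∞ φ) (p : EuclideanSpace ℝ (Fin n)) (k : Fin n) :
    weylMonomial m (fun x => (x k : ℂ) * φ x) p = p k * weylMonomial m φ p +
      m (Sum.inr k) * Complex.I * weylMonomial (m - Finsupp.single (Sum.inr k) 1) φ p := by
  have hs := contDiff_weylIntegrand m hφ p
  have h1 : weylIntegrand m (fun x => (x k : ℂ) * φ x) p = fun s =>
      (p k : ℂ) * weylIntegrand m φ p s + (s k : ℂ) * weylIntegrand m φ p s := by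
    funext s
    simp only [weylIntegrand, PiLp.add_apply]
    push_cast
    ring
  have h2 : weylIntegrand (m - Finsupp.single (Sum.inr k) 1) φ p = weylIntegrand m φ p := by
    funext s
    simp [weylIntegrand]
  have h3 : (fun j => (m - Finsupp.single (Sum.inr k) 1 : Fin n ⊕ Fin n →₀ ℕ) (Sum.inr j)) =
      (fun j => m (Sum.inr j)) - Pi.single k 1 := by
    funext j
    by_cases hjk : j = k
    · subst hjk; simp
    · simp [hjk]
  rw [weylMonomial, weylMonomial, weylMonomial, h1, h2, h3, iPartialPow_eq_iPartialList,
    iPartialList_const_mul_add _ hs ((contDiff_coord k).mul hs), ← iPartialPow_eq_iPartialList,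
    ← iPartialPow_eq_iPartialList]
  exact congrArg _ (iPartialPow_coord_mul_apply_zero hs _ _)

/-- The coordinate at `p + s` is `p_k + s_k`, and at `s = 0` the factor `s_k` only survives by
lowering one exponent of `(i∂)^α`. This commutator relation drives the uniqueness proof. -/
theorem weylLinear_coord_mul (f : MvPolynomial (Fin n ⊕ Fin n) ℂ)
    {φ : EuclideanSpace ℝ (Fin n) → ℂ} (hφ : ContDiff ℝ ∞ φ) (p : EuclideanSpace ℝ (Fin n))
    (k : Fin n) : weylLinear (fun x => (x k : ℂ) * φ x) p f = p k * weylLinear φ p f +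
      Complex.I * weylLinear φ p (MvPolynomial.pderiv (Sum.inr k) f) := by
  induction f using MvPolynomial.induction_on' with
  | monomial m c =>
    rw [MvPolynomial.pderiv_monomial, weylLinear_monomial, weylLinear_monomial,
      weylLinear_monomial, weylMonomial_coord_mul m hφ]
    ring
  | add f g hf hg =>
    simp only [map_add, hf, hg]
    ring

theorem weylLinear_of_forall_pderiv_eq_zero {f : MvPolynomial (Fin n ⊕ Fin n) ℂ}
    (hf : ∀ k, MvPolynomial.pderiv (Sum.inr k) f = 0) (φ : EuclideanSpace ℝ (Fin n) → ℂ)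
    (p : EuclideanSpace ℝ (Fin n)) (y : Fin n → ℂ) :
    weylLinear φ p f = MvPolynomial.eval (Sum.elim (fun j => (p j : ℂ)) y) f * φ p := by
  rw [← weylOp_eq_weylLinear, weylOp, MvPolynomial.eval_eq', Finset.sum_mul]
  refine Finset.sum_congr rfl fun m hm => ?_
  have h0 : ∀ k, m (Sum.inr k) = 0 := by
    intro k
    by_contra hk
    have h1 := MvPolynomial.coeff_pderiv (i := Sum.inr k) f (m - Finsupp.single (Sum.inr k) 1)
    have h2 : m - Finsupp.single (Sum.inr k) 1 + Finsupp.single (Sum.inr k) 1 = m :=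
      tsub_add_cancel_of_le (Finsupp.single_le_iff.2 (Nat.one_le_iff_ne_zero.2 hk))
    rw [hf k, MvPolynomial.coeff_zero, h2] at h1
    rcases mul_eq_zero.1 h1.symm with h3 | h3
    · exact MvPolynomial.mem_support_iff.1 hm h3
    · exact Nat.cast_add_one_ne_zero _ h3
  have h1 : (fun j => m (Sum.inr j)) = (0 : Fin n → ℕ) := funext h0
  rw [h1, iPartialPow_zero, Fintype.prod_sum_type]
  simp [h0, mul_assoc]

theorem exists_schwartz_apply_ne_zero (p : EuclideanSpace ℝ (Fin n)) :
    ∃ φ : 𝓢(EuclideanSpace ℝ (Fin n), ℂ), φ p ≠ 0 := by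
  let b : ContDiffBump p := ⟨1, 2, one_pos, one_lt_two⟩
  have h1 : HasCompactSupport fun x => (b x : ℂ) :=
    b.hasCompactSupport.comp_left (g := fun r : ℝ => (r : ℂ)) Complex.ofReal_zero
  have h2 : ContDiff ℝ ∞ fun x => (b x : ℂ) := Complex.ofRealCLM.contDiff.comp b.contDiff
  refine ⟨h1.toSchwartzMap h2, ?_⟩
  have h3 : b p = 1 := b.one_of_mem_closedBall (by simp [b.rIn_pos.le])
  simp [h3]

/-- Induction on the degree in `y`. If `𝒲(f) = 0` on Schwartz functions, the commutator with `x_k`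
shows the same for `∂f/∂y_k`, of lower `y`-degree, so these derivatives vanish. Then `f` depends on
`x` only, acts by multiplication, and vanishes at all real points. -/
theorem eq_zero_of_weylLinear_eq_zero {f : MvPolynomial (Fin n ⊕ Fin n) ℂ}
    (hf : ∀ (φ : 𝓢(EuclideanSpace ℝ (Fin n), ℂ)) p, weylLinear φ p f = 0) : f = 0 := by
  suffices h : ∀ (N : ℕ) (f : MvPolynomial (Fin n ⊕ Fin n) ℂ),
      (∀ m ∈ f.support, ∑ k, m (Sum.inr k) < N) →
      (∀ (φ : 𝓢(EuclideanSpace ℝ (Fin n), ℂ)) p, weylLinear φ p f = 0) → f = 0 from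
    h (f.support.sup (fun m => ∑ k, m (Sum.inr k)) + 1) f
      (fun m hm => Nat.lt_succ_of_le (Finset.le_sup (f := fun m : Fin n ⊕ Fin n →₀ ℕ =>
        ∑ k, m (Sum.inr k)) hm)) hf
  intro N
  induction N with
  | zero =>
    intro f hf _
    rw [← MvPolynomial.support_eq_empty]
    exact Finset.eq_empty_of_forall_notMem fun m hm => absurd (hf m hm) (Nat.not_lt_zero _)
  | succ N ih =>
    intro f hN hf
    have hd : ∀ k, MvPolynomial.pderiv (Sum.inr k) f = 0 := by
      intro k
      refine ih _ (fun m hm => ?_) fun φ p => ?_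
      · rw [MvPolynomial.mem_support_iff, MvPolynomial.coeff_pderiv] at hm
        have h1 := hN _ (MvPolynomial.mem_support_iff.2 (left_ne_zero_of_mul hm))
        have h2 : ∑ j, (m + Finsupp.single (Sum.inr k) 1 : Fin n ⊕ Fin n →₀ ℕ) (Sum.inr j) =
            ∑ j, m (Sum.inr j) + 1 := by
          simp [Finset.sum_add_distrib, Finsupp.single_apply]
        omega
      · have h1 := weylLinear_coord_mul f (φ.smooth ⊤) p k
        have h2 : (fun x => (x k : ℂ) * φ x) = coordMul k φ :=
          funext fun x => (coordMul_apply k φ x).symm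
        rw [h2, hf, hf, mul_zero, zero_add] at h1
        exact (mul_eq_zero.1 h1.symm).resolve_left Complex.I_ne_zero
    -- Vanishing at real points is enough, the reals being an infinite set in each variable.
    refine MvPolynomial.funext_set (fun _ => Set.range ((↑) : ℝ → ℂ))
      (fun _ => Set.infinite_range_of_injective Complex.ofReal_injective) fun x hx => ?_
    have hx' : ∀ i, ∃ r : ℝ, (r : ℂ) = x i := fun i => hx i (Set.mem_univ i)
    choose r hr using hx'
    set p : EuclideanSpace ℝ (Fin n) := WithLp.toLp 2 fun j => r (Sum.inl j)
    obtain ⟨φ, hφ⟩ := exists_schwartz_apply_ne_zero p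
    have h1 := weylLinear_of_forall_pderiv_eq_zero hd φ p fun j => x (Sum.inr j)
    have h2 : Sum.elim (fun j => (p j : ℂ)) (fun j => x (Sum.inr j)) = x := by
      funext i
      rcases i with i | i
      · exact hr _
      · rfl
    rw [hf, h2] at h1
    rw [map_zero]
    exact (mul_eq_zero.1 h1.symm).resolve_right hφ

/-- Both Weyl operators give continuous functions, so almost everywhere equality holds pointwise. -/
theorem IsWeylSymbol.unique {T : L2 n →. L2 n} {f g : MvPolynomial (Fin n ⊕ Fin n) ℂ}
    (hf : IsWeylSymbol T f) (hg : IsWeylSymbol T g) : f = g := by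
  rw [← sub_eq_zero]
  refine eq_zero_of_weylLinear_eq_zero fun φ p => ?_
  obtain ⟨ψ, hψ, hψf⟩ := hf φ
  obtain ⟨ψ', hψ', hψg⟩ := hg φ
  rw [Part.mem_unique hψ' hψ] at hψg
  have h1 := Measure.eq_of_ae_eq (hψf.symm.trans hψg) (continuous_weylOp f (φ.smooth ⊤))
    (continuous_weylOp g (φ.smooth ⊤))
  rw [map_sub, ← weylOp_eq_weylLinear, ← weylOp_eq_weylLinear, h1, sub_self]

end WeylCorrespondence

/-! ### Quadratic symbols and the comparison of orderings. -/

section QuadraticSymbols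

open scoped ContDiff
open MvPolynomial (X pderiv monomial)

variable {n : ℕ}

theorem iPartial_comp_add (j : Fin n) (g : EuclideanSpace ℝ (Fin n) → ℂ)
    (p : EuclideanSpace ℝ (Fin n)) :
    iPartial j (fun s => g (p + s)) = fun s => iPartial j g (p + s) := by
  funext s
  simp only [iPartial, lineDeriv, add_assoc]

variable (φ : 𝓢(EuclideanSpace ℝ (Fin n), ℂ))

theorem iPartial_schwartz (j : Fin n) : iPartial j φ = fun x => Complex.I * coordDeriv j φ x :=
  funext fun x => by rw [coordDeriv_apply, iPartial]

theorem coordDeriv_coordMul_apply (i j : Fin n) (x : EuclideanSpace ℝ (Fin n)) :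
    coordDeriv i (coordMul j φ) x = (if i = j then 1 else 0) * φ x + x j * coordDeriv i φ x := by
  have h1 := congrFun (iPartial_coord_mul (φ.smooth ⊤) i j) x
  have h2 : (fun x => (x j : ℂ) * φ x) = coordMul j φ :=
    funext fun x => (coordMul_apply j φ x).symm
  rw [h2, iPartial_schwartz, iPartial_schwartz] at h1
  refine mul_left_cancel₀ Complex.I_ne_zero (h1.trans ?_)
  split_ifs <;> ring

theorem iPartial_const_mul (c : ℂ) {g : EuclideanSpace ℝ (Fin n) → ℂ} (hg : ContDiff ℝ ∞ g)
    (j : Fin n) : iPartial j (fun s => c * g s) = fun s => c * iPartial j g s := by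
  have h1 := iPartial_const_mul_add c hg (contDiff_const (c := (0 : ℂ))) j
  have h2 : iPartial j (fun _ => (0 : ℂ)) = fun _ => 0 := by
    funext s
    simp [iPartial, lineDeriv]
  simpa [h2] using h1

theorem iPartial_iPartial_schwartz (i j : Fin n) (x : EuclideanSpace ℝ (Fin n)) :
    iPartial i (iPartial j φ) x = -coordDeriv i (coordDeriv j φ) x := by
  rw [iPartial_schwartz, iPartial_const_mul _ ((coordDeriv j φ).smooth ⊤), iPartial_schwartz]
  simp only [← mul_assoc, Complex.I_mul_I, neg_one_mul]

theorem coordDeriv_comm_apply (i j : Fin n) (x : EuclideanSpace ℝ (Fin n)) :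
    coordDeriv i (coordDeriv j φ) x = coordDeriv j (coordDeriv i φ) x := by
  have h1 := congrFun (iPartial_comm (φ.smooth ⊤) i j) x
  rw [iPartial_iPartial_schwartz, iPartial_iPartial_schwartz] at h1
  exact neg_injective h1

theorem weylLinear_X_mul_X_inl_inl (i j : Fin n) (p : EuclideanSpace ℝ (Fin n)) :
    weylLinear φ p (X (Sum.inl i) * X (Sum.inl j)) = p i * p j * φ p := by
  rw [weylLinear_of_forall_pderiv_eq_zero (fun k => ?_) φ p 0]
  · simp
  · simp [MvPolynomial.pderiv_X]

theorem X_mul_X_eq_monomial (a b : Fin n ⊕ Fin n) :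
    (X a * X b : MvPolynomial (Fin n ⊕ Fin n) ℂ) =
      monomial (Finsupp.single a 1 + Finsupp.single b 1) 1 := by
  rw [MvPolynomial.X, MvPolynomial.X, MvPolynomial.monomial_mul, mul_one]

theorem weylLinear_X_mul_X_inr_inr (i j : Fin n) (p : EuclideanSpace ℝ (Fin n)) :
    weylLinear φ p (X (Sum.inr i) * X (Sum.inr j)) = -coordDeriv i (coordDeriv j φ) p := by
  have hs : ContDiff ℝ ∞ fun s => φ (p + s) := (φ.smooth ⊤).comp (contDiff_const.add contDiff_id)
  rw [X_mul_X_eq_monomial, weylLinear_monomial, one_mul, weylMonomial]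
  have h1 : (fun k => (Finsupp.single (Sum.inr i) 1 + Finsupp.single (Sum.inr j) 1 :
      Fin n ⊕ Fin n →₀ ℕ) (Sum.inr k)) = 0 + Pi.single i 1 + Pi.single j 1 := by
    funext k
    simp [Finsupp.single_apply, Pi.single_apply, eq_comm]
  have h2 : weylIntegrand (Finsupp.single (Sum.inr i) 1 + Finsupp.single (Sum.inr j) 1) φ p =
      fun s => φ (p + s) := by
    funext s
    simp [weylIntegrand]
  rw [h1, h2, iPartialPow_add_single hs, iPartialPow_add_single (contDiff_iPartial hs j),
    iPartialPow_zero, iPartial_comp_add, iPartial_comp_add]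
  simp only [iPartial_iPartial_schwartz, add_zero]

/-- The diagonal `1/2` comes from differentiating `s_j/2` in `p_j + s_j/2`; it is the symmetric
ordering of `x_j` and `∂_j`. -/
theorem weylLinear_X_mul_X_inr_inl (i j : Fin n) (p : EuclideanSpace ℝ (Fin n)) :
    weylLinear φ p (X (Sum.inr i) * X (Sum.inl j)) =
      Complex.I * ((if i = j then 1 / 2 else 0) * φ p + p j * coordDeriv i φ p) := by
  have hs : ContDiff ℝ ∞ fun s => φ (p + s) := (φ.smooth ⊤).comp (contDiff_const.add contDiff_id)
  rw [X_mul_X_eq_monomial, weylLinear_monomial, one_mul, weylMonomial]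
  have h1 : (fun k => (Finsupp.single (Sum.inr i) 1 + Finsupp.single (Sum.inl j) 1 :
      Fin n ⊕ Fin n →₀ ℕ) (Sum.inr k)) = 0 + Pi.single i 1 := by
    funext k
    simp [Finsupp.single_apply, Pi.single_apply, eq_comm]
  have h2 : weylIntegrand (Finsupp.single (Sum.inr i) 1 + Finsupp.single (Sum.inl j) 1) φ p =
      fun s => (p j : ℂ) * φ (p + s) + (s j : ℂ) * ((1 / 2) * φ (p + s)) := by
    funext s
    simp [weylIntegrand, Finsupp.single_apply]
    ring
  have hs' : ContDiff ℝ ∞ fun s => (1 / 2 : ℂ) * φ (p + s) := contDiff_const.mul hs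
  have h3 := contDiff_weylIntegrand (Finsupp.single (Sum.inr i) 1 + Finsupp.single (Sum.inl j) 1)
    (φ.smooth ⊤) p
  rw [h2] at h3
  rw [h1, h2, iPartialPow_add_single h3, iPartialPow_zero,
    iPartial_const_mul_add _ hs ((contDiff_coord j).mul hs'), iPartial_coord_mul hs',
    iPartial_comp_add, iPartial_schwartz]
  simp only [PiLp.zero_apply, Complex.ofReal_zero, zero_mul, add_zero]
  split_ifs <;> ring

/-- The quadratic polynomial `½i(2y·Ax + y·By - x·Cx)`. -/
noncomputable def quadraticSymbol (A B C : Matrix (Fin n) (Fin n) ℝ) :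
    MvPolynomial (Fin n ⊕ Fin n) ℂ :=
  ∑ i, ∑ j, ((Complex.I * A i j) • (X (Sum.inr i) * X (Sum.inl j)) +
    (Complex.I / 2 * B i j) • (X (Sum.inr i) * X (Sum.inr j)) -
    (Complex.I / 2 * C i j) • (X (Sum.inl i) * X (Sum.inl j)))

theorem eval_quadraticSymbol (A B C : Matrix (Fin n) (Fin n) ℝ) (x y : Fin n → ℝ) :
    MvPolynomial.eval (Sum.elim (fun j => (x j : ℂ)) (fun j => (y j : ℂ))) (quadraticSymbol A B C) =
      (1 / 2) * Complex.I * ((2 * (y ⬝ᵥ A *ᵥ x) + y ⬝ᵥ B *ᵥ y - x ⬝ᵥ C *ᵥ x : ℝ) : ℂ) := by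
  simp only [quadraticSymbol, dotProduct, Matrix.mulVec, map_sum, map_add, map_sub,
    MvPolynomial.smul_eval, map_mul, MvPolynomial.eval_X, Sum.elim_inl, Sum.elim_inr]
  push_cast
  simp only [Finset.mul_sum, mul_add, mul_sub, ← Finset.sum_add_distrib, ← Finset.sum_sub_distrib]
  exact Finset.sum_congr rfl fun i _ => Finset.sum_congr rfl fun j _ => by ring

/-- Permits entrywise comparison after symmetrization, where the symmetry of `B`, `C` and of second
derivatives can be used. -/
theorem sum_sum_eq_of_symm {E F : Fin n → Fin n → ℂ}
    (h : ∀ i j, E i j + E j i = F i j + F j i) : ∑ i, ∑ j, E i j = ∑ i, ∑ j, F i j := by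
  have key : ∀ G : Fin n → Fin n → ℂ, ∑ i, ∑ j, (G i j + G j i) = 2 * ∑ i, ∑ j, G i j := by
    intro G
    simp only [Finset.sum_add_distrib]
    rw [Finset.sum_comm (f := fun i j => G j i)]
    ring
  have h1 := key E
  rw [Finset.sum_congr rfl fun i _ => Finset.sum_congr rfl fun j _ => h i j, key F] at h1
  exact (mul_left_cancel₀ two_ne_zero h1).symm

/-- The scalar terms match as follows. Reordering the mixed products of creation and annihilation
operators produces half the trace of `cayleyP`, which cancels the term from `(det P)^{-1/2}`. The
commutators in the pure products give `-(tr A)/2`, exactly the constant in the Weyl quantization of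
`i y·Ax`. -/
theorem ladderOp_apply_eq_weylOp {A B C : Matrix (Fin n) (Fin n) ℝ} (hB : Bᵀ = B) (hC : Cᵀ = C)
    (x : EuclideanSpace ℝ (Fin n)) :
    ladderOp (-(1 / 2) * (cayleyP (Matrix.fromBlocks A B C (-Aᵀ))).trace)
      ((cayleyQ (Matrix.fromBlocks A B C (-Aᵀ))).map star)
      (-(cayleyP (Matrix.fromBlocks A B C (-Aᵀ)))ᵀ) (cayleyQ (Matrix.fromBlocks A B C (-Aᵀ))) φ x =
      weylOp (quadraticSymbol A B C) φ x := by
  set G := Matrix.fromBlocks A B C (-Aᵀ) with hG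
  have hp : ∀ i j, cayleyP G i j = 1 / 2 * ((A i j - A j i) + Complex.I * (C i j - B i j)) := by
    intro i j
    rw [cayleyP_apply]
    simp [hG, sub_eq_add_neg]
  have hq : ∀ i j, cayleyQ G i j = 1 / 2 * ((A i j + A j i) + Complex.I * (B i j + C i j)) := by
    intro i j
    rw [cayleyQ_apply]
    simp [hG]
  have hqs : ∀ i j, star (cayleyQ G i j) =
      1 / 2 * ((A i j + A j i) - Complex.I * (B i j + C i j)) := by
    intro i j
    rw [hq]
    simp [sub_eq_add_neg]
  have hB' : ∀ i j, B j i = B i j := fun i j => congrFun (congrFun hB i) j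
  have hC' : ∀ i j, C j i = C i j := fun i j => congrFun (congrFun hC i) j
  -- The trace is spread over a double sum so that it can join the entrywise comparison.
  have htr : (cayleyP G).trace * φ x =
      ∑ i, ∑ j, (if i = j then (1 : ℂ) else 0) * cayleyP G i j * φ x := by
    simp [Matrix.trace, Finset.sum_mul]
  rw [weylOp_eq_weylLinear, quadraticSymbol, ladderOp]
  simp only [map_sum, map_add, map_sub, map_smul, weylLinear_X_mul_X_inl_inl,
    weylLinear_X_mul_X_inr_inr, weylLinear_X_mul_X_inr_inl, creation, annihilation,
    LinearMap.add_apply, LinearMap.sub_apply]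
  simp only [add_apply, sub_apply, smul_apply,
    _root_.sum_apply, smul_eq_mul, coordMul_apply, coordDeriv_coordMul_apply, mul_assoc, htr]
  simp only [Finset.mul_sum, mul_add, mul_sub, ← Finset.sum_add_distrib, ← Finset.sum_sub_distrib]
  refine sum_sum_eq_of_symm fun i j => ?_
  simp only [Matrix.map_apply, Matrix.neg_apply, Matrix.transpose_apply, hqs]
  simp only [hp, hq, hB' i j, hC' i j, coordDeriv_comm_apply φ j i]
  by_cases hij : i = j
  · subst hij
    simp only [if_true]
    ring_nf
    simp only [Complex.I_sq]
    ring
  · simp only [hij, Ne.symm hij, if_false]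
    ring_nf
    simp only [Complex.I_sq]
    ring

end QuadraticSymbols

/-! ### The Weyl symbol of the differential. -/

section MetaplecticSymbol

variable {n : ℕ} {A B C : Matrix (Fin n) (Fin n) ℝ}

theorem symm_of_fromBlocks_mem_sp
    (hX : Matrix.fromBlocks A B C (-Aᵀ) ∈ LieAlgebra.Symplectic.sp (Fin n) ℝ) :
    Bᵀ = B ∧ Cᵀ = C := by
  have h1 := transpose_mul_J_of_mem_sp hX
  rw [Matrix.J, Matrix.fromBlocks_transpose, Matrix.fromBlocks_neg, Matrix.fromBlocks_multiply,
    Matrix.fromBlocks_multiply, Matrix.fromBlocks_inj] at h1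
  obtain ⟨h2, -, -, h3⟩ := h1
  simp only [mul_zero, zero_add, add_zero, mul_one, zero_mul, one_mul, mul_neg, neg_mul,
    neg_neg, neg_inj, neg_zero] at h2 h3
  exact ⟨h3, h2⟩

theorem isWeylSymbol_dMetaplectic
    (hX : Matrix.fromBlocks A B C (-Aᵀ) ∈ LieAlgebra.Symplectic.sp (Fin n) ℝ) :
    IsWeylSymbol (dMetaplectic (Matrix.fromBlocks A B C (-Aᵀ))) (quadraticSymbol A B C) := by
  intro φ
  obtain ⟨hB, hC⟩ := symm_of_fromBlocks_mem_sp hX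
  have h1 := hasDerivAt_metaplectic hX φ
  refine ⟨_, ⟨h1.differentiableAt, h1.deriv⟩, ?_⟩
  filter_upwards [SchwartzMap.coeFn_toLp (ladderOp _ _ _ _ φ) 2 volume] with x hx
  rw [hx, ladderOp_apply_eq_weylOp φ hB hC]

theorem two_mul_dotProduct_eq_neg_standardJ (x y : Fin n → ℝ) :
    2 * (y ⬝ᵥ A *ᵥ x) + y ⬝ᵥ B *ᵥ y - x ⬝ᵥ C *ᵥ x =
      -(Sum.elim x y ⬝ᵥ (standardJ n * Matrix.fromBlocks A B C (-Aᵀ)) *ᵥ Sum.elim x y) := by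
  have h1 : x ⬝ᵥ Aᵀ *ᵥ y = y ⬝ᵥ A *ᵥ x := by
    rw [Matrix.mulVec_transpose, dotProduct_comm, Matrix.dotProduct_mulVec]
  rw [standardJ, Matrix.fromBlocks_multiply, Matrix.fromBlocks_mulVec]
  simp [Matrix.neg_mulVec, dotProduct_add, h1]
  ring

end MetaplecticSymbol

theorem mainTheorem8 (n : ℕ) (A B C : Matrix (Fin n) (Fin n) ℝ)
    (hX : Matrix.fromBlocks A B C (-Aᵀ) ∈ LieAlgebra.Symplectic.sp (Fin n) ℝ) :
    (∃! f : MvPolynomial (Fin n ⊕ Fin n) ℂ,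
      IsWeylSymbol (dMetaplectic (Matrix.fromBlocks A B C (-Aᵀ))) f) ∧
    ∀ x y : Fin n → ℝ,
      weylSymbol (dMetaplectic (Matrix.fromBlocks A B C (-Aᵀ))) x y =
          (1 / 2) * Complex.I *
            ((2 * (y ⬝ᵥ A *ᵥ x) + y ⬝ᵥ B *ᵥ y - x ⬝ᵥ C *ᵥ x : ℝ) : ℂ) ∧
      (1 / 2) * Complex.I * ((2 * (y ⬝ᵥ A *ᵥ x) + y ⬝ᵥ B *ᵥ y - x ⬝ᵥ C *ᵥ x : ℝ) : ℂ) =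
          -(1 / 2) * Complex.I *
            ((Sum.elim x y ⬝ᵥ
              (standardJ n * Matrix.fromBlocks A B C (-Aᵀ)) *ᵥ Sum.elim x y : ℝ) : ℂ) := by
  have h1 := isWeylSymbol_dMetaplectic hX
  refine ⟨⟨_, h1, fun f hf => hf.unique h1⟩, fun x y => ⟨?_, ?_⟩⟩
  -- By uniqueness the polynomial chosen in `weylSymbol` is `quadraticSymbol A B C`.
  · rw [weylSymbol, (Classical.epsilon_spec ⟨_, h1⟩).unique h1, eval_quadraticSymbol]
  · rw [two_mul_dotProduct_eq_neg_standardJ, Complex.ofReal_neg]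
    ring
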